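/- **Setting.** Let $d\ge 3$ (for instance $d=5$) and consider the quartic melonic $U(1)^d$ tensor field theory with complex field $T_{\vec p}$, $\vec p\in\mathbb Z^d$, and interaction $\lambda\sum_{i=1}^d V_i$, where $V_i=\sum T_{\vec p}\bar T_{\vec p'}T_{\vec q}\bar T_{\vec q'}$ is summed over momenta with $p_c=p'_c$, $q_c=q'_c$ for $c\ne i$ and $p_i=q'_i$, $q_i=p'_i$. The bare coupling is $\lambda=Z_\lambda\lambda_{41}^r$. At scale $s$ the covariance is $$C_s(\vec p)=\frac{\chi(\vec p)}{Z_{-\infty}\vec p^{\,2}+m^2+\chi(\vec p)\,r_s(\vec p)},\qquad\text{i.e. } C_s^{-1}=\chi^{-1}(Z_{-\infty}\vec p^{\,2}+m^2)+r_s\ \text{ where }\chi\neq0,$$ with a UV cut-off function $\chi$, real constants $Z_{-\infty},m^2$, and an IR regulator $r_s$; the theory at $s=-\infty$ is the one with $r\equiv0$. A Feynman graph of order $n$ is a Wick contraction of $n$ labelled vertices, with colours $i\in\{1,\dots,d\}$, and $N$ external fields of each type $T,\bar T$; it has weight $(-\lambda)^n/n!$ times the sum, over the momenta of its lines compatible with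 the vertices and the external momenta, of the product of the propagators $C_s$ of its internal lines (external legs amputated). A graph with $V=n$ vertices and $L$ internal lines is *melonic* if its number of closed faces is $F=(d-1)(L-V+1)$. The *melonic sector*, which is the leading sector in the deep UV, is defined as follows. * $\Sigma_s(\vec p)$ is the sum of all one-particle irreducible (1PI) melonic two-point graphs at momentum $\vec p$, and $G_s=C_s/(1-C_s\Sigma_s)$, i.e. $G_s^{-1}=C_s^{-1}-\Sigma_s$ where $C_s\neq0$. * $\Gamma^{(4),i}_s$ is minus the sum, at zero external momenta, of all 1PI melonic four-point graphs whose boundary graph is the quartic melon of colour $i$ (the external faces of colours $c\ne i$ pair the external fields in one way, those of colour $i$ in the other way). * For a fixed colour $i$, $\lambda_{41}(s)=\tfrac14\Gamma^{(4),i}_s$ is the effective coupling and $\mathcal A_s=\sum_{\vec p\in\mathbb Z^d,\ p_i=0}G_s(\vec p)^2$ (a sum over $\mathbb Z^{d-1}$) is the effective loop; $\mathcal A_{-\infty}$ is its value for $r\equiv 0$, and $\bar{\mathcal A}_s=\mathcal A_s-\mathcal A_{-\infty}$. **Assumptions.** $\lambda_{41}^r$ is the renormalized coupling: $\Gamma^{(4),i}_{-\infty}=4\lambda_{41}^r$.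 For $r\equiv0$ and for $r_s$ with $s$ in an open set $U\subset\mathbb R$ of scales, the theory is in the perturbative (symmetric) phase: the denominator of $C_s$ does not vanish where $\chi\ne0$, $\sum_{\vec p}|C_s(\vec p)|<\infty$, and the series over graphs and line momenta that define $\Sigma_s(\vec p)$ (for every $\vec p$) and $\Gamma^{(4),i}_s$ converge absolutely. **Claim (structure equation).** At $s=-\infty$ and for every $s\in U$, one has $1-C_s\Sigma_s\ne0$ everywhere and the sum $\mathcal A_s$ converges. For every $s\in U$, one has $1+2\lambda_{41}^r\bar{\mathcal A}_s\neq0$ and $$\lambda_{41}(s)=\frac{\lambda_{41}^r}{1+2\lambda_{41}^r\,\bar{\mathcal A}_s}.$$ Consequently, at every $s\in U$ where $\mathcal A_s$ is differentiable, $\lambda_{41}$ is differentiable and $$\partial_s\lambda_{41}(s)=-2\,\lambda_{41}(s)^2\,\partial_s\mathcal A_s .$$ -/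

import Mathlib

open scoped Nat

noncomputable section

namespace TGFT

/-- Momenta of a rank-`d` tensor field over `U(1)^d`. -/
abbrev Mom (d : ℕ) := Fin d → ℤ

/-- `p² = p_1² + ⋯ + p_d²`. -/
def normSq {d : ℕ} (p : Mom d) : ℝ := ∑ j, (p j : ℝ) ^ 2

/-- A Feynman graph (Wick contraction) with `n` labelled quartic melonic vertices and `N` labelled
external fields of each type.  Vertex `v` of colour `i` stands for
`∑ T_p T̄_p' T_q T̄_q'` with `p_c = p'_c`, `q_c = q'_c` for `c ≠ i` and `p_i = q'_i`, `q_i = p'_i`;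
its two fields `T` (and its two fields `T̄`) are indexed by `(v, a)` with `a : Bool`.
The bijection `wick` sends every field `T` (of a vertex, `Sum.inl`, or external, `Sum.inr`) to the
field `T̄` with which it is contracted. -/
structure FeynmanGraph (d n N : ℕ) where
  color : Fin n → Fin d
  wick : (Fin n × Bool) ⊕ Fin N ≃ (Fin n × Bool) ⊕ Fin N

namespace FeynmanGraph

variable {d n N : ℕ}

/-- The strand of colour `c` inside a vertex: the field `T̄` numbered `(v, a)` shares its index of
colour `c` with the field `T` numbered `strand c (v, a)`. -/
def strand (G : FeynmanGraph d n N) (c : Fin d) : Fin n × Bool ≃ Fin n × Bool where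
  toFun h := (h.1, if c = G.color h.1 then !h.2 else h.2)
  invFun h := (h.1, if c = G.color h.1 then !h.2 else h.2)
  left_inv := by
    rintro ⟨v, a⟩
    by_cases hc : c = G.color v <;> simp [hc]
  right_inv := by
    rintro ⟨v, a⟩
    by_cases hc : c = G.color v <;> simp [hc]

/-- The line starting at the vertex field `T` numbered `h` is internal if it ends at a vertex (and
not at an external field). -/
def IsInternal (G : FeynmanGraph d n N) (h : Fin n × Bool) : Prop :=
  (G.wick (Sum.inl h)).isLeft

/-- Number `L` of internal lines. -/
def numLines (G : FeynmanGraph d n N) : ℕ := {h | G.IsInternal h}.ncard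

/-- One step along the face of colour `c`: follow the line from a field `T` to a field `T̄`, then
the strand of colour `c` through the vertex to the next field `T`.  An external `T̄_k` is sent to
the external `T_k`, so that the map is a permutation. -/
def faceStep (G : FeynmanGraph d n N) (c : Fin d) :
    Equiv.Perm ((Fin n × Bool) ⊕ Fin N) :=
  G.wick.trans (Equiv.sumCongr (G.strand c) (Equiv.refl (Fin N)))

/-- The internal (closed) faces of colour `c`: the cycles of `faceStep c`, fixed points included,
that do not meet any external field. -/
def internalFaces (G : FeynmanGraph d n N) (c : Fin d) : Set (Set ((Fin n × Bool) ⊕ Fin N)) :=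
  {O | (∃ x, O = {y | (G.faceStep c).SameCycle x y}) ∧ ∀ k : Fin N, Sum.inr k ∉ O}

/-- Number `F` of internal faces. -/
def numFaces (G : FeynmanGraph d n N) : ℕ := ∑ c, (G.internalFaces c).ncard

/-- The external face of colour `c` that starts at the external `T_k` ends at the external
`T̄_l`. -/
def ExternalFace (G : FeynmanGraph d n N) (c : Fin d) (k l : Fin N) : Prop :=
  ∃ m : ℕ, ((G.faceStep c) ^ (m + 1)) (Sum.inr k) = Sum.inr l ∧
    ∀ j < m, (((G.faceStep c) ^ (j + 1)) (Sum.inr k)).isLeft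

/-- Two vertices are joined by an internal line other than the line starting at one of the fields
in `cut`. -/
def Joined (G : FeynmanGraph d n N) (cut : Set (Fin n × Bool)) (v w : Fin n) : Prop :=
  ∃ a b : Bool, (v, a) ∉ cut ∧ G.wick (Sum.inl (v, a)) = Sum.inl (w, b)

/-- The vertices remain connected after the lines in `cut` have been removed. -/
def ConnectedWithout (G : FeynmanGraph d n N) (cut : Set (Fin n × Bool)) : Prop :=
  ∀ v w : Fin n, Relation.EqvGen (G.Joined cut) v w

/-- One-particle irreducible graph: it has a vertex, all external fields are hooked to vertices, it
is connected, and it stays connected when any one line is removed. -/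
def OnePI (G : FeynmanGraph d n N) : Prop :=
  0 < n ∧
  (∀ k : Fin N, (G.wick (Sum.inr k)).isLeft ∧ (G.wick.symm (Sum.inr k)).isLeft) ∧
  G.ConnectedWithout ∅ ∧ ∀ h, G.ConnectedWithout {h}

/-- Melonic graph (with external fields): the number of internal faces takes the value
`F = (d - 1) (L - V + 1)`. -/
def Melonic (G : FeynmanGraph d n N) : Prop :=
  (G.numFaces : ℤ) = ((d : ℤ) - 1) * ((G.numLines : ℤ) - (n : ℤ) + 1)

/-- The boundary graph of a four-point graph is the quartic melon of colour `i`: the external faces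
of colours `c ≠ i` join the external fields according to one pairing, those of colour `i` according
to the other pairing. -/
def BoundaryMelon (G : FeynmanGraph d n 2) (i : Fin d) : Prop :=
  ∃ π : Equiv.Perm (Fin 2), ∀ (c : Fin d) (k l : Fin 2),
    G.ExternalFace c k l ↔ (l = π k ↔ c ≠ i)

/-- `q h` is the momentum of the line starting at the vertex field `T` numbered `h`, `p k` that of
the external fields `T_k` and `T̄_k`.  The momenta are compatible if each line ending at an external
field carries its momentum, and each strand of colour `c` in a vertex transmits the `c`-th
component. -/
def Conserves (G : FeynmanGraph d n N) (p : Fin N → Mom d) (q : Fin n × Bool → Mom d) : Prop :=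
  (∀ k : Fin N, Sum.elim q p (G.wick.symm (Sum.inr k)) = p k) ∧
  ∀ (h : Fin n × Bool) (c : Fin d),
    Sum.elim q p (G.wick.symm (Sum.inl h)) c = q (G.strand c h) c

open Classical in
/-- Product of the propagators `C` over the internal lines (external legs are amputated). -/
def propagators (G : FeynmanGraph d n N) (C : Mom d → ℝ) (q : Fin n × Bool → Mom d) : ℝ :=
  ∏ h, if G.IsInternal h then C (q h) else 1

end FeynmanGraph

/-- Feynman graphs of all orders together with momenta of their lines. -/
abbrev LabelledGraph (d N : ℕ) := Σ n : ℕ, FeynmanGraph d n N × (Fin n × Bool → Mom d)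

open Classical in
/-- Contribution of a 1PI melonic two-point graph to the self-energy at external momentum `p`, in
the expansion of `∫ dμ_C exp(-lam * ∑_i V_i)`, where `V_i` is the quartic melon of colour `i`. -/
def selfEnergyTerm {d : ℕ} (C : Mom d → ℝ) (lam : ℝ) (p : Mom d) (x : LabelledGraph d 1) : ℝ :=
  if x.2.1.OnePI ∧ x.2.1.Melonic ∧ x.2.1.Conserves (fun _ => p) x.2.2 then
    (-lam) ^ x.1 / (x.1)! * x.2.1.propagators C x.2.2
  else 0

/-- The melonic self-energy `Σ(p)` for the covariance `C` and the bare coupling `lam`. -/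
def selfEnergy {d : ℕ} (C : Mom d → ℝ) (lam : ℝ) (p : Mom d) : ℝ :=
  ∑' x, selfEnergyTerm C lam p x

/-- The effective propagator, `G(p)⁻¹ = C(p)⁻¹ - Σ(p)` (and `G(p) = 0` where `C(p) = 0`). -/
def effPropagator {d : ℕ} (C : Mom d → ℝ) (lam : ℝ) (p : Mom d) : ℝ :=
  C p / (1 - C p * selfEnergy C lam p)

open Classical in
/-- Contribution of a 1PI melonic four-point graph of colour `i`, at zero external momenta. -/
def vertexTerm {d : ℕ} (C : Mom d → ℝ) (lam : ℝ) (i : Fin d) (x : LabelledGraph d 2) : ℝ :=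
  if x.2.1.OnePI ∧ x.2.1.Melonic ∧ x.2.1.BoundaryMelon i ∧
      x.2.1.Conserves (fun _ => 0) x.2.2 then
    (-lam) ^ x.1 / (x.1)! * x.2.1.propagators C x.2.2
  else 0

/-- The monocoloured component `Γ⁽⁴⁾ⁱ` of the melonic 1PI four-point function at zero momenta (a
derivative of the effective action, so minus the sum of the amputated 1PI graphs). -/
def gammaFour {d : ℕ} (C : Mom d → ℝ) (lam : ℝ) (i : Fin d) : ℝ :=
  -∑' x, vertexTerm C lam i x

/-- The effective quartic melonic coupling, `λ₄₁ = Γ⁽⁴⁾ⁱ / 4`. -/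
def effCoupling {d : ℕ} (C : Mom d → ℝ) (lam : ℝ) (i : Fin d) : ℝ :=
  gammaFour C lam i / 4

/-- The effective loop `𝒜 = ∑ G(p)²` over the momenta `p ∈ ℤ^(d-1)`, that is `p ∈ ℤ^d`
with `p_i = 0`. -/
def effLoop {d : ℕ} (C : Mom d → ℝ) (lam : ℝ) (i : Fin d) : ℝ :=
  ∑' p : {p : Mom d // p i = 0}, effPropagator C lam p.1 ^ 2

/-- The regularized covariance with UV cut-off function `χ`, wave function and mass counterterms
`Z` and `m2`, and IR regulator `r`: `C⁻¹ = (Z p² + m2) / χ + r` (and `C = 0` where `χ = 0`). -/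
def covariance {d : ℕ} (χ : Mom d → ℝ) (Z m2 : ℝ) (r : Mom d → ℝ) (p : Mom d) : ℝ :=
  χ p / (Z * normSq p + m2 + χ p * r p)

/-- The symmetric phase: the covariance exists and makes momentum sums converge, and the
perturbative expansions of the melonic self-energy and four-point function converge absolutely. -/
structure Perturbative {d : ℕ} (χ : Mom d → ℝ) (Z m2 : ℝ) (r : Mom d → ℝ) (lam : ℝ)
    (i : Fin d) : Prop where
  denom : ∀ p, χ p ≠ 0 → Z * normSq p + m2 + χ p * r p ≠ 0
  uv : Summable (covariance χ Z m2 r)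
  selfEnergy : ∀ p, Summable (selfEnergyTerm (covariance χ Z m2 r) lam p)
  vertex : Summable (vertexTerm (covariance χ Z m2 r) lam i)

end TGFT

end

/-!
Melonic graphs are trees in disguise, and the structure equation is a geometric series.

Every vertex is cut into its two halves, so that the lines of a graph form closed walks, once every
external `T̄_k` is glued to `T_k`.  Crossing the vertices of colour `c` turns these walks into the
faces of colour `c`.  A crossing multiplies a permutation by a transposition, which changes the
number of cycles by one; counting shows that, for `d ≥ 3`, a connected graph has at most
`(d - 1) n + d` faces, with equality if and only if every vertex is a bridge between its two halves
(`FeynmanGraph.sum_classCount_faceStep_eq_iff`).  For 1PI graphs this is the melonic condition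
(`OnePI.melonic_iff_treeLike_two`, `OnePI.melonic_iff_treeLike_four`).

In such a tree-like graph a line from one field to another is a dressed line: it is bare, or runs
into a vertex whose other half carries a loop, again a dressed line, and goes on as a dressed line
(`Segment.exists_line`).  Hence dressed lines are decorated binary trees.  A 1PI melonic two-point
graph is a vertex with one dressed line on its second half (`exists_isTwo`).  A 1PI melonic
four-point graph with a boundary graph of colour `i` is a chain of vertices of colour `i`, with two
dressed lines between consecutive vertices (`exists_isFour`); the two pairings of the external
fields give two copies of these.  Conversely every tree and every chain defines such a graph, and
the description is unique once the vertices and their halves are labelled.  There are `n! 2ⁿ`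
labellings of the `n` vertices, which cancels the `1 / n!` and gives each vertex the weight `-2 λ`
(`hasSum_selfEnergy`, `hasSum_vertex`).

Summing over trees gives the Dyson equation `G = C + C Σ G` (`tsum_lineWeight_eq`), so that
`1 - C Σ ≠ 0` and `G` is the effective propagator.  Summing over chains gives a series
`X = 1 - 2 λ 𝒜 X` (`tsum_list_prod_eq`), so that `1 + 2 λ 𝒜 ≠ 0` and
`λ₄₁ = λ / (1 + 2 λ 𝒜)` (`effCoupling_eq`).  For `λ ≠ 0`, the absolute convergence of the sums over
trees and steps is inherited from that of the sums over graphs, since each of them is, up to a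
factor, a part of one of these; for `λ = 0` nothing but bare lines is left.
The comparison of the formula for `λ₄₁` with its value for a vanishing regulator eliminates the
bare coupling `λ`.
-/

noncomputable section

namespace TGFT

/-! ### Merging classes of an equivalence relation -/

section Setoids

variable {X : Type*}

/-- The equivalence relation whose only nontrivial relation is `a ~ b`. -/
def pairSetoid (a b : X) : Setoid X := Relation.EqvGen.setoid fun x y => x = a ∧ y = b

theorem pairSetoid_rel (a b : X) : pairSetoid a b a b := Relation.EqvGen.rel _ _ ⟨rfl, rfl⟩

theorem pairSetoid_le {a b : X} {s : Setoid X} : pairSetoid a b ≤ s ↔ s a b := by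
  constructor
  · intro h
    exact h (pairSetoid_rel a b)
  · intro h
    refine Setoid.eqvGen_le ?_
    rintro x y ⟨rfl, rfl⟩
    exact h

/-- The number of classes of an equivalence relation. -/
def classCount (s : Setoid X) : ℕ := Nat.card (Quotient s)

theorem classCount_sup_pair_of_rel {s : Setoid X} {a b : X} (h : s a b) :
    classCount (s ⊔ pairSetoid a b) = classCount s := by
  rw [sup_eq_left.2 (pairSetoid_le.2 h)]

/-- Identifying two inequivalent points decreases the number of classes by one. -/
theorem classCount_sup_pair_of_not_rel [Finite X] {s : Setoid X} {a b : X} (h : ¬ s a b) :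
    classCount (s ⊔ pairSetoid a b) + 1 = classCount s := by
  classical
  -- `g` moves the class of `b` to that of `a`; its kernel is the new relation.
  let g : X → Quotient s := fun x => if s x b then Quotient.mk s a else Quotient.mk s x
  have hg : s ⊔ pairSetoid a b ≤ Setoid.ker g := by
    refine sup_le ?_ (pairSetoid_le.2 ?_)
    · intro x y hxy
      have : s x b ↔ s y b := ⟨fun h' => s.trans' (s.symm' hxy) h', fun h' => s.trans' hxy h'⟩
      have hq : Quotient.mk s x = Quotient.mk s y := Quotient.sound hxy
      simp [Setoid.ker_def, g, this, hq]
    · simp [Setoid.ker_def, g]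
  let f : {z : Quotient s // z ≠ Quotient.mk s b} → Quotient (s ⊔ pairSetoid a b) := fun z =>
    Setoid.map_of_le le_sup_left z.1
  have hf : Function.Bijective f := by
    constructor
    · rintro ⟨z, hz⟩ ⟨w, hw⟩ hzw
      induction z using Quotient.inductionOn with | _ x
      induction w using Quotient.inductionOn with | _ y
      have hx : ¬ s x b := fun h' => hz (Quotient.sound h')
      have hy : ¬ s y b := fun h' => hw (Quotient.sound h')
      have hr : (s ⊔ pairSetoid a b) x y := Quotient.exact hzw
      have := hg hr
      simp only [Setoid.ker_def, g, if_neg hx, if_neg hy] at this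
      exact Subtype.ext this
    · intro z
      induction z using Quotient.inductionOn with | _ x
      by_cases hx : s x b
      · refine ⟨⟨Quotient.mk s a, fun h' => h (Quotient.exact h')⟩, ?_⟩
        refine Quotient.sound (s := s ⊔ pairSetoid a b) ?_
        have h1 : s ⊔ pairSetoid a b ≥ pairSetoid a b := le_sup_right
        have h2 : s ⊔ pairSetoid a b ≥ s := le_sup_left
        exact Setoid.trans' _ (h1 (pairSetoid_rel a b)) (h2 (s.symm' hx))
      · exact ⟨⟨Quotient.mk s x, fun h' => hx (Quotient.exact h')⟩, rfl⟩
  have h1 : Nat.card {z : Quotient s // z ≠ Quotient.mk s b} = classCount (s ⊔ pairSetoid a b) :=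
    Nat.card_congr (Equiv.ofBijective f hf)
  have h2 := Set.ncard_add_ncard_compl ({Quotient.mk s b} : Set (Quotient s))
  rw [Set.ncard_singleton] at h2
  rw [← h1, classCount, ← h2, add_comm]
  rfl

theorem classCount_le_sup_pair [Finite X] (s : Setoid X) (a b : X) :
    classCount s ≤ classCount (s ⊔ pairSetoid a b) + 1 := by
  by_cases h : s a b
  · rw [classCount_sup_pair_of_rel h]; omega
  · rw [classCount_sup_pair_of_not_rel h]

theorem classCount_top [Nonempty X] {s : Setoid X} (h : ∀ x y, s x y) : classCount s = 1 := by
  have : Subsingleton (Quotient s) := by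
    rw [Quotient.subsingleton_iff, Setoid.eq_top_iff]; exact h
  have : Nonempty (Quotient s) := ‹Nonempty X›.map (Quotient.mk s)
  exact Nat.card_eq_one_iff_unique.2 ⟨inferInstance, inferInstance⟩

end Setoids

/-! ### Cycles of a permutation multiplied by a transposition -/

section Perms

variable {X : Type*}

/-- The equivalence relation whose classes are the cycles of `f`, fixed points included. -/
abbrev cyc (f : Equiv.Perm X) : Setoid X := Equiv.Perm.SameCycle.setoid f

theorem cyc_apply (f : Equiv.Perm X) (x : X) : cyc f x (f x) := ⟨1, by simp⟩

theorem cyc_le {f : Equiv.Perm X} {s : Setoid X} : cyc f ≤ s ↔ ∀ x, s x (f x) := by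
  constructor
  · intro h x
    exact h (cyc_apply f x)
  · rintro h x y ⟨m, rfl⟩
    have hpow : ∀ (m : ℕ) z, s z ((f ^ m) z) := by
      intro m
      induction m with
      | zero => intro z; exact s.refl' z
      | succ k ih =>
        intro z
        rw [pow_succ', Equiv.Perm.mul_apply]
        exact s.trans' (ih z) (h _)
    rcases m with m | m
    · exact hpow m x
    · have := hpow (m + 1) ((f ^ (Int.negSucc m)) x)
      refine s.symm' ?_
      rwa [← Equiv.Perm.mul_apply, ← zpow_natCast, ← zpow_add,
        show ((m + 1 : ℕ) : ℤ) + Int.negSucc m = 0 by omega, zpow_zero,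
        Equiv.Perm.one_apply] at this

variable [DecidableEq X]

theorem cyc_swap_mul_le (f : Equiv.Perm X) (a b : X) :
    cyc (Equiv.swap a b * f) ≤ cyc f ⊔ pairSetoid a b := by
  rw [cyc_le]
  intro x
  have h1 : pairSetoid a b ≤ cyc f ⊔ pairSetoid a b := le_sup_right
  have h2 : cyc f ≤ cyc f ⊔ pairSetoid a b := le_sup_left
  have hx := h2 (cyc_apply f x)
  have hab := h1 (pairSetoid_rel a b)
  rw [Equiv.Perm.mul_apply]
  refine Setoid.trans' _ hx ?_
  by_cases ha : f x = a
  · rw [ha, Equiv.swap_apply_left]; exact hab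
  · by_cases hb : f x = b
    · rw [hb, Equiv.swap_apply_right]; exact Setoid.symm' _ hab
    · rw [Equiv.swap_apply_of_ne_of_ne ha hb]

theorem cyc_swap_mul_sup (f : Equiv.Perm X) (a b : X) :
    cyc (Equiv.swap a b * f) ⊔ pairSetoid a b = cyc f ⊔ pairSetoid a b := by
  refine le_antisymm (sup_le (cyc_swap_mul_le f a b) le_sup_right) (sup_le ?_ le_sup_right)
  have := cyc_swap_mul_le (Equiv.swap a b * f) a b
  rwa [← mul_assoc, Equiv.swap_mul_self, one_mul] at this

/-- Multiplication by a transposition joins the two cycles that contain its two points. -/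
theorem cyc_swap_mul_of_not_rel [Finite X] {f : Equiv.Perm X} {a b : X} (h : ¬ cyc f a b) :
    cyc (Equiv.swap a b * f) = cyc f ⊔ pairSetoid a b := by
  have hab : cyc (Equiv.swap a b * f) a b := by
    have hex : ∃ m : ℕ, (f ^ (m + 1)) a = a := ⟨orderOf f - 1, by
      rw [Nat.sub_add_cancel (orderOf_pos f), pow_orderOf_eq_one]; rfl⟩
    classical
    have hmin : ∀ {j}, j < Nat.find hex → _ := fun hj => Nat.find_min hex hj
    have hspec := Nat.find_spec hex
    set m := Nat.find hex
    -- The orbit of `a` under `f` avoids `b`, so that the new permutation follows it until it would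
    -- return to `a`, and then goes to `b` instead.
    have key : ∀ j ≤ m, ((Equiv.swap a b * f) ^ j) a = (f ^ j) a := by
      intro j
      induction j with
      | zero => intro _; rfl
      | succ j ih =>
        intro hj
        rw [pow_succ', Equiv.Perm.mul_apply, ih (by omega), Equiv.Perm.mul_apply,
          ← Equiv.Perm.mul_apply f, ← pow_succ']
        refine Equiv.swap_apply_of_ne_of_ne (hmin (by omega)) ?_
        intro hb
        exact h ⟨(j + 1 : ℕ), by rw [zpow_natCast]; exact hb⟩
    refine ⟨(m + 1 : ℕ), ?_⟩
    rw [zpow_natCast, pow_succ', Equiv.Perm.mul_apply, key m le_rfl, Equiv.Perm.mul_apply,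
      ← Equiv.Perm.mul_apply f, ← pow_succ', hspec, Equiv.swap_apply_left]
  rw [← cyc_swap_mul_sup, sup_eq_left.2 (pairSetoid_le.2 hab)]

theorem classCount_cyc_swap_mul_of_not_rel [Finite X] {f : Equiv.Perm X} {a b : X}
    (h : ¬ cyc f a b) : classCount (cyc (Equiv.swap a b * f)) + 1 = classCount (cyc f) := by
  rw [cyc_swap_mul_of_not_rel h, classCount_sup_pair_of_not_rel h]

theorem classCount_cyc_swap_mul_le [Finite X] (f : Equiv.Perm X) (a b : X) :
    classCount (cyc (Equiv.swap a b * f)) ≤ classCount (cyc f) + 1 := by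
  by_cases h : cyc f a b
  · refine (classCount_le_sup_pair _ a b).trans ?_
    rw [cyc_swap_mul_sup, classCount_sup_pair_of_rel h]
  · have := classCount_cyc_swap_mul_of_not_rel h
    omega

end Perms

/-! ### Faces of connected graphs -/

/-- The fields of one type (`T` or `T̄`) of a graph.  The fields `T` and `T̄` with the same name are
identified, which turns `wick` into a permutation: the walk along the fields that crosses every
vertex `v` from `T̄ (v, a)` to `T (v, a)`. -/
abbrev Fld (n N : ℕ) := (Fin n × Bool) ⊕ Fin N

/-- The other half of a vertex. -/
def opp {n : ℕ} (h : Fin n × Bool) : Fin n × Bool := (h.1, !h.2)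

@[simp] theorem opp_fst {n : ℕ} (h : Fin n × Bool) : (opp h).1 = h.1 := rfl

@[simp] theorem opp_opp {n : ℕ} (h : Fin n × Bool) : opp (opp h) = h := by simp [opp]

theorem opp_ne {n : ℕ} (h : Fin n × Bool) : opp h ≠ h := by
  intro h'
  have := congrArg Prod.snd h'
  simp [opp] at this

theorem eq_or_eq_opp {n : ℕ} {x h : Fin n × Bool} (e : x.1 = h.1) : x = h ∨ x = opp h := by
  obtain ⟨v, a⟩ := x
  obtain ⟨w, b⟩ := h
  obtain rfl : v = w := e
  cases a <;> cases b <;> simp [opp]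

/-- The permutation that exchanges the two halves of the vertices in `E`. -/
def flip {n : ℕ} (N : ℕ) (E : Finset (Fin n)) : Equiv.Perm (Fld n N) where
  toFun := Sum.map (fun h => (h.1, if h.1 ∈ E then !h.2 else h.2)) id
  invFun := Sum.map (fun h => (h.1, if h.1 ∈ E then !h.2 else h.2)) id
  left_inv := by
    rintro (⟨v, a⟩ | k)
    · by_cases hv : v ∈ E <;> simp [hv]
    · rfl
  right_inv := by
    rintro (⟨v, a⟩ | k)
    · by_cases hv : v ∈ E <;> simp [hv]
    · rfl

theorem flip_inr {n N : ℕ} (E : Finset (Fin n)) (k : Fin N) : flip N E (Sum.inr k) = Sum.inr k :=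
  rfl

theorem flip_empty {n N : ℕ} : flip N (∅ : Finset (Fin n)) = 1 := by
  ext x
  rcases x with h | k <;> simp [flip]

theorem flip_insert {n N : ℕ} {E : Finset (Fin n)} {v : Fin n} (hv : v ∉ E) :
    flip N (insert v E) = Equiv.swap (Sum.inl (v, false)) (Sum.inl (v, true)) * flip N E := by
  refine Equiv.ext ?_
  rintro (⟨w, a⟩ | k)
  · rw [Equiv.Perm.mul_apply]
    by_cases hw : w = v
    · subst hw
      cases a <;> simp [flip, hv]
    · have : flip N E (Sum.inl (w, a)) = Sum.inl (w, if w ∈ E then !a else a) := rfl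
      rw [this, Equiv.swap_apply_of_ne_of_ne (by simp [hw]) (by simp [hw])]
      simp [flip, hw]
  · rw [Equiv.Perm.mul_apply, flip_inr, flip_inr, Equiv.swap_apply_of_ne_of_ne] <;> simp

namespace FeynmanGraph

variable {d n N : ℕ} (G : FeynmanGraph d n N)

/-- The equivalence relation on the fields generated by the lines and by the vertices in `E`: the
vertices outside `E` are cut into their two halves. -/
def link (E : Finset (Fin n)) : Setoid (Fld n N) :=
  cyc G.wick ⊔ ⨆ v ∈ E, pairSetoid (Sum.inl (v, false)) (Sum.inl (v, true))

theorem link_empty : G.link ∅ = cyc G.wick := by simp [link]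

theorem link_insert (v : Fin n) (E : Finset (Fin n)) :
    G.link (insert v E) = G.link E ⊔ pairSetoid (Sum.inl (v, false)) (Sum.inl (v, true)) := by
  rw [link, link, Finset.iSup_insert, sup_assoc, sup_comm (pairSetoid _ _)]

theorem link_mono {E F : Finset (Fin n)} (h : E ⊆ F) : G.link E ≤ G.link F :=
  sup_le_sup_left (biSup_mono h) _

theorem link_wick (E : Finset (Fin n)) (x : Fld n N) : G.link E x (G.wick x) :=
  (le_sup_left : cyc G.wick ≤ G.link E) (cyc_apply _ _)

theorem link_cyc (E : Finset (Fin n)) {x y : Fld n N} (h : cyc G.wick x y) : G.link E x y :=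
  (le_sup_left : cyc G.wick ≤ G.link E) h

theorem link_opp {E : Finset (Fin n)} {h : Fin n × Bool} (hv : h.1 ∈ E) :
    G.link E (Sum.inl h) (Sum.inl (opp h)) := by
  have h1 : pairSetoid (Sum.inl (h.1, false)) (Sum.inl (h.1, true)) ≤ G.link E :=
    le_trans (le_iSup₂_of_le (f := fun v (_ : v ∈ E) =>
      pairSetoid (Sum.inl (v, false) : Fld n N) (Sum.inl (v, true))) h.1 hv le_rfl) le_sup_right
  have h2 := h1 (pairSetoid_rel _ _)
  obtain ⟨v, a⟩ := h
  cases a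
  · exact h2
  · exact Setoid.symm' _ h2

/-- Sets of fields stable under the lines and under the vertices of `E` are unions of classes of
`link E`. -/
theorem mem_iff_of_link {E : Finset (Fin n)} {S : Set (Fld n N)}
    (hw : ∀ x, x ∈ S ↔ G.wick x ∈ S)
    (hE : ∀ h : Fin n × Bool, h.1 ∈ E → Sum.inl h ∈ S → Sum.inl (opp h) ∈ S)
    {x y : Fld n N} (h : G.link E x y) : x ∈ S ↔ y ∈ S := by
  have hle : G.link E ≤ Setoid.ker fun x => x ∈ S := by
    refine sup_le (cyc_le.2 fun x => propext (hw x)) (iSup₂_le fun v hv => pairSetoid_le.2 ?_)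
    exact propext ⟨hE (v, false) hv, hE (v, true) hv⟩
  exact (hle h : (x ∈ S) = (y ∈ S)).to_iff

/-- The walk that crosses the vertices of `E` and follows the lines. -/
def partialStep (E : Finset (Fin n)) : Equiv.Perm (Fld n N) := flip N E * G.wick

theorem partialStep_empty : G.partialStep ∅ = G.wick := by rw [partialStep, flip_empty, one_mul]

theorem partialStep_insert {E : Finset (Fin n)} {v : Fin n} (hv : v ∉ E) :
    G.partialStep (insert v E) =
      Equiv.swap (Sum.inl (v, false)) (Sum.inl (v, true)) * G.partialStep E := by
  rw [partialStep, flip_insert hv, mul_assoc, partialStep]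

theorem faceStep_eq (c : Fin d) : G.faceStep c = G.partialStep {v | G.color v = c} := by
  refine Equiv.ext fun x => ?_
  simp only [faceStep, partialStep, Equiv.trans_apply, Equiv.Perm.mul_apply]
  rcases G.wick x with h | k
  · simp [flip, strand, eq_comm]
  · rfl

theorem cyc_partialStep_le (E : Finset (Fin n)) : cyc (G.partialStep E) ≤ G.link E := by
  refine cyc_le.2 fun x => ?_
  rw [partialStep, Equiv.Perm.mul_apply]
  have h1 := G.link_wick E x
  rcases hw : G.wick x with h | k
  · rw [hw] at h1
    refine Setoid.trans' _ h1 ?_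
    by_cases hv : h.1 ∈ E
    · have h2 := G.link_opp hv
      simpa [flip, hv, opp] using h2
    · simp [flip, hv]
  · rwa [hw] at h1

/-- Tree-like graphs: all fields are linked, and every vertex is needed to link its two halves. -/
def TreeLike : Prop :=
  (∀ x y, G.link Finset.univ x y) ∧
    ∀ v, ¬ G.link (Finset.univ.erase v) (Sum.inl (v, false)) (Sum.inl (v, true))

variable {G}

theorem TreeLike.not_link (hG : G.TreeLike) (h : Fin n × Bool) :
    ¬ G.link (Finset.univ.erase h.1) (Sum.inl h) (Sum.inl (opp h)) := by
  obtain ⟨v, a⟩ := h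
  cases a
  · exact hG.2 v
  · exact fun h' => hG.2 v (Setoid.symm' _ h')

theorem TreeLike.not_link_of_notMem (hG : G.TreeLike) {E : Finset (Fin n)} {v : Fin n}
    (hv : v ∉ E) : ¬ G.link E (Sum.inl (v, false)) (Sum.inl (v, true)) := fun h =>
  hG.2 v (G.link_mono (fun w hw => Finset.mem_erase.2
    ⟨fun e => hv (by rwa [← e]), Finset.mem_univ w⟩) h)

/-- In a tree-like graph, every crossing of a vertex joins two cycles of the walk, so that the faces
are the classes of the linking relation. -/
theorem TreeLike.cyc_partialStep (hG : G.TreeLike) (E : Finset (Fin n)) :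
    cyc (G.partialStep E) = G.link E := by
  induction E using Finset.induction_on with
  | empty => rw [partialStep_empty, link_empty]
  | insert v E hv ih =>
    rw [partialStep_insert _ hv, cyc_swap_mul_of_not_rel, ih, link_insert]
    rw [ih]
    exact hG.not_link_of_notMem hv

theorem TreeLike.cyc_faceStep (hG : G.TreeLike) (c : Fin d) :
    cyc (G.faceStep c) = G.link {v | G.color v = c} := by
  rw [faceStep_eq, hG.cyc_partialStep]

theorem TreeLike.classCount_link (hG : G.TreeLike) (E : Finset (Fin n)) :
    classCount (G.link E) + E.card = classCount (cyc G.wick) := by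
  induction E using Finset.induction_on with
  | empty => simp [link_empty]
  | insert v E hv ih =>
    have := classCount_sup_pair_of_not_rel (hG.not_link_of_notMem hv)
    rw [Finset.card_insert_of_notMem hv, link_insert]
    omega

variable (G)

/-- Every vertex joins at most two classes. -/
theorem classCount_wick_le (E : Finset (Fin n)) :
    classCount (cyc G.wick) ≤ classCount (G.link E) + E.card := by
  induction E using Finset.induction_on with
  | empty => simp [link_empty]
  | insert v E hv ih =>
    have := classCount_le_sup_pair (G.link E) (Sum.inl (v, false)) (Sum.inl (v, true))
    rw [← link_insert] at this
    rw [Finset.card_insert_of_notMem hv]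
    omega

/-- Crossing one more vertex of colour `c` changes the number of faces of colour `c` by at most
one, and decreases it if the vertex joins two classes. -/
theorem sum_classCount_partialStep_le (E : Finset (Fin n)) :
    ∑ c, classCount (cyc (G.partialStep (E.filter fun v => G.color v = c))) +
      2 * classCount (cyc G.wick) ≤
    d * classCount (cyc G.wick) + E.card + 2 * classCount (G.link E) := by
  induction E using Finset.induction_on with
  | empty => simp [link_empty, partialStep_empty]
  | insert v E hv ih =>
    rw [Finset.card_insert_of_notMem hv]
    rw [← Finset.add_sum_erase _ _ (Finset.mem_univ (G.color v))] at ih ⊢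
    have hrest : ∑ c ∈ Finset.univ.erase (G.color v),
          classCount (cyc (G.partialStep ((insert v E).filter fun w => G.color w = c))) =
        ∑ c ∈ Finset.univ.erase (G.color v),
          classCount (cyc (G.partialStep (E.filter fun w => G.color w = c))) := by
      refine Finset.sum_congr rfl fun c hc => ?_
      rw [Finset.filter_insert, if_neg (Finset.ne_of_mem_erase hc).symm]
    have hv' : v ∉ E.filter fun w => G.color w = G.color v := fun h => hv (Finset.mem_filter.1 h).1
    rw [hrest, Finset.filter_insert, if_pos rfl, partialStep_insert _ hv', link_insert]
    by_cases h : G.link E (Sum.inl (v, false)) (Sum.inl (v, true))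
    · rw [classCount_sup_pair_of_rel h]
      have := classCount_cyc_swap_mul_le (G.partialStep (E.filter fun w => G.color w = G.color v))
        (Sum.inl (v, false)) (Sum.inl (v, true))
      omega
    · have h1 := classCount_sup_pair_of_not_rel h
      have h2 : ¬ cyc (G.partialStep (E.filter fun w => G.color w = G.color v))
          (Sum.inl (v, false)) (Sum.inl (v, true)) := fun h' =>
        h (G.link_mono (Finset.filter_subset _ _) (G.cyc_partialStep_le _ h'))
      have h3 := classCount_cyc_swap_mul_of_not_rel h2
      omega

/-- A connected graph has at most `(d - 1) n + d` faces (external ones included, once they have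
been closed), with equality for the tree-like graphs only.  This uses `d ≥ 3`. -/
theorem sum_classCount_faceStep_eq_iff [Nonempty (Fld n N)] (hd : 3 ≤ d)
    (hc : ∀ x y, G.link Finset.univ x y) :
    ∑ c, classCount (cyc (G.faceStep c)) = (d - 1) * n + d ↔ G.TreeLike := by
  obtain ⟨e, rfl⟩ : ∃ e, d = e + 3 := ⟨d - 3, by omega⟩
  have h1 := classCount_top hc
  simp only [faceStep_eq]
  constructor
  · intro h
    refine ⟨hc, fun v hv => ?_⟩
    -- With `κ` the number of cycles of `wick`, the bound on the number of faces gives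
    -- `(d - 2) κ ≥ (d - 2) (n + 1)`, whereas a superfluous vertex `v` would give `κ ≤ n`.
    have h2 := G.sum_classCount_partialStep_le Finset.univ
    rw [h, Finset.card_univ, Fintype.card_fin, h1] at h2
    have h3 := G.classCount_wick_le (Finset.univ.erase v)
    have h4 := classCount_sup_pair_of_rel hv
    rw [← link_insert, Finset.insert_erase (Finset.mem_univ v), h1] at h4
    rw [← h4, Finset.card_erase_of_mem (Finset.mem_univ v), Finset.card_univ,
      Fintype.card_fin] at h3
    have hn : 0 < n := v.pos
    have h5 : classCount (cyc G.wick) ≤ n := by omega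
    have h6 : (e + 1) * classCount (cyc G.wick) ≤ (e + 1) * n := Nat.mul_le_mul_left _ h5
    have e1 : (e + 3 - 1) * n = (e + 1) * n + n := by
      rw [show e + 3 - 1 = e + 1 + 1 by omega]; ring
    have e2 : (e + 3) * classCount (cyc G.wick) =
      (e + 1) * classCount (cyc G.wick) + 2 * classCount (cyc G.wick) := by ring
    omega
  · intro h
    have h2 := h.classCount_link Finset.univ
    rw [Finset.card_univ, Fintype.card_fin, h1] at h2
    have h3 : ∀ c : Fin (e + 3),
        classCount (cyc (G.partialStep {v | G.color v = c})) +
          (Finset.univ.filter fun v => G.color v = c).card = n + 1 := by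
      intro c
      rw [h.cyc_partialStep, h.classCount_link, ← h2, add_comm]
    have h4 := Finset.sum_congr (rfl : (Finset.univ : Finset (Fin (e + 3))) = _) fun c _ => h3 c
    rw [Finset.sum_add_distrib, Finset.sum_const, Finset.card_univ, Fintype.card_fin,
      ← Finset.card_eq_sum_card_fiberwise (fun _ _ => Finset.mem_coe.2 (Finset.mem_univ _)),
      Finset.card_univ, Fintype.card_fin, smul_eq_mul] at h4
    have e1 : (e + 3) * (n + 1) = (e + 2) * n + (e + 3) + n := by ring
    rw [show e + 3 - 1 = e + 2 by omega]
    omega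

/-- Every cycle of the face walk is an internal face, apart from those that meet external fields. -/
theorem ncard_internalFaces (c : Fin d) :
    (G.internalFaces c).ncard +
      (Set.range fun k : Fin N => {y | cyc (G.faceStep c) (Sum.inr k) y}).ncard =
      classCount (cyc (G.faceStep c)) := by
  set s := cyc (G.faceStep c) with hs
  have h1 : classCount s = s.classes.ncard := Nat.card_congr (Setoid.quotientEquivClasses s)
  have hset : ∀ x, {y | s x y} = {y | s y x} := fun x => Set.ext fun y => Setoid.comm' s
  have hsub : (Set.range fun k : Fin N => {y | s (Sum.inr k) y}) ⊆ s.classes := by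
    rintro _ ⟨k, rfl⟩
    exact ⟨Sum.inr k, hset _⟩
  rw [h1, ← Set.ncard_sdiff_add_ncard_of_subset hsub]
  congr 2
  ext O
  constructor
  · rintro ⟨⟨x, rfl⟩, hk⟩
    refine ⟨⟨x, hset x⟩, ?_⟩
    rintro ⟨k, hk'⟩
    refine hk k ?_
    rw [show {y | (G.faceStep c).SameCycle x y} = {y | s (Sum.inr k) y} from hk'.symm]
    exact s.refl' _
  · rintro ⟨⟨x, rfl⟩, hk⟩
    refine ⟨⟨x, (hset x).symm⟩, fun k hxk => hk ⟨k, ?_⟩⟩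
    refine Set.ext fun y => ?_
    exact ⟨fun h => s.trans' (s.symm' h) hxk, fun h => s.trans' hxk (s.symm' h)⟩

/-- Number of internal lines when all external fields are hooked to vertices. -/
theorem numLines_add (hext : ∀ k : Fin N, (G.wick.symm (Sum.inr k)).isLeft) :
    G.numLines + N = 2 * n := by
  have h1 := Set.ncard_add_ncard_compl {h | G.IsInternal h}
  have h2 : {h | G.IsInternal h}ᶜ.ncard = N := by
    have : {h | G.IsInternal h}ᶜ =
        Set.range fun k : Fin N => (G.wick.symm (Sum.inr k)).getLeft (hext k) := by
      ext h
      constructor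
      · intro hh
        rcases hw : G.wick (Sum.inl h) with x | k
        · exact absurd (by simp [IsInternal, hw]) hh
        · refine ⟨k, Sum.inl_injective (β := Fin N) ?_⟩
          rw [Sum.inl_getLeft, ← hw, Equiv.symm_apply_apply]
      · rintro ⟨k, rfl⟩
        simp [IsInternal]
    rw [this, Set.ncard_range_of_injective, Nat.card_eq_fintype_card, Fintype.card_fin]
    intro k l hkl
    have := congrArg (Sum.inl (β := Fin N)) hkl
    simpa using this
  rw [h2, Nat.card_eq_fintype_card, Fintype.card_prod, Fintype.card_fin, Fintype.card_bool] at h1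
  rw [numLines]
  omega

end FeynmanGraph

/-! ### Dressed lines as binary trees -/

/-- Shapes of dressed lines.  A line is either bare, or it runs into a melonic insertion (decorated
by an element of `α`): a vertex whose other half carries a loop, itself a dressed line, after which
the rest of the line follows. -/
inductive Line (α : Type) : Type
  | bare : Line α
  | insertion (x : α) (loop rest : Line α) : Line α

/-- The colour of the vertex of an insertion, together with the momentum of its loop. -/
abbrev Deco (d : ℕ) := Fin d × Mom d

namespace Line

/-- Number of vertices. -/
def size {α : Type} : Line α → ℕ
  | bare => 0
  | insertion _ l r => l.size + r.size + 1

/-- The labels of the vertices, in the order in which they are met. -/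
def labels {α β : Type} : Line (β × α) → List β
  | bare => []
  | insertion x l r => x.1 :: (l.labels ++ r.labels)

/-- Forget the labels. -/
def forget {α β : Type} : Line (β × α) → Line α
  | bare => bare
  | insertion x l r => insertion x.2 l.forget r.forget

/-- Momentum conservation along a dressed line of momentum `p`: in an insertion of colour `c`, the
loop momentum has the same component of colour `c` as `p`. -/
def Valid {d : ℕ} (p : Mom d) : Line (Deco d) → Prop
  | bare => True
  | insertion x l r => x.2 x.1 = p x.1 ∧ l.Valid x.2 ∧ r.Valid p

variable {d n N : ℕ}

/-- The bare lines that make up a dressed line of momentum `p` from the field `h` to the field `k`: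
their starting points, end points and momenta.  An insertion labelled `x = (v, a)` is entered
through `T̄ x` and left through `T x`, and its loop runs from `T` to `T̄` on the other half of
`v`. -/
def segments (p : Mom d) (h k : Fld n N) :
    Line ((Fin n × Bool) × Deco d) → List (Fld n N × Fld n N × Mom d)
  | bare => [(h, k, p)]
  | insertion x l r => (h, Sum.inl x.1, p) ::
      (l.segments x.2.2 (Sum.inl (opp x.1)) (Sum.inl (opp x.1)) ++ r.segments p (Sum.inl x.1) k)

/-- The vertices and their colours. -/
def colors : Line ((Fin n × Bool) × Deco d) → List (Fin n × Fin d)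
  | bare => []
  | insertion x l r => (x.1.1, x.2.1) :: (l.colors ++ r.colors)

/-- The halves of the vertices of a dressed line. -/
def halves : Line ((Fin n × Bool) × Deco d) → List (Fin n × Bool)
  | bare => []
  | insertion x l r => opp x.1 :: (l.halves ++ x.1 :: r.halves)

theorem map_fst_segments (p : Mom d) (h k : Fld n N) (T : Line ((Fin n × Bool) × Deco d)) :
    (T.segments p h k).map Prod.fst = h :: T.halves.map Sum.inl := by
  induction T generalizing p h k with
  | bare => rfl
  | insertion x l r hl hr => simp [segments, halves, hl, hr]

theorem exists_mem_segments_target (p : Mom d) (h k : Fld n N)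
    (T : Line ((Fin n × Bool) × Deco d)) : ∃ y, (y, k, p) ∈ T.segments p h k := by
  induction T generalizing p h with
  | bare => exact ⟨h, by simp [segments]⟩
  | insertion x l r hl hr =>
    obtain ⟨y, hy⟩ := hr p (Sum.inl x.1)
    exact ⟨y, by simp [segments, hy]⟩

end Line

/-! ### Tree-like graphs are made of dressed lines -/

namespace FeynmanGraph

variable {d n N : ℕ} (G : FeynmanGraph d n N)

/-- The lines of the list belong to the graph and carry the prescribed momenta. -/
def Follows (q : Fld n N → Mom d) (L : List (Fld n N × Fld n N × Mom d)) : Prop :=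
  ∀ l ∈ L, G.wick l.1 = l.2.1 ∧ q l.1 = l.2.2

/-- The vertices of the list have the prescribed colours. -/
def Colored (L : List (Fin n × Fin d)) : Prop := ∀ l ∈ L, G.color l.1 = l.2

/-- A set `S` of fields `T` that is traversed by a dressed line from `h` to `k`: the lines starting
in `S` end in `S \ {h}` or at `k`, and `S \ {h}` contains both halves of each of its vertices. -/
structure Segment (h k : Fld n N) (S : Finset (Fld n N)) : Prop where
  mem : h ∈ S
  fwd : ∀ x ∈ S, G.wick x = k ∨ G.wick x ∈ S ∧ G.wick x ≠ h
  bwd : ∀ x, G.wick x ∈ S → G.wick x ≠ h → x ∈ S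
  target : ∀ x, G.wick x = k → x ∈ S
  eq_or_notMem : k = h ∨ k ∉ S
  opp : ∀ x, Sum.inl x ∈ S → Sum.inl x ≠ h → Sum.inl (opp x) ∈ S ∧ Sum.inl (opp x) ≠ h
  cycle : cyc G.wick h k

variable {G} {h k : Fld n N} {S : Finset (Fld n N)}

theorem Segment.eq_of_wick_eq (hG : G.TreeLike) (hS : G.Segment h k S) (hw : G.wick h = k) :
    S = {h} := by
  have key : ∀ y, y ∈ S → y = h := by
    intro y hy
    by_contra hne
    have hiff := mem_iff_of_link (G := G) (E := Finset.univ) (S := {y | y ∈ S ∧ y ≠ h})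
      (fun x => ?_) (fun x _ hx => hS.opp x hx.1 hx.2) (hG.1 y h)
    · exact (hiff.1 ⟨hy, hne⟩).2 rfl
    · constructor
      · rintro ⟨hx, hxh⟩
        rcases hS.fwd x hx with h1 | h1
        · exact absurd (G.wick.injective (h1.trans hw.symm)) hxh
        · exact h1
      · rintro ⟨hx, hxh⟩
        refine ⟨hS.bwd x hx hxh, ?_⟩
        rintro rfl
        rcases hS.eq_or_notMem with h1 | h1
        · exact hxh (hw.trans h1)
        · exact h1 (hw ▸ hx)
  exact Finset.eq_singleton_iff_unique_mem.2 ⟨hS.mem, key⟩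

theorem Segment.wick_mem (hS : G.Segment h k S) (hw : G.wick h ≠ k) :
    G.wick h ∈ S ∧ G.wick h ≠ h := (hS.fwd h hS.mem).resolve_left hw

open Classical in
/-- When a dressed line reaches the half `x` of a vertex, the rest of its fields splits into those
hanging on the other half, which are traversed by a loop, and those that follow. -/
theorem Segment.split (hG : G.TreeLike) (hS : G.Segment h k S) {x : Fin n × Bool}
    (hw : G.wick h = Sum.inl x) (hk : Sum.inl x ≠ k) :
    ∃ S₁ S₂ : Finset (Fld n N), G.Segment (Sum.inl (TGFT.opp x)) (Sum.inl (TGFT.opp x)) S₁ ∧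
      G.Segment (Sum.inl x) k S₂ ∧ Disjoint S₁ S₂ ∧ S₁ ⊆ S ∧ S₂ ⊆ S ∧ h ∉ S₁ ∧ h ∉ S₂ ∧
      ∀ y ∈ S, y ≠ h → y ∈ S₁ ∨ y ∈ S₂ := by
  have hwk : G.wick h ≠ k := hw ▸ hk
  obtain ⟨hxS, hxh⟩ := hS.wick_mem hwk
  rw [hw] at hxS hxh
  obtain ⟨hoS, hoh⟩ := hS.opp x hxS hxh
  -- `S₁` consists of the fields that stay linked to the half `opp x` without the vertex of `x`.
  set R := G.link (Finset.univ.erase x.1) with hR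
  have hnot : ¬ R (Sum.inl x) (Sum.inl (TGFT.opp x)) := hG.not_link x
  have hhx : R h (Sum.inl x) := hw ▸ G.link_wick _ h
  set S₁ := S.filter fun y => y ≠ h ∧ R y (Sum.inl (TGFT.opp x)) with hS₁
  set S₂ := S.filter fun y => y ≠ h ∧ ¬ R y (Sum.inl (TGFT.opp x)) with hS₂
  have m1 : ∀ y, y ∈ S₁ ↔ y ∈ S ∧ y ≠ h ∧ R y (Sum.inl (TGFT.opp x)) := by simp [hS₁]
  have m2 : ∀ y, y ∈ S₂ ↔ y ∈ S ∧ y ≠ h ∧ y ∉ S₁ := by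
    intro y
    rw [m1]
    simp only [hS₂, Finset.mem_filter]
    tauto
  -- The set `S₁` is stable under the lines and under the vertices other than that of `x`.
  have hA : ∀ y, y ∈ S₁ ↔ G.wick y ∈ S₁ := by
    intro y
    rw [m1, m1]
    constructor
    · rintro ⟨h1, h2, h3⟩
      rcases hS.fwd y h1 with h4 | h4
      · refine absurd ?_ hnot
        refine R.trans' (R.symm' hhx) (R.trans' (G.link_cyc _ hS.cycle) ?_)
        rw [← h4]
        exact R.trans' (R.symm' (G.link_wick _ y)) h3
      · exact ⟨h4.1, h4.2, R.trans' (R.symm' (G.link_wick _ y)) h3⟩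
    · rintro ⟨h1, h2, h3⟩
      refine ⟨hS.bwd y h1 h2, ?_, R.trans' (G.link_wick _ y) h3⟩
      rintro rfl
      exact hnot (hw ▸ h3)
  have hB : ∀ z : Fin n × Bool, z.1 ≠ x.1 → Sum.inl z ∈ S₁ → Sum.inl (TGFT.opp z) ∈ S₁ := by
    intro z hz hz1
    obtain ⟨h1, h2, h3⟩ := (m1 _).1 hz1
    obtain ⟨h4, h5⟩ := hS.opp z h1 h2
    exact (m1 _).2 ⟨h4, h5, R.trans' (R.symm' (G.link_opp
      (Finset.mem_erase.2 ⟨hz, Finset.mem_univ _⟩))) h3⟩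
  have ho1 : Sum.inl (TGFT.opp x) ∈ S₁ := (m1 _).2 ⟨hoS, hoh, R.refl' _⟩
  have hx1 : Sum.inl x ∉ S₁ := fun h' => hnot ((m1 _).1 h').2.2
  have hh1 : h ∉ S₁ := fun h' => ((m1 _).1 h').2.1 rfl
  have hh2 : h ∉ S₂ := fun h' => ((m2 _).1 h').2.1 rfl
  refine ⟨S₁, S₂, ⟨ho1, ?_, ?_, ?_, Or.inl rfl, ?_, Setoid.refl' _ _⟩,
    ⟨(m2 _).2 ⟨hxS, hxh, hx1⟩, ?_, ?_, ?_, Or.inr ?_, ?_, ?_⟩, ?_, ?_, ?_, hh1, hh2, ?_⟩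
  · intro y hy
    by_cases h1 : G.wick y = Sum.inl (TGFT.opp x)
    · exact Or.inl h1
    · exact Or.inr ⟨(hA y).1 hy, h1⟩
  · exact fun y hy _ => (hA y).2 hy
  · exact fun y hy => (hA y).2 (hy ▸ ho1)
  · intro z hz hzo
    have hz1 : z.1 ≠ x.1 := by
      intro e
      rcases eq_or_eq_opp e with rfl | rfl
      · exact hx1 hz
      · exact hzo rfl
    refine ⟨hB z hz1 hz, fun e => hz1 ?_⟩
    exact (congrArg Prod.fst (Sum.inl_injective e) :)
  · intro y hy
    obtain ⟨h1, h2, h3⟩ := (m2 y).1 hy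
    rcases hS.fwd y h1 with h4 | h4
    · exact Or.inl h4
    · refine Or.inr ⟨(m2 _).2 ⟨h4.1, h4.2, fun h5 => h3 ((hA y).2 h5)⟩, fun h5 => h2 ?_⟩
      exact G.wick.injective (h5.trans hw.symm)
  · intro y hy hyx
    obtain ⟨h1, h2, h3⟩ := (m2 _).1 hy
    refine (m2 y).2 ⟨hS.bwd y h1 h2, ?_, fun h5 => h3 ((hA y).1 h5)⟩
    rintro rfl
    exact hyx hw
  · intro y hy
    refine (m2 y).2 ⟨hS.target y hy, ?_, fun h5 => ?_⟩
    · rintro rfl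
      exact hwk hy
    · have h6 := (hA y).1 h5
      rw [hy] at h6
      rcases hS.eq_or_notMem with h7 | h7
      · exact hh1 (h7 ▸ h6)
      · exact h7 ((m1 _).1 h6).1
  · intro h'
    rcases hS.eq_or_notMem with h7 | h7
    · exact hh2 (h7 ▸ h')
    · exact h7 ((m2 _).1 h').1
  · intro z hz hzx
    obtain ⟨h1, h2, h3⟩ := (m2 _).1 hz
    obtain ⟨h4, h5⟩ := hS.opp z h1 h2
    have hz1 : z.1 ≠ x.1 := by
      intro e
      rcases eq_or_eq_opp e with rfl | rfl
      · exact hzx rfl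
      · exact h3 ho1
    refine ⟨(m2 _).2 ⟨h4, h5, fun h6 => h3 ?_⟩, fun e => hz1 ?_⟩
    · simpa using hB (TGFT.opp z) hz1 h6
    · exact (congrArg Prod.fst (Sum.inl_injective e) :)
  · exact Setoid.trans' _ (Setoid.symm' _ (hw ▸ cyc_apply G.wick h)) hS.cycle
  · exact Finset.disjoint_left.2 fun y hy1 hy2 => ((m2 y).1 hy2).2.2 hy1
  · exact Finset.filter_subset _ _
  · exact Finset.filter_subset _ _
  · intro y hy hyh
    by_cases h1 : y ∈ S₁
    · exact Or.inl h1
    · exact Or.inr ((m2 y).2 ⟨hy, hyh, h1⟩)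

/-- The momentum of the line that ends at a vertex is transmitted by its strands. -/
def Transmits (G : FeynmanGraph d n N) (q : Fld n N → Mom d) : Prop :=
  ∀ (h : Fin n × Bool) (c : Fin d),
    q (G.wick.symm (Sum.inl h)) c = q (Sum.inl (G.strand c h)) c

theorem Transmits.apply_of_ne {q : Fld n N → Mom d} (hq : G.Transmits q) {h : Fld n N}
    {x : Fin n × Bool} (hw : G.wick h = Sum.inl x) {c : Fin d} (hc : c ≠ G.color x.1) :
    q h c = q (Sum.inl x) c := by
  have := hq x c
  rw [← hw, Equiv.symm_apply_apply] at this
  simpa [strand, hc] using this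

theorem Transmits.apply_color {q : Fld n N → Mom d} (hq : G.Transmits q) {h : Fld n N}
    {x : Fin n × Bool} (hw : G.wick h = Sum.inl x) :
    q h (G.color x.1) = q (Sum.inl (TGFT.opp x)) (G.color x.1) := by
  have := hq x (G.color x.1)
  rw [← hw, Equiv.symm_apply_apply] at this
  simpa [strand, TGFT.opp] using this

/-- A vertex whose one half carries a line of conserved momentum transmits the momentum between
the two fields of its other half. -/
theorem Transmits.eq_of_opp {q : Fld n N → Mom d} (hq : G.Transmits q) {h h' : Fld n N}
    {x : Fin n × Bool} (hw : G.wick h = Sum.inl x) (hw' : G.wick h' = Sum.inl (TGFT.opp x))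
    (he : q h' = q (Sum.inl (TGFT.opp x))) : q (Sum.inl x) = q h := by
  funext c
  by_cases hc : c = G.color x.1
  · subst hc
    have h1 := hq.apply_color hw'
    rw [opp_opp, opp_fst] at h1
    rw [hq.apply_color hw, ← h1, he]
  · exact (hq.apply_of_ne hw hc).symm

/-- In a tree-like graph, a segment without external fields is a dressed line. -/
theorem Segment.exists_line (hG : G.TreeLike) {q : Fld n N → Mom d} (hq : G.Transmits q) :
    ∀ {h k : Fld n N} {S : Finset (Fld n N)}, G.Segment h k S →
      (∀ e, Sum.inr e ∈ S → Sum.inr e = h) →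
      ∃ T : Line ((Fin n × Bool) × Deco d), G.Follows q (T.segments (q h) h k) ∧
        G.Colored T.colors ∧ T.forget.Valid (q h) ∧
        (h :: T.halves.map Sum.inl).Nodup ∧ ∀ y, y ∈ S ↔ y ∈ h :: T.halves.map Sum.inl := by
  intro h k S
  induction hm : S.card using Nat.strong_induction_on generalizing h k S with
  | _ m ih =>
  intro hS hext
  by_cases hwk : G.wick h = k
  · refine ⟨.bare, ?_, ?_, trivial, ?_, ?_⟩
    · simp [Line.segments, Follows, hwk]
    · simp [Line.colors, Colored]
    · simp [Line.halves]
    · simp [Line.halves, hS.eq_of_wick_eq hG hwk]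
  · obtain ⟨h1, h2⟩ := hS.wick_mem hwk
    rcases hw : G.wick h with x | e
    · rw [hw] at hwk
      obtain ⟨S₁, S₂, hS₁, hS₂, hdis, hsub1, hsub2, hh1, hh2, hcov⟩ := hS.split hG hw hwk
      have hlt : ∀ S' ⊆ S, h ∉ S' → S'.card < m := fun S' hs hh =>
        hm ▸ Finset.card_lt_card ⟨hs, fun h' => hh (h' hS.mem)⟩
      have hext1 : ∀ S' ⊆ S, h ∉ S' → ∀ e, Sum.inr e ∉ S' := fun S' hs hh e he =>
        hh (hext e (hs he) ▸ he)
      obtain ⟨l, hl1, hl2, hl3, hl4, hl5⟩ := ih _ (hlt _ hsub1 hh1) rfl hS₁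
        (fun e he => absurd he (hext1 _ hsub1 hh1 e))
      obtain ⟨r, hr1, hr2, hr3, hr4, hr5⟩ := ih _ (hlt _ hsub2 hh2) rfl hS₂
        (fun e he => absurd he (hext1 _ hsub2 hh2 e))
      obtain ⟨y, hy⟩ := Line.exists_mem_segments_target (q (Sum.inl (TGFT.opp x)))
        (Sum.inl (TGFT.opp x)) (Sum.inl (TGFT.opp x)) l
      obtain ⟨hy1, hy2⟩ := hl1 _ hy
      -- The loop has the same momentum at both ends, hence so do the two sides of the insertion.
      have hqx : q (Sum.inl x) = q h := hq.eq_of_opp hw hy1 hy2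
      rw [hqx] at hr1 hr3
      refine ⟨.insertion (x, (G.color x.1, q (Sum.inl (TGFT.opp x)))) l r, ?_, ?_, ?_, ?_, ?_⟩
      · intro s hs
        simp only [Line.segments, List.mem_cons, List.mem_append] at hs
        rcases hs with rfl | hs | hs
        · exact ⟨hw, rfl⟩
        · exact hl1 s hs
        · exact hr1 s hs
      · intro s hs
        simp only [Line.colors, List.mem_cons, List.mem_append] at hs
        rcases hs with rfl | hs | hs
        · rfl
        · exact hl2 s hs
        · exact hr2 s hs
      · exact ⟨(hq.apply_color hw).symm, hl3, hr3⟩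
      · have e1 : (Line.insertion (x, (G.color x.1, q (Sum.inl (TGFT.opp x)))) l r).halves.map
              (Sum.inl (β := Fin N)) = (Sum.inl (TGFT.opp x) :: l.halves.map Sum.inl) ++
              (Sum.inl x :: r.halves.map Sum.inl) := by simp [Line.halves]
        rw [e1, List.nodup_cons, List.nodup_append']
        refine ⟨?_, hl4, hr4, ?_⟩
        · rw [List.mem_append, ← hl5, ← hr5]
          exact fun h' => h'.elim hh1 hh2
        · intro y hy1 hy2
          exact Finset.disjoint_left.1 hdis ((hl5 y).2 hy1) ((hr5 y).2 hy2)
      · intro y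
        have e1 : (Line.insertion (x, (G.color x.1, q (Sum.inl (TGFT.opp x)))) l r).halves.map
              (Sum.inl (β := Fin N)) = (Sum.inl (TGFT.opp x) :: l.halves.map Sum.inl) ++
              (Sum.inl x :: r.halves.map Sum.inl) := by simp [Line.halves]
        rw [e1, List.mem_cons, List.mem_append, ← hl5, ← hr5]
        constructor
        · intro hy
          by_cases hyh : y = h
          · exact Or.inl hyh
          · exact Or.inr (hcov y hy hyh)
        · rintro (rfl | hy | hy)
          · exact hS.mem
          · exact hsub1 hy
          · exact hsub2 hy
    · rw [hw] at h1 h2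
      exact absurd (hext e h1) h2

end FeynmanGraph

/-! ### Chains of dressed lines -/

section

/-- A step along the chain of a labelled four-point graph: the next half-vertex, the momentum of
the two lines that lead to it and back, and these two dressed lines. -/
abbrev LabelledStep (d n : ℕ) :=
  (Fin n × Bool) × Mom d × Line ((Fin n × Bool) × Deco d) × Line ((Fin n × Bool) × Deco d)

variable {d n N : ℕ}

/-- The bare lines of a chain that starts on the half-vertex `h` and ends on the second external
leg. -/
def chainSegments (h : Fin n × Bool) : List (LabelledStep d n) → List (Fld n 2 × Fld n 2 × Mom d)
  | [] => [(Sum.inl h, Sum.inr 1, 0), (Sum.inr 1, Sum.inl h, 0)]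
  | (x, q, t, t') :: s => t.segments q (Sum.inl h) (Sum.inl x) ++
      (t'.segments q (Sum.inl x) (Sum.inl h) ++ chainSegments (opp x) s)

/-- The vertices of a chain and their colours. -/
def chainColors (i : Fin d) : List (LabelledStep d n) → List (Fin n × Fin d)
  | [] => []
  | (x, _, t, t') :: s => (x.1, i) :: (t.colors ++ (t'.colors ++ chainColors i s))

/-- The fields where the bare lines of a chain start. -/
def chainFields (h : Fin n × Bool) : List (LabelledStep d n) → List (Fld n 2)
  | [] => [Sum.inl h, Sum.inr 1]
  | (x, _, t, t') :: s => (Sum.inl h :: t.halves.map Sum.inl) ++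
      ((Sum.inl x :: t'.halves.map Sum.inl) ++ chainFields (opp x) s)

theorem map_fst_chainSegments (h : Fin n × Bool) (s : List (LabelledStep d n)) :
    (chainSegments h s).map Prod.fst = chainFields h s := by
  induction s generalizing h with
  | nil => rfl
  | cons y s ih => simp [chainSegments, chainFields, Line.map_fst_segments, ih]

/-- Momentum conservation along a chain of colour `i`. -/
def StepValid (i : Fin d) (y : Mom d × Line (Deco d) × Line (Deco d)) : Prop :=
  y.1 i = 0 ∧ y.2.1.Valid y.1 ∧ y.2.2.Valid y.1

/-- Forget the labels of a step. -/
def forgetStep (y : LabelledStep d n) : Mom d × Line (Deco d) × Line (Deco d) :=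
  (y.2.1, y.2.2.1.forget, y.2.2.2.forget)

namespace FeynmanGraph

variable {G : FeynmanGraph d n N} {h k : Fld n N} {S : Finset (Fld n N)}

/-- Only the vertex of `h` links a loop on the half-vertex `h` to the rest of the graph. -/
theorem Segment.mem_iff_of_link {h : Fin n × Bool} (hS : G.Segment (Sum.inl h) (Sum.inl h) S)
    {E : Finset (Fin n)} (hE : h.1 ∉ E) {x y : Fld n N} (hxy : G.link E x y) :
    x ∈ S ↔ y ∈ S := by
  refine FeynmanGraph.mem_iff_of_link (G := G) (S := {x | x ∈ S}) (fun z => ?_)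
    (fun z hz hzS => ?_) hxy
  · constructor
    · intro hz
      rcases hS.fwd z hz with h1 | h1
      · exact (h1 ▸ hS.mem : G.wick z ∈ S)
      · exact h1.1
    · intro hz
      by_cases h1 : G.wick z = Sum.inl h
      · exact hS.target z h1
      · exact hS.bwd z hz h1
  · refine (hS.opp z hzS fun e => hE ?_).1
    rwa [← Sum.inl_injective e]

/-- A segment whose first line ends on an external leg goes on from this leg. -/
theorem Segment.erase (hS : G.Segment h k S) {e : Fin N} (hw : G.wick h = Sum.inr e)
    (hk : G.wick h ≠ k) : G.Segment (Sum.inr e) k (S.erase h) := by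
  obtain ⟨h1, h2⟩ := hS.wick_mem hk
  refine ⟨?_, ?_, ?_, ?_, ?_, ?_, ?_⟩
  · rw [← hw]
    exact Finset.mem_erase.2 ⟨h2, h1⟩
  · intro x hx
    obtain ⟨hxh, hxS⟩ := Finset.mem_erase.1 hx
    rcases hS.fwd x hxS with h3 | h3
    · exact Or.inl h3
    · exact Or.inr ⟨Finset.mem_erase.2 ⟨h3.2, h3.1⟩, fun h4 =>
        hxh (G.wick.injective (h4.trans hw.symm))⟩
  · intro x hx hxe
    obtain ⟨hxh, hxS⟩ := Finset.mem_erase.1 hx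
    refine Finset.mem_erase.2 ⟨?_, hS.bwd x hxS hxh⟩
    rintro rfl
    exact hxe hw
  · intro x hx
    refine Finset.mem_erase.2 ⟨?_, hS.target x hx⟩
    rintro rfl
    exact hk hx
  · refine Or.inr fun h3 => ?_
    obtain ⟨h4, h5⟩ := Finset.mem_erase.1 h3
    exact hS.eq_or_notMem.elim h4 fun h6 => h6 h5
  · intro x hx _
    obtain ⟨hxh, hxS⟩ := Finset.mem_erase.1 hx
    obtain ⟨h4, h5⟩ := hS.opp x hxS hxh
    exact ⟨Finset.mem_erase.2 ⟨h5, h4⟩, by simp⟩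
  · exact Setoid.trans' _ (Setoid.symm' _ (hw ▸ cyc_apply G.wick h)) hS.cycle

/-- Total momentum conservation: a segment whose external legs conserve momentum conserves
momentum. -/
theorem Segment.momentum (hG : G.TreeLike) {q : Fld n N → Mom d} (hq : G.Transmits q)
    (hext : ∀ e, q (G.wick.symm (Sum.inr e)) = q (Sum.inr e)) :
    ∀ {h k : Fld n N} {S : Finset (Fld n N)}, G.Segment h k S → q (G.wick.symm k) = q h := by
  intro h k S
  induction hm : S.card using Nat.strong_induction_on generalizing h k S with
  | _ m ih =>
  intro hS
  by_cases hwk : G.wick h = k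
  · rw [← hwk, Equiv.symm_apply_apply]
  · have hlt : ∀ S' ⊆ S, h ∉ S' → S'.card < m := fun S' hs hh =>
      hm ▸ Finset.card_lt_card ⟨hs, fun h' => hh (h' hS.mem)⟩
    rcases hw : G.wick h with x | e
    · rw [hw] at hwk
      obtain ⟨S₁, S₂, hS₁, hS₂, -, hsub1, hsub2, hh1, hh2, -⟩ := hS.split hG hw hwk
      have h1 := ih _ (hlt _ hsub1 hh1) rfl hS₁
      have h2 := ih _ (hlt _ hsub2 hh2) rfl hS₂
      rw [h2, hq.eq_of_opp hw (Equiv.apply_symm_apply _ _) h1]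
    · have h1 := ih _ (hlt _ (Finset.erase_subset _ _) (Finset.notMem_erase _ _)) rfl
        (hS.erase hw hwk)
      rw [h1, ← hext, ← hw, Equiv.symm_apply_apply]

/-- A segment that contains exactly one external leg, which is not on its own cycle, crosses one
vertex `x` that leads to this leg; before and after this vertex it is a dressed line. -/
theorem Segment.exists_step (hG : G.TreeLike) {q : Fld n N → Mom d} (hq : G.Transmits q)
    (hext : ∀ e, q (G.wick.symm (Sum.inr e)) = q (Sum.inr e)) {m : Fin N} :
    ∀ {h k : Fld n N} {S : Finset (Fld n N)}, G.Segment h k S → Sum.inr m ∈ S →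
      (∀ e, Sum.inr e ∈ S → Sum.inr e = h ∨ e = m) → ¬ cyc G.wick h (Sum.inr m) →
      ∃ (t : Line ((Fin n × Bool) × Deco d)) (x : Fin n × Bool)
        (t' : Line ((Fin n × Bool) × Deco d)) (S' : Finset (Fld n N)),
        G.Follows q (t.segments (q h) h (Sum.inl x)) ∧
        G.Follows q (t'.segments (q h) (Sum.inl x) k) ∧
        G.Colored t.colors ∧ G.Colored t'.colors ∧
        t.forget.Valid (q h) ∧ t'.forget.Valid (q h) ∧
        G.Segment (Sum.inl (TGFT.opp x)) (Sum.inl (TGFT.opp x)) S' ∧ Sum.inr m ∈ S' ∧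
        ((h :: t.halves.map Sum.inl) ++ (Sum.inl x :: t'.halves.map Sum.inl)).Nodup ∧
        (∀ y, y ∈ S ↔
          y ∈ (h :: t.halves.map Sum.inl) ++ (Sum.inl x :: t'.halves.map Sum.inl) ∨ y ∈ S') ∧
        ∀ y ∈ (h :: t.halves.map Sum.inl) ++ (Sum.inl x :: t'.halves.map Sum.inl), y ∉ S' := by
  intro h k S
  induction hc : S.card using Nat.strong_induction_on generalizing h k S with
  | _ c ih =>
  intro hS hmS hem hcyc
  by_cases hwk : G.wick h = k
  · rw [hS.eq_of_wick_eq hG hwk, Finset.mem_singleton] at hmS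
    exact absurd (hmS ▸ Setoid.refl' _ _) hcyc
  · obtain ⟨h1, h2⟩ := hS.wick_mem hwk
    rcases hw : G.wick h with x | e
    · rw [hw] at hwk
      obtain ⟨S₁, S₂, hS₁, hS₂, hdis, hsub1, hsub2, hh1, hh2, hcov⟩ := hS.split hG hw hwk
      have hlt : ∀ S' ⊆ S, h ∉ S' → S'.card < c := fun S' hs hh =>
        hc ▸ Finset.card_lt_card ⟨hs, fun h' => hh (h' hS.mem)⟩
      have hext' : ∀ S' ⊆ S, h ∉ S' → ∀ e, Sum.inr e ∈ S' → e = m := fun S' hs hh e he =>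
        (hem e (hs he)).resolve_left fun h' => hh (h' ▸ he)
      have hmh : Sum.inr m ≠ h := fun e => hcyc (e ▸ Setoid.refl' _ _)
      have hqx : q (Sum.inl x) = q h :=
        hq.eq_of_opp hw (Equiv.apply_symm_apply _ _) (hS₁.momentum hG hq hext)
      -- Either the leg hangs on the first vertex that is met, or this vertex is an insertion.
      rcases hcov _ hmS hmh with hm1 | hm2
      · obtain ⟨r, hr1, hr2, hr3, hr4, hr5⟩ := hS₂.exists_line hG hq fun e he => by
          rw [hext' _ hsub2 hh2 e he] at he
          exact absurd he (Finset.disjoint_left.1 hdis hm1)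
        rw [hqx] at hr1 hr3
        have hmem : ∀ y, y ∈ (h :: (Line.bare : Line ((Fin n × Bool) × Deco d)).halves.map
            Sum.inl) ++ (Sum.inl x :: r.halves.map Sum.inl) ↔ y = h ∨ y ∈ S₂ := by
          intro y
          rw [List.mem_append, ← hr5]
          simp [Line.halves]
        refine ⟨.bare, x, r, S₁, ?_, hr1, ?_, hr2, trivial, hr3, hS₁, hm1, ?_, ?_, ?_⟩
        · simp [Line.segments, Follows, hw]
        · simp [Line.colors, Colored]
        · simp only [Line.halves, List.map_nil, List.cons_append, List.nil_append]
          refine List.nodup_cons.2 ⟨?_, hr4⟩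
          rw [← hr5]
          exact hh2
        · intro y
          rw [hmem]
          constructor
          · intro hy
            by_cases hyh : y = h
            · exact Or.inl (Or.inl hyh)
            · rcases hcov y hy hyh with h3 | h3
              · exact Or.inr h3
              · exact Or.inl (Or.inr h3)
          · rintro ((rfl | hy) | hy)
            · exact hS.mem
            · exact hsub2 hy
            · exact hsub1 hy
        · intro y hy
          rcases (hmem y).1 hy with rfl | h3
          · exact hh1
          · exact Finset.disjoint_right.1 hdis h3
      · obtain ⟨l, hl1, hl2, hl3, hl4, hl5⟩ := hS₁.exists_line hG hq fun e he => by
          rw [hext' _ hsub1 hh1 e he] at he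
          exact absurd he (Finset.disjoint_right.1 hdis hm2)
        obtain ⟨t, z, t', S', a1, a2, a3, a4, a5, a6, a7, a8, a9, a10, a11⟩ :=
          ih _ (hlt _ hsub2 hh2) rfl hS₂ hm2 (fun e he => Or.inr (hext' _ hsub2 hh2 e he))
            (fun h' => hcyc (Setoid.trans' _ (hw ▸ cyc_apply G.wick h) h'))
        rw [hqx] at a1 a2 a5 a6
        set T : Line ((Fin n × Bool) × Deco d) :=
          .insertion (x, (G.color x.1, q (Sum.inl (TGFT.opp x)))) l t with hT
        have e1 : (h :: T.halves.map Sum.inl) ++ (Sum.inl z :: t'.halves.map Sum.inl) =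
            h :: ((Sum.inl (TGFT.opp x) :: l.halves.map Sum.inl) ++
              ((Sum.inl x :: t.halves.map Sum.inl) ++ (Sum.inl z :: t'.halves.map Sum.inl))) := by
          simp [hT, Line.halves]
        refine ⟨T, z, t', S', ?_, a2, ?_, a4, ?_, a6, a7, a8, ?_, ?_, ?_⟩
        · intro s hs
          simp only [hT, Line.segments, List.mem_cons, List.mem_append] at hs
          rcases hs with rfl | hs | hs
          · exact ⟨hw, rfl⟩
          · exact hl1 s hs
          · exact a1 s hs
        · intro s hs
          simp only [hT, Line.colors, List.mem_cons, List.mem_append] at hs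
          rcases hs with rfl | hs | hs
          · rfl
          · exact hl2 s hs
          · exact a3 s hs
        · exact ⟨(hq.apply_color hw).symm, hl3, a5⟩
        · rw [e1, List.nodup_cons, List.nodup_append']
          refine ⟨?_, hl4, a9, ?_⟩
          · rw [List.mem_append, ← hl5]
            rintro (h3 | h3)
            · exact hh1 h3
            · exact hh2 ((a10 h).2 (Or.inl h3))
          · intro y hy1 hy2
            exact Finset.disjoint_left.1 hdis ((hl5 y).2 hy1) ((a10 y).2 (Or.inl hy2))
        · intro y
          rw [e1, List.mem_cons, List.mem_append, ← hl5, or_assoc, or_assoc, ← a10]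
          constructor
          · intro hy
            by_cases hyh : y = h
            · exact Or.inl hyh
            · exact Or.inr (hcov y hy hyh)
          · rintro (rfl | hy | hy)
            · exact hS.mem
            · exact hsub1 hy
            · exact hsub2 hy
        · intro y hy hyS
          rw [e1, List.mem_cons, List.mem_append, ← hl5] at hy
          have hy2 : y ∈ S₂ := (a10 y).2 (Or.inr hyS)
          rcases hy with rfl | hy | hy
          · exact hh2 hy2
          · exact Finset.disjoint_left.1 hdis hy hy2
          · exact a11 y hy hyS
    · have h3 := (hem e (hw ▸ h1)).resolve_left (hw ▸ h2)
      rw [h3] at hw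
      exact absurd (hw ▸ cyc_apply G.wick h) hcyc

/-- In a tree-like graph whose second external leg is hooked without insertion and linked to the
first one by vertices of colour `i`, the fields between a half-vertex and this leg form a chain. -/
theorem Segment.exists_chain {G : FeynmanGraph d n 2} (hG : G.TreeLike) {q : Fld n 2 → Mom d}
    (hq : G.Transmits q) (hext : ∀ e, q (G.wick.symm (Sum.inr e)) = q (Sum.inr e))
    (hq1 : q (Sum.inr 1) = 0) {z : Fin n × Bool} (hz : G.wick (Sum.inl z) = Sum.inr 1)
    (hz' : G.wick (Sum.inr 1) = Sum.inl z) {i : Fin d}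
    (hi : G.link {v | G.color v = i} (Sum.inr 0) (Sum.inr 1)) :
    ∀ {h : Fin n × Bool} {S : Finset (Fld n 2)}, G.Segment (Sum.inl h) (Sum.inl h) S →
      Sum.inr 1 ∈ S → Sum.inr 0 ∉ S → q (Sum.inl h) i = 0 →
      ∃ s : List (LabelledStep d n), G.Follows q (chainSegments h s) ∧
        G.Colored (chainColors i s) ∧ (∀ y ∈ s, StepValid i (forgetStep y)) ∧
        (chainFields h s).Nodup ∧ ∀ y, y ∈ S ↔ y ∈ chainFields h s := by
  intro h S
  induction hc : S.card using Nat.strong_induction_on generalizing h S with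
  | _ c ih =>
  intro hS h1S h0S hqi
  by_cases hhz : h = z
  · subst hhz
    have hS' := hS.erase hz (by rw [hz]; simp)
    have hS'' := hS'.eq_of_wick_eq hG hz'
    refine ⟨[], ?_, ?_, ?_, ?_, ?_⟩
    · have hqh : q (Sum.inl h) = 0 := by
        rw [← hq1, ← hext, ← hz, Equiv.symm_apply_apply]
      simp [chainSegments, Follows, hz, hz', hq1, hqh]
    · simp [chainColors, Colored]
    · simp
    · simp [chainFields]
    · intro y
      rw [← Finset.insert_erase hS.mem, hS'']
      simp [chainFields]
  · -- The cycle of the second leg consists of the leg and `z` only.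
    have hfar : ¬ cyc G.wick (Sum.inl h) (Sum.inr 1) := by
      intro h'
      have hcl : ∀ y, (y ∈ ({Sum.inl z, Sum.inr 1} : Set (Fld n 2))) ↔
          G.wick y ∈ ({Sum.inl z, Sum.inr 1} : Set (Fld n 2)) := by
        intro y
        simp only [Set.mem_insert_iff, Set.mem_singleton_iff]
        constructor
        · rintro (rfl | rfl)
          · exact Or.inr hz
          · exact Or.inl hz'
        · rintro (h3 | h3)
          · exact Or.inr (G.wick.injective (h3.trans hz'.symm))
          · exact Or.inl (G.wick.injective (h3.trans hz.symm))
      have := (FeynmanGraph.mem_iff_of_link (G := G) (E := ∅) hcl (by simp)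
        (G.link_cyc _ h')).2 (by simp)
      simp [hhz] at this
    obtain ⟨t, x, t', S', a1, a2, a3, a4, a5, a6, a7, a8, a9, a10, a11⟩ :=
      hS.exists_step hG hq hext (m := 1) h1S (fun e he => Or.inr (by
        rcases Fin.eq_zero_or_eq_succ e with rfl | ⟨j, rfl⟩
        · exact absurd he h0S
        · rw [Fin.fin_one_eq_zero j]; rfl)) hfar
    have hsub : S' ⊆ S := fun y hy => (a10 y).2 (Or.inr hy)
    have h0S' : Sum.inr 0 ∉ S' := fun h' => h0S (hsub h')
    -- Without the vertex of `x`, the first leg would not be linked to the second one.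
    have hcol : G.color x.1 = i := by
      by_contra hne
      refine h0S' ((a7.mem_iff_of_link (E := {v | G.color v = i}) ?_ hi).2 a8)
      simpa using hne
    have hlt : S'.card < c := hc ▸ Finset.card_lt_card
      ⟨hsub, fun h' => a11 _ (by simp) (h' hS.mem)⟩
    obtain ⟨y, hy⟩ := Line.exists_mem_segments_target (q (Sum.inl h)) (Sum.inl h) (Sum.inl x) t
    obtain ⟨hy1, hy2⟩ := a1 _ hy
    have hqi' : q (Sum.inl (TGFT.opp x)) i = 0 := by
      rw [← hqi, ← hcol, ← hq.apply_color hy1]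
      exact congrFun hy2 _
    obtain ⟨s, b1, b2, b3, b4, b5⟩ := ih _ hlt rfl a7 a8 h0S' hqi'
    refine ⟨(x, q (Sum.inl h), t, t') :: s, ?_, ?_, ?_, ?_, ?_⟩
    · intro l hl
      simp only [chainSegments, List.mem_append] at hl
      rcases hl with hl | hl | hl
      · exact a1 l hl
      · exact a2 l hl
      · exact b1 l hl
    · intro l hl
      simp only [chainColors, List.mem_cons, List.mem_append] at hl
      rcases hl with rfl | hl | hl | hl
      · exact hcol
      · exact a3 l hl
      · exact a4 l hl
      · exact b2 l hl
    · intro l hl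
      rcases List.mem_cons.1 hl with rfl | hl
      · exact ⟨hqi, a5, a6⟩
      · exact b3 l hl
    · rw [chainFields, ← List.append_assoc, List.nodup_append']
      exact ⟨a9, b4, fun y hy1 hy2 => a11 y hy1 ((b5 y).2 hy2)⟩
    · intro y
      rw [chainFields, ← List.append_assoc, List.mem_append, a10, b5]

end FeynmanGraph

end

/-! ### Melonic graphs are the tree-like ones -/

namespace FeynmanGraph

variable {d n N : ℕ} {G : FeynmanGraph d n N}

theorem OnePI.nonempty (h : G.OnePI) : Nonempty (Fld n N) := ⟨Sum.inl (⟨0, h.1⟩, false)⟩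

theorem OnePI.link (h : G.OnePI) (x y : Fld n N) : G.link Finset.univ x y := by
  obtain ⟨-, hext, hcon, -⟩ := h
  have hv : ∀ v : Fin n, ∀ a b, G.link Finset.univ (Sum.inl (v, a)) (Sum.inl (v, b)) := by
    intro v a b
    rcases eq_or_eq_opp (x := (v, b)) (h := (v, a)) rfl with e | e
    · rw [e]
    · rw [e]
      exact G.link_opp (Finset.mem_univ v)
  have hJ : ∀ v w : Fin n, ∀ a b, G.link Finset.univ (Sum.inl (v, a)) (Sum.inl (w, b)) := by
    intro v w
    induction hcon v w with
    | rel v w h =>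
      obtain ⟨a', b', -, hw⟩ := h
      intro a b
      exact Setoid.trans' _ (hv v a a')
        (Setoid.trans' _ (hw ▸ G.link_wick _ (Sum.inl (v, a'))) (hv w b' b))
    | refl v => exact hv v
    | symm v w _ ih => exact fun a b => Setoid.symm' _ (ih b a)
    | trans u v w _ _ ih1 ih2 => exact fun a b => Setoid.trans' _ (ih1 a a) (ih2 a b)
  have hroot : ∀ x : Fld n N, ∃ h, G.link Finset.univ x (Sum.inl h) := by
    rintro (h | k)
    · exact ⟨h, Setoid.refl' _ _⟩
    · have h1 := (hext k).1
      have h2 := G.link_wick Finset.univ (Sum.inr k)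
      rcases hw : G.wick (Sum.inr k) with h | l
      · exact ⟨h, hw ▸ h2⟩
      · rw [hw] at h1
        simp at h1
  obtain ⟨u, hu⟩ := hroot x
  obtain ⟨w, hw⟩ := hroot y
  exact Setoid.trans' _ hu (Setoid.trans' _ (hJ _ _ _ _) (Setoid.symm' _ hw))

theorem segment_univ (G : FeynmanGraph d n N) (k : Fin N) :
    G.Segment (Sum.inr k) (Sum.inr k) Finset.univ where
  mem := Finset.mem_univ _
  fwd x _ := by
    by_cases h : G.wick x = Sum.inr k
    · exact Or.inl h
    · exact Or.inr ⟨Finset.mem_univ _, h⟩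
  bwd _ _ _ := Finset.mem_univ _
  target _ _ := Finset.mem_univ _
  eq_or_notMem := Or.inl rfl
  opp _ _ _ := ⟨Finset.mem_univ _, by simp⟩
  cycle := Setoid.refl' _ _

/-- In a tree-like 1PI graph, both fields of the half-vertex hooked to an external leg are
external: any insertion on that leg would be separated from its root by cutting the line that
leaves the root. -/
theorem TreeLike.wick_root (hG : G.TreeLike) (h1 : G.OnePI) {k : Fin N} {x : Fin n × Bool}
    (hx : G.wick (Sum.inr k) = Sum.inl x) : ∃ l, G.wick (Sum.inl x) = Sum.inr l := by
  obtain ⟨S₁, S₂, hS₁, hS₂, hdis, -⟩ := (G.segment_univ k).split hG hx (by simp)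
  have hx1 : Sum.inl x ∉ S₁ := Finset.disjoint_right.1 hdis hS₂.mem
  -- The vertex of `x` and the vertices of the loop `S₁` on its other half are stable under all
  -- lines but the one that leaves `x`.  They are thus all the vertices, and the line that leaves
  -- `x` cannot end on any of them.
  have hlink : ∀ {y z}, G.link (Finset.univ.erase x.1) y z → (y ∈ S₁ ↔ z ∈ S₁) := fun h =>
    hS₁.mem_iff_of_link (by simp) h
  have hW : ∀ h : Fin n × Bool, h ≠ x →
      ((h.1 = x.1 ∨ Sum.inl (h.1, false) ∈ S₁) ↔ Sum.inl h ∈ S₁) := by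
    intro h hne
    by_cases e : h.1 = x.1
    · rcases eq_or_eq_opp e with rfl | rfl
      · exact absurd rfl hne
      · simp [hS₁.mem]
    · have : Sum.inl (h.1, false) ∈ S₁ ↔ Sum.inl h ∈ S₁ := by
        rcases eq_or_eq_opp (x := (h.1, false)) (h := h) rfl with e' | e'
        · rw [e']
        · rw [e']
          exact (hlink (G.link_opp (Finset.mem_erase.2 ⟨e, Finset.mem_univ _⟩))).symm
      simp [e, this]
  have hclosed : ∀ v w, G.Joined {x} v w →
      ((v = x.1 ∨ Sum.inl (v, false) ∈ S₁) ↔ (w = x.1 ∨ Sum.inl (w, false) ∈ S₁)) := by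
    rintro v w ⟨a, b, hne, hw⟩
    have hb : (w, b) ≠ x := by
      rintro rfl
      have := G.wick.injective (hw.trans hx.symm)
      simp at this
    rw [hW (v, a) (by simpa using hne), hW (w, b) hb, ← hw]
    exact hlink (G.link_wick _ _)
  have hall : ∀ v, v = x.1 ∨ Sum.inl (v, false) ∈ S₁ := by
    have : ∀ v w, Relation.EqvGen (G.Joined {x}) v w →
        ((v = x.1 ∨ Sum.inl (v, false) ∈ S₁) ↔ (w = x.1 ∨ Sum.inl (w, false) ∈ S₁)) := by
      intro v w h
      induction h with
      | rel v w h => exact hclosed v w h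
      | refl v => rfl
      | symm v w _ ih => exact ih.symm
      | trans u v w _ _ h1 h2 => exact h1.trans h2
    exact fun v => (this x.1 v (h1.2.2.2 x x.1 v)).1 (Or.inl rfl)
  rcases hw : G.wick (Sum.inl x) with y | l
  · exfalso
    have hyx : y ≠ x := by
      rintro rfl
      have := G.wick.injective (hw.trans hx.symm)
      simp at this
    have hy := (hW y hyx).1 (hall y.1)
    refine hx1 ((hlink (G.link_wick _ (Sum.inl x))).2 ?_)
    rwa [hw]
  · exact ⟨l, rfl⟩

/-- Internal faces and closed external faces make up all the cycles of the face walks. -/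
theorem numFaces_add (G : FeynmanGraph d n N) :
    G.numFaces +
      ∑ c, (Set.range fun k : Fin N => {y | cyc (G.faceStep c) (Sum.inr k) y}).ncard =
      ∑ c, classCount (cyc (G.faceStep c)) := by
  rw [numFaces, ← Finset.sum_add_distrib]
  exact Finset.sum_congr rfl fun c _ => G.ncard_internalFaces c

/-- Here `L = 2n - 1`, and every colour has one external face, so that melonic graphs have
`(d - 1) n + d` faces in all. -/
theorem OnePI.melonic_iff_treeLike_two {G : FeynmanGraph d n 1} (hd : 3 ≤ d) (h : G.OnePI) :
    G.Melonic ↔ G.TreeLike := by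
  have := h.nonempty
  rw [← G.sum_classCount_faceStep_eq_iff hd h.link, ← G.numFaces_add, Melonic]
  have h1 := G.numLines_add fun k => (h.2.1 k).2
  have h2 : ∀ c, (Set.range fun k : Fin 1 =>
      {y | cyc (G.faceStep c) (Sum.inr k) y}).ncard = 1 := by
    intro c
    rw [Set.range_unique, Set.ncard_singleton]
  simp only [h2, Finset.sum_const, Finset.card_univ, Fintype.card_fin, smul_eq_mul, mul_one]
  obtain ⟨e, rfl⟩ : ∃ e, d = e + 1 := ⟨d - 1, by omega⟩
  have h3 : (G.numLines : ℤ) = 2 * n - 1 := by omega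
  rw [h3]
  have e1 : (((e + 1 : ℕ) : ℤ) - 1) * (2 * n - 1 - n + 1) = ((e * n : ℕ) : ℤ) := by
    push_cast; ring
  rw [e1, show e + 1 - 1 = e from rfl]
  omega

/-- After the gluing of every external `T̄_k` to `T_k`, the two legs of a four-point graph lie on a
common face of colour `c` if and only if `c = i`. -/
def SharesFace (G : FeynmanGraph d n 2) (i : Fin d) : Prop :=
  ∀ c, cyc (G.faceStep c) (Sum.inr 0) (Sum.inr 1) ↔ c = i

/-- Here `L = 2n - 2`, and there are `2d - 1` external faces after the closure of the legs, so that
melonic graphs have `(d - 1) n + d` faces in all. -/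
theorem OnePI.melonic_iff_treeLike_four {G : FeynmanGraph d n 2} (hd : 3 ≤ d) (h : G.OnePI)
    {i : Fin d} (hi : G.SharesFace i) : G.Melonic ↔ G.TreeLike := by
  have := h.nonempty
  rw [← G.sum_classCount_faceStep_eq_iff hd h.link, ← G.numFaces_add, Melonic]
  have h1 := G.numLines_add fun k => (h.2.1 k).2
  have h2 : ∀ c, (Set.range fun k : Fin 2 =>
      {y | cyc (G.faceStep c) (Sum.inr k) y}).ncard = if c = i then 1 else 2 := by
    intro c
    have hr : (Set.range fun k : Fin 2 => {y | cyc (G.faceStep c) (Sum.inr k) y}) =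
        {{y | cyc (G.faceStep c) (Sum.inr 0) y}, {y | cyc (G.faceStep c) (Sum.inr 1) y}} := by
      ext O
      simp [Fin.exists_fin_two, eq_comm]
    rw [hr]
    split_ifs with hc
    · have h3 := (hi c).2 hc
      have : {y | cyc (G.faceStep c) (Sum.inr 0) y} = {y | cyc (G.faceStep c) (Sum.inr 1) y} :=
        Set.ext fun y => ⟨fun h => Setoid.trans' _ (Setoid.symm' _ h3) h,
          fun h => Setoid.trans' _ h3 h⟩
      rw [this, Set.pair_eq_singleton, Set.ncard_singleton]
    · refine Set.ncard_pair fun h3 => hc ((hi c).1 ?_)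
      have : Sum.inr 1 ∈ {y | cyc (G.faceStep c) (Sum.inr 1) y} :=
        Equiv.Perm.SameCycle.refl _ _
      rw [← h3] at this
      exact this
  have h4 : ∑ c, (if c = i then 1 else 2) + 1 = 2 * d := by
    rw [← Finset.add_sum_erase _ _ (Finset.mem_univ i), if_pos rfl,
      Finset.sum_congr rfl fun c hc => if_neg (Finset.ne_of_mem_erase hc), Finset.sum_const,
      Finset.card_erase_of_mem (Finset.mem_univ i), Finset.card_univ, Fintype.card_fin]
    simp only [smul_eq_mul]
    omega
  simp only [h2]
  obtain ⟨e, rfl⟩ : ∃ e, d = e + 1 := ⟨d - 1, by omega⟩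
  have hn := h.1
  have h3 : (G.numLines : ℤ) = 2 * n - 2 := by omega
  rw [h3]
  have e1 : (((e + 1 : ℕ) : ℤ) - 1) * (2 * n - 2 - n + 1) = ((e * n : ℕ) : ℤ) - e := by
    push_cast; ring
  rw [e1, show e + 1 - 1 = e from rfl]
  omega

/-! ### External faces and the boundary graph -/

theorem ExternalFace.cyc {c : Fin d} {k l : Fin N} (h : G.ExternalFace c k l) :
    cyc (G.faceStep c) (Sum.inr k) (Sum.inr l) := by
  obtain ⟨m, hm, -⟩ := h
  exact ⟨(m + 1 : ℕ), by rw [zpow_natCast]; exact hm⟩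

theorem exists_externalFace (G : FeynmanGraph d n N) (c : Fin d) (k : Fin N) :
    ∃ l, G.ExternalFace c k l := by
  classical
  have hex : ∃ m : ℕ, ¬ (((G.faceStep c) ^ (m + 1)) (Sum.inr k)).isLeft := by
    refine ⟨orderOf (G.faceStep c) - 1, ?_⟩
    rw [Nat.sub_add_cancel (orderOf_pos _), pow_orderOf_eq_one]
    simp
  have hspec := Nat.find_spec hex
  have hmin : ∀ {j}, j < Nat.find hex → _ := fun hj => Nat.find_min hex hj
  rcases hw : ((G.faceStep c) ^ (Nat.find hex + 1)) (Sum.inr k) with h | l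
  · rw [hw] at hspec
    simp at hspec
  · exact ⟨l, Nat.find hex, hw, fun j hj => not_not.1 (hmin hj)⟩

/-- An external face that returns to its starting leg meets no other leg. -/
theorem ExternalFace.eq_of_cyc {c : Fin d} {k l : Fin N} (h : G.ExternalFace c k k)
    (hl : TGFT.cyc (G.faceStep c) (Sum.inr k) (Sum.inr l)) : l = k := by
  obtain ⟨m, hm, hlt⟩ := h
  obtain ⟨j, hj⟩ := Equiv.Perm.SameCycle.exists_nat_pow_eq hl
  have hper : ∀ a : ℕ, ((G.faceStep c) ^ ((m + 1) * a)) (Sum.inr k) = Sum.inr k := by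
    intro a
    induction a with
    | zero => rfl
    | succ a ih => rw [Nat.mul_succ, pow_add, Equiv.Perm.mul_apply, hm, ih]
  rw [← Nat.mod_add_div j (m + 1), pow_add, Equiv.Perm.mul_apply, hper] at hj
  rcases hr : j % (m + 1) with _ | r
  · rw [hr] at hj
    exact (Sum.inr_injective hj).symm
  · rw [hr] at hj
    have h1 := hlt r (by have := Nat.mod_lt j (show 0 < m + 1 by omega); omega)
    rw [hj] at h1
    simp at h1

/-- The legs share exactly the faces of colour `i` if and only if the external faces of the other
colours return to their leg, and those of colour `i` do not. -/
theorem sharesFace_iff {G : FeynmanGraph d n 2} {i : Fin d} :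
    G.SharesFace i ↔ ∀ (c : Fin d) (k l : Fin 2), G.ExternalFace c k l ↔ (l = k ↔ c ≠ i) := by
  constructor
  · intro h c k l
    have hsh : ∀ k l : Fin 2, l ≠ k →
        (TGFT.cyc (G.faceStep c) (Sum.inr k) (Sum.inr l) ↔ c = i) := by
      intro k l hkl
      rw [← h c]
      fin_cases k <;> fin_cases l
      · exact absurd rfl hkl
      · rfl
      · exact Setoid.comm' _
      · exact absurd rfl hkl
    obtain ⟨m, hm⟩ := G.exists_externalFace c k
    have huniq : ∀ m', G.ExternalFace c k m' → (m' = k ↔ c ≠ i) := by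
      intro m' hm'
      constructor
      · rintro rfl hc
        obtain ⟨k', hk'⟩ : ∃ k' : Fin 2, k' ≠ m' := exists_ne m'
        exact hk' (hm'.eq_of_cyc ((hsh m' k' hk').2 hc))
      · intro hc
        by_contra hne
        exact hc ((hsh k m' hne).1 hm'.cyc)
    refine ⟨huniq l, fun hl => ?_⟩
    have : (m = k ↔ l = k) := (huniq m hm).trans hl.symm
    have : m = l := by
      revert this
      fin_cases m <;> fin_cases k <;> fin_cases l <;> simp
    exact this ▸ hm
  · intro h c
    constructor
    · intro hc
      by_contra hne
      have h1 : G.ExternalFace c 0 0 := (h c 0 0).2 (by simpa using hne)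
      have := h1.eq_of_cyc hc
      simp at this
    · rintro rfl
      exact ((h c 0 1).2 (by simp)).cyc

/-- The exchange of the two external fields. -/
def swapExternal (n : ℕ) : Equiv.Perm (Fld n 2) :=
  Equiv.sumCongr (Equiv.refl _) (Equiv.swap 0 1)

@[simp] theorem swapExternal_inl (h : Fin n × Bool) :
    swapExternal n (Sum.inl h) = Sum.inl h := rfl

@[simp] theorem swapExternal_inr (k : Fin 2) :
    swapExternal n (Sum.inr k) = Sum.inr (Equiv.swap 0 1 k) := rfl

@[simp] theorem swapExternal_symm : (swapExternal n).symm = swapExternal n := by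
  simp [swapExternal]

/-- Exchange the two external fields `T̄`. -/
def twist (G : FeynmanGraph d n 2) : FeynmanGraph d n 2 where
  color := G.color
  wick := G.wick.trans (swapExternal n)

theorem twist_wick_inl (G : FeynmanGraph d n 2) (x : Fld n 2) (h : Fin n × Bool) :
    G.twist.wick x = Sum.inl h ↔ G.wick x = Sum.inl h := by
  rw [twist, Equiv.trans_apply]
  rcases G.wick x with y | k <;> simp

theorem twist_wick_isLeft (G : FeynmanGraph d n 2) (x : Fld n 2) :
    (G.twist.wick x).isLeft = (G.wick x).isLeft := by
  rw [twist, Equiv.trans_apply]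
  rcases G.wick x with y | k <;> simp

theorem twist_twist (G : FeynmanGraph d n 2) : G.twist.twist = G := by
  obtain ⟨color, wick⟩ := G
  simp only [twist, FeynmanGraph.mk.injEq, true_and]
  refine Equiv.ext fun x => ?_
  simp only [Equiv.trans_apply]
  rcases wick x with y | k <;> simp

theorem twist_wick_symm_inl (G : FeynmanGraph d n 2) (h : Fin n × Bool) :
    G.twist.wick.symm (Sum.inl h) = G.wick.symm (Sum.inl h) := by
  simp [twist]

theorem twist_wick_symm_inr (G : FeynmanGraph d n 2) (k : Fin 2) :
    G.twist.wick.symm (Sum.inr k) = G.wick.symm (Sum.inr (Equiv.swap 0 1 k)) := by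
  simp [twist]

theorem twist_isInternal (G : FeynmanGraph d n 2) (h : Fin n × Bool) :
    G.twist.IsInternal h ↔ G.IsInternal h := by
  rw [IsInternal, IsInternal, twist_wick_isLeft]

theorem twist_faceStep (G : FeynmanGraph d n 2) (c : Fin d) (x : Fld n 2) :
    G.twist.faceStep c x =
      swapExternal n (G.faceStep c x) := by
  simp only [faceStep, twist, Equiv.trans_apply]
  rcases G.wick x with y | k <;> simp [strand]

theorem twist_numLines (G : FeynmanGraph d n 2) : G.twist.numLines = G.numLines := by
  simp only [numLines, twist_isInternal]

theorem twist_joined (G : FeynmanGraph d n 2) (cut : Set (Fin n × Bool)) :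
    G.twist.Joined cut = G.Joined cut := by
  funext v w
  simp only [Joined, twist_wick_inl]

theorem twist_onePI {G : FeynmanGraph d n 2} (h : G.OnePI) : G.twist.OnePI := by
  obtain ⟨h1, h2, h3, h4⟩ := h
  refine ⟨h1, fun k => ⟨?_, ?_⟩, ?_, ?_⟩
  · rw [twist_wick_isLeft]
    exact (h2 k).1
  · rw [twist_wick_symm_inr]
    exact (h2 _).2
  · simpa only [ConnectedWithout, twist_joined] using h3
  · simpa only [ConnectedWithout, twist_joined] using h4

theorem twist_conserves {G : FeynmanGraph d n 2} {q : Fin n × Bool → Mom d}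
    (h : G.Conserves (fun _ => 0) q) : G.twist.Conserves (fun _ => 0) q := by
  refine ⟨fun k => ?_, fun x c => ?_⟩
  · rw [twist_wick_symm_inr]
    exact h.1 _
  · rw [twist_wick_symm_inl]
    exact h.2 x c

theorem twist_propagators (G : FeynmanGraph d n 2) (C : Mom d → ℝ) (q : Fin n × Bool → Mom d) :
    G.twist.propagators C q = G.propagators C q := by
  refine Finset.prod_congr rfl fun h _ => ?_
  by_cases hh : G.IsInternal h
  · rw [if_pos hh, if_pos ((G.twist_isInternal h).2 hh)]
  · rw [if_neg hh, if_neg fun h' => hh ((G.twist_isInternal h).1 h')]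

theorem internalFaces_subset_twist (G : FeynmanGraph d n 2) (c : Fin d) :
    G.internalFaces c ⊆ G.twist.internalFaces c := by
  rintro O ⟨⟨x, hO⟩, hext⟩
  have hmem : ∀ y, y ∈ O ↔ (G.faceStep c).SameCycle x y := fun y => by rw [hO]; rfl
  have hstep : ∀ y, y ∈ O → G.twist.faceStep c y = G.faceStep c y := by
    intro y hy
    have h1 : G.faceStep c y ∈ O := (hmem _).2 (Setoid.trans' (TGFT.cyc (G.faceStep c))
      ((hmem y).1 hy) (cyc_apply _ _))
    rw [twist_faceStep]
    rcases hf : G.faceStep c y with z | k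
    · simp
    · exact absurd (hf ▸ h1) (hext k)
  refine ⟨⟨x, ?_⟩, hext⟩
  ext y
  constructor
  · intro hy
    obtain ⟨j, hj⟩ := Equiv.Perm.SameCycle.exists_nat_pow_eq ((hmem y).1 hy)
    have key : ∀ j : ℕ, ((G.twist.faceStep c) ^ j) x = ((G.faceStep c) ^ j) x := by
      intro j
      induction j with
      | zero => rfl
      | succ j ih =>
        rw [pow_succ', Equiv.Perm.mul_apply, ih, hstep, ← Equiv.Perm.mul_apply, ← pow_succ']
        exact (hmem _).2 ⟨j, by rw [zpow_natCast]⟩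
    exact ⟨j, by rw [zpow_natCast, key, hj]⟩
  · intro hy
    have hle : TGFT.cyc (G.twist.faceStep c) ≤ Setoid.ker fun y => y ∈ O := by
      refine cyc_le.2 fun z => propext ⟨fun hz => ?_, fun hz => ?_⟩
      · rw [hstep z hz]
        exact (hmem _).2 (Setoid.trans' (TGFT.cyc (G.faceStep c)) ((hmem z).1 hz) (cyc_apply _ _))
      · have h1 : G.faceStep c z ∈ O := by
          rw [twist_faceStep] at hz
          rcases hf : G.faceStep c z with w | k
          · simpa [hf] using hz
          · rw [hf] at hz
            exact absurd hz (hext _)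
        exact (hmem _).2 (Setoid.trans' (TGFT.cyc (G.faceStep c)) ((hmem _).1 h1)
          (Setoid.symm' _ (cyc_apply _ _)))
    exact ((hle hy : (x ∈ O) = (y ∈ O)).to_iff).1 ((hmem x).2 (Equiv.Perm.SameCycle.refl _ _))

theorem twist_melonic {G : FeynmanGraph d n 2} (h : G.Melonic) : G.twist.Melonic := by
  have hF : G.twist.numFaces = G.numFaces := by
    refine Finset.sum_congr rfl fun c _ => congrArg Set.ncard (Set.Subset.antisymm ?_
      (G.internalFaces_subset_twist c))
    have := G.twist.internalFaces_subset_twist c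
    rwa [twist_twist] at this
  rwa [Melonic, hF, twist_numLines]

theorem ExternalFace.twist {G : FeynmanGraph d n 2} {c : Fin d} {k l : Fin 2}
    (h : G.ExternalFace c k l) : G.twist.ExternalFace c k (Equiv.swap 0 1 l) := by
  obtain ⟨m, hm, hlt⟩ := h
  have key : ∀ j ≤ m, ((G.twist.faceStep c) ^ j) (Sum.inr k) =
      ((G.faceStep c) ^ j) (Sum.inr k) := by
    intro j
    induction j with
    | zero => intro _; rfl
    | succ j ih =>
      intro hj
      have h1 := hlt j (by omega)
      rw [pow_succ', Equiv.Perm.mul_apply] at h1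
      rw [pow_succ', Equiv.Perm.mul_apply, ih (by omega), twist_faceStep, pow_succ',
        Equiv.Perm.mul_apply]
      rcases hf : G.faceStep c ((G.faceStep c ^ j) (Sum.inr k)) with z | e
      · simp
      · rw [hf] at h1
        simp at h1
  refine ⟨m, ?_, fun j hj => ?_⟩
  · rw [pow_succ', Equiv.Perm.mul_apply] at hm
    rw [pow_succ', Equiv.Perm.mul_apply, key m le_rfl, twist_faceStep, hm]
    simp
  · rw [key (j + 1) (by omega)]
    exact hlt j hj

theorem externalFace_twist_iff {G : FeynmanGraph d n 2} {c : Fin d} {k l : Fin 2} :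
    G.twist.ExternalFace c k l ↔ G.ExternalFace c k (Equiv.swap 0 1 l) := by
  constructor
  · intro h
    simpa [twist_twist] using h.twist
  · intro h
    simpa using h.twist

/-- Up to an exchange of the external fields `T̄`, a boundary graph that is the melon of colour `i`
means that the two external legs share exactly the faces of colour `i`. -/
theorem boundaryMelon_iff {G : FeynmanGraph d n 2} {i : Fin d} :
    G.BoundaryMelon i ↔ G.SharesFace i ∨ G.twist.SharesFace i := by
  rw [sharesFace_iff, sharesFace_iff]
  simp only [externalFace_twist_iff]
  constructor
  · rintro ⟨π, hπ⟩
    have hcases : (∀ k, π k = k) ∨ ∀ k, π k = Equiv.swap 0 1 k := by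
      revert π
      simp only [Fin.forall_fin_two]
      intro π _
      have hne : π 0 ≠ π 1 := fun h => by simpa using π.injective h
      revert hne
      generalize π 0 = a
      generalize π 1 = b
      fin_cases a <;> fin_cases b <;> simp
    rcases hcases with h | h
    · left
      simpa [h] using hπ
    · right
      intro c k l
      rw [hπ, h]
      simp
  · rintro (h | h)
    · exact ⟨1, by simpa using h⟩
    · refine ⟨Equiv.swap 0 1, fun c k l => ?_⟩
      have := h c k (Equiv.swap 0 1 l)
      rw [Equiv.swap_apply_self] at this
      rw [this, Equiv.swap_apply_eq_iff]

/-- A colour `c ≠ i` tells the two pairings of the external fields apart. -/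
theorem SharesFace.not_twist {G : FeynmanGraph d n 2} (hd : 3 ≤ d) {i : Fin d}
    (h : G.SharesFace i) : ¬ G.twist.SharesFace i := by
  intro h'
  have : Nontrivial (Fin d) := Fin.nontrivial_iff_two_le.2 (by omega)
  obtain ⟨c, hc⟩ := exists_ne i
  have h1 := (sharesFace_iff.1 h' c 0 0).2 (by simpa using hc)
  rw [externalFace_twist_iff, Equiv.swap_apply_left] at h1
  exact hc ((h c).1 h1.cyc)

end FeynmanGraph

/-! ### Labellings -/

section

variable {d n N : ℕ}

/-- A list of half-vertices in which every vertex occurs exactly once. -/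
def FullLabels (L : List (Fin n × Bool)) : Prop := (L.map Prod.fst).Nodup ∧ L.length = n

theorem FullLabels.mem_map_fst {L : List (Fin n × Bool)} (hL : FullLabels L) (v : Fin n) :
    v ∈ L.map Prod.fst := by
  have h1 : (L.map Prod.fst).toFinset = Finset.univ := by
    rw [← Finset.card_eq_iff_eq_univ, List.toFinset_card_of_nodup hL.1, List.length_map, hL.2,
      Fintype.card_fin]
  rw [← List.mem_toFinset, h1]
  exact Finset.mem_univ v

theorem fullLabels_iff {L : List (Fin n × Bool)} :
    FullLabels L ↔ (L ++ L.map opp).Nodup ∧ ∀ h, h ∈ L ++ L.map opp := by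
  have hopp : Function.Injective (opp (n := n)) := fun a b h => by
    rw [← opp_opp a, h, opp_opp]
  constructor
  · intro hL
    have hnd : L.Nodup := List.Nodup.of_map _ hL.1
    have hinj : ∀ x ∈ L, ∀ y ∈ L, x.1 = y.1 → x = y := fun x hx y hy h =>
      List.inj_on_of_nodup_map hL.1 hx hy h
    refine ⟨List.nodup_append'.2 ⟨hnd, hnd.map hopp, ?_⟩, ?_⟩
    · intro x hx hx'
      obtain ⟨y, hy, rfl⟩ := List.mem_map.1 hx'
      exact opp_ne y (hinj _ hx _ hy rfl)
    · intro h
      obtain ⟨y, hy, hyv⟩ := List.mem_map.1 (hL.mem_map_fst h.1)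
      rcases eq_or_eq_opp hyv with rfl | rfl
      · exact List.mem_append_left _ hy
      · exact List.mem_append_right _ (List.mem_map.2 ⟨_, hy, opp_opp h⟩)
  · rintro ⟨hnd, hall⟩
    obtain ⟨h1, -, h3⟩ := List.nodup_append'.1 hnd
    refine ⟨h1.map_on ?_, ?_⟩
    · intro x hx y hy h
      rcases eq_or_eq_opp h with e | e
      · exact e
      · exact absurd (List.mem_map.2 ⟨y, hy, e.symm⟩) (h3 hx)
    · have h4 : (L ++ L.map opp).toFinset = Finset.univ := by
        ext h
        simpa using hall h
      have h5 := List.toFinset_card_of_nodup hnd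
      rw [h4, Finset.card_univ, Fintype.card_prod, Fintype.card_fin, Fintype.card_bool,
        List.length_append, List.length_map] at h5
      omega

namespace Line

theorem halves_perm (T : Line ((Fin n × Bool) × Deco d)) :
    T.halves.Perm (T.labels ++ T.labels.map opp) := by
  induction T with
  | bare => exact List.Perm.refl _
  | insertion x l r hl hr =>
    rw [List.perm_iff_count] at hl hr ⊢
    intro a
    have h1 := hl a
    have h2 := hr a
    simp only [halves, labels, List.count_cons, List.count_append, List.map_cons,
      List.map_append, List.cons_append] at h1 h2 ⊢
    omega

theorem mem_halves_of_mem_labels {T : Line ((Fin n × Bool) × Deco d)} {x : Fin n × Bool}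
    (h : x ∈ T.labels) : x ∈ T.halves :=
  T.halves_perm.mem_iff.2 (List.mem_append_left _ h)

theorem opp_mem_halves {T : Line ((Fin n × Bool) × Deco d)} {x : Fin n × Bool}
    (h : x ∈ T.halves) : opp x ∈ T.halves := by
  rw [T.halves_perm.mem_iff, List.mem_append, List.mem_map] at h ⊢
  rcases h with h | ⟨y, hy, rfl⟩
  · exact Or.inr ⟨x, h, rfl⟩
  · rw [opp_opp]
    exact Or.inl hy

theorem map_fst_colors (T : Line ((Fin n × Bool) × Deco d)) :
    T.colors.map Prod.fst = T.labels.map Prod.fst := by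
  induction T with
  | bare => rfl
  | insertion x l r hl hr => simp [colors, labels, hl, hr]

theorem map_target_segments_perm (p : Mom d) (h k : Fld n N)
    (T : Line ((Fin n × Bool) × Deco d)) :
    ((T.segments p h k).map fun s => s.2.1).Perm (k :: T.halves.map Sum.inl) := by
  induction T generalizing p h k with
  | bare => exact List.Perm.refl _
  | insertion x l r hl hr =>
    have h1 := hl x.2.2 (Sum.inl (opp x.1)) (Sum.inl (opp x.1))
    have h2 := hr p (Sum.inl x.1) k
    let _ : BEq (Fld n N) := instBEqOfDecidableEq
    rw [List.perm_iff_count] at h1 h2 ⊢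
    intro a
    have h3 := h1 a
    have h4 := h2 a
    simp only [segments, halves, List.count_cons, List.count_append, List.map_cons,
      List.map_append] at h3 h4 ⊢
    omega

theorem exists_mem_segments_source (p : Mom d) (h k : Fld n N)
    (T : Line ((Fin n × Bool) × Deco d)) : ∃ y, (h, y, p) ∈ T.segments p h k := by
  cases T with
  | bare => exact ⟨k, by simp [segments]⟩
  | insertion x l r => exact ⟨Sum.inl x.1, by simp [segments]⟩

end Line

/-- The labels of the vertices of a chain. -/
def chainLabels : List (LabelledStep d n) → List (Fin n × Bool)
  | [] => []
  | (x, _, t, t') :: s => x :: (t.labels ++ (t'.labels ++ chainLabels s))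

theorem chainFields_perm (h : Fin n × Bool) (s : List (LabelledStep d n)) :
    (chainFields h s).Perm (Sum.inl h :: Sum.inr 1 ::
      (chainLabels s ++ (chainLabels s).map opp).map Sum.inl) := by
  induction s generalizing h with
  | nil => exact List.Perm.refl _
  | cons y s ih =>
    obtain ⟨x, q, t, t'⟩ := y
    have h1 := t.halves_perm.map (Sum.inl (β := Fin 2))
    have h2 := t'.halves_perm.map (Sum.inl (β := Fin 2))
    have h3 := ih (opp x)
    let _ : BEq (Fld n 2) := instBEqOfDecidableEq
    rw [List.perm_iff_count] at h1 h2 h3 ⊢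
    intro a
    have h4 := h1 a
    have h5 := h2 a
    have h6 := h3 a
    simp only [chainFields, chainLabels, List.count_cons, List.count_append, List.map_cons,
      List.map_append, List.cons_append] at h4 h5 h6 ⊢
    omega

theorem map_target_chainSegments_perm (h : Fin n × Bool) (s : List (LabelledStep d n)) :
    ((chainSegments h s).map fun l => l.2.1).Perm (chainFields h s) := by
  induction s generalizing h with
  | nil => exact List.Perm.swap _ _ _
  | cons y s ih =>
    obtain ⟨x, q, t, t'⟩ := y
    have h1 := t.map_target_segments_perm q (Sum.inl h) (Sum.inl x : Fld n 2)
    have h2 := t'.map_target_segments_perm q (Sum.inl x) (Sum.inl h : Fld n 2)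
    have h3 := ih (opp x)
    let _ : BEq (Fld n 2) := instBEqOfDecidableEq
    rw [List.perm_iff_count] at h1 h2 h3 ⊢
    intro a
    have h4 := h1 a
    have h5 := h2 a
    have h6 := h3 a
    simp only [chainFields, chainSegments, List.count_cons, List.count_append,
      List.map_append, List.cons_append] at h4 h5 h6 ⊢
    omega

theorem map_fst_chainColors (i : Fin d) (s : List (LabelledStep d n)) :
    (chainColors i s).map Prod.fst = (chainLabels s).map Prod.fst := by
  induction s with
  | nil => rfl
  | cons y s ih =>
    obtain ⟨x, q, t, t'⟩ := y
    simp [chainColors, chainLabels, Line.map_fst_colors, ih]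

/-! ### Graphs with prescribed lines and colours -/

theorem exists_fun_of_nodup {A B : Type*} [Inhabited B] {L : List (A × B)}
    (hL : (L.map Prod.fst).Nodup) : ∃ f : A → B, ∀ e ∈ L, f e.1 = e.2 := by
  classical
  refine ⟨fun a => if h : ∃ b, (a, b) ∈ L then h.choose else default, ?_⟩
  rintro ⟨a, b⟩ he
  have h : ∃ b, (a, b) ∈ L := ⟨b, he⟩
  simp only [dif_pos h]
  have := List.inj_on_of_nodup_map hL h.choose_spec he rfl
  exact congrArg Prod.snd this

namespace FeynmanGraph

/-- A full list of lines and a full list of colours define a graph. -/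
theorem exists_follows_colored {L : List (Fld n N × Fld n N × Mom d)}
    {M : List (Fin n × Fin d)} {p : Fin N → Mom d} (hd : 0 < d)
    (hL : (L.map Prod.fst).Nodup) (htgt : ∀ y, y ∈ L.map fun l => l.2.1)
    (hM : (M.map Prod.fst).Nodup)
    (hp : ∀ k y p', (Sum.inr k, y, p') ∈ L → p' = p k) :
    ∃ (G : FeynmanGraph d n N) (q : Fin n × Bool → Mom d),
      G.Follows (Sum.elim q p) L ∧ G.Colored M := by
  have : Inhabited (Fin d) := ⟨⟨0, hd⟩⟩
  obtain ⟨color, hcolor⟩ := exists_fun_of_nodup hM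
  by_cases hne : Nonempty (Fld n N)
  · obtain ⟨z⟩ := hne
    have : Inhabited (Fld n N) := ⟨z⟩
    obtain ⟨f, hf⟩ := exists_fun_of_nodup hL
    have hsurj : Function.Surjective fun y => (f y).1 := by
      intro y
      obtain ⟨l, hl, rfl⟩ := List.mem_map.1 (htgt y)
      exact ⟨l.1, congrArg Prod.fst (hf l hl)⟩
    refine ⟨⟨color, Equiv.ofBijective _ (Finite.injective_iff_bijective.1
      (Finite.injective_iff_surjective.2 hsurj))⟩, fun h => (f (Sum.inl h)).2, ?_, hcolor⟩
    rintro ⟨a, b, p'⟩ hl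
    refine ⟨?_, ?_⟩
    · simp [Equiv.ofBijective_apply, hf _ hl]
    · rcases a with h | k
      · simp [hf _ hl]
      · exact (hp k b p' hl).symm
  · have : IsEmpty (Fld n N) := not_nonempty_iff.1 hne
    exact ⟨⟨color, Equiv.refl _⟩, fun _ _ => 0, fun l => isEmptyElim l.1, hcolor⟩

/-- A full list of lines and a full list of colours determine the graph and its momenta. -/
theorem eq_of_follows_colored {G G' : FeynmanGraph d n N} {q q' : Fin n × Bool → Mom d}
    {L : List (Fld n N × Fld n N × Mom d)} {M : List (Fin n × Fin d)} {p : Fin N → Mom d}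
    (hsrc : ∀ y, y ∈ L.map Prod.fst) (hM : ∀ v, v ∈ M.map Prod.fst)
    (h1 : G.Follows (Sum.elim q p) L) (h2 : G'.Follows (Sum.elim q' p) L)
    (h3 : G.Colored M) (h4 : G'.Colored M) : G = G' ∧ q = q' := by
  constructor
  · obtain ⟨c, w⟩ := G
    obtain ⟨c', w'⟩ := G'
    rw [FeynmanGraph.mk.injEq]
    constructor
    · funext v
      obtain ⟨l, hl, rfl⟩ := List.mem_map.1 (hM v)
      exact (h3 l hl).trans (h4 l hl).symm
    · refine Equiv.ext fun y => ?_
      obtain ⟨l, hl, rfl⟩ := List.mem_map.1 (hsrc y)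
      exact (h1 l hl).1.trans (h2 l hl).1.symm
  · funext h
    obtain ⟨l, hl, hlh⟩ := List.mem_map.1 (hsrc (Sum.inl h))
    have e1 := (h1 l hl).2
    have e2 := (h2 l hl).2
    rw [hlh] at e1 e2
    exact e1.trans e2.symm

variable {G : FeynmanGraph d n N} {q : Fld n N → Mom d}

theorem Follows.append {L L' : List (Fld n N × Fld n N × Mom d)} :
    G.Follows q (L ++ L') ↔ G.Follows q L ∧ G.Follows q L' := List.forall_mem_append

theorem Follows.cons {l : Fld n N × Fld n N × Mom d} {L : List (Fld n N × Fld n N × Mom d)} :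
    G.Follows q (l :: L) ↔ (G.wick l.1 = l.2.1 ∧ q l.1 = l.2.2) ∧ G.Follows q L :=
  List.forall_mem_cons

theorem Colored.append {M M' : List (Fin n × Fin d)} :
    G.Colored (M ++ M') ↔ G.Colored M ∧ G.Colored M' := List.forall_mem_append

theorem Colored.cons {m : Fin n × Fin d} {M : List (Fin n × Fin d)} :
    G.Colored (m :: M) ↔ G.color m.1 = m.2 ∧ G.Colored M := List.forall_mem_cons

/-- A dressed line of a graph is determined by its starting point and by a set `B` of end points,
provided that it meets `B` at its end only. -/
theorem Follows.line_unique {h k k' : Fld n N} {p : Mom d}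
    {T T' : Line ((Fin n × Bool) × Deco d)} {B : Fld n N → Prop}
    (h1 : G.Follows q (T.segments p h k)) (h2 : G.Follows q (T'.segments p h k'))
    (h3 : G.Colored T.colors) (h4 : G.Colored T'.colors) (hk : B k) (hk' : B k')
    (hT : ∀ x ∈ T.labels, ¬ B (Sum.inl x)) (hT' : ∀ x ∈ T'.labels, ¬ B (Sum.inl x))
    (hn : T.halves.Nodup) (hn' : T'.halves.Nodup) : T = T' ∧ k = k' := by
  induction T generalizing T' h k k' p B with
  | bare =>
    cases T' with
    | bare => exact ⟨rfl, (h1 (h, k, p) (by simp [Line.segments])).1.symm.trans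
        (h2 (h, k', p) (by simp [Line.segments])).1⟩
    | insertion x l r =>
      have e : k = Sum.inl x.1 := (h1 (h, k, p) (by simp [Line.segments])).1.symm.trans
        (h2 (h, Sum.inl x.1, p) (by simp [Line.segments])).1
      exact absurd (e ▸ hk) (hT' _ (by simp [Line.labels]))
  | insertion x l r ihl ihr =>
    cases T' with
    | bare =>
      have e : k' = Sum.inl x.1 := (h2 (h, k', p) (by simp [Line.segments])).1.symm.trans
        (h1 (h, Sum.inl x.1, p) (by simp [Line.segments])).1
      exact absurd (e ▸ hk') (hT _ (by simp [Line.labels]))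
    | insertion x' l' r' =>
      rw [Line.segments, Follows.cons, Follows.append] at h1 h2
      rw [Line.colors, Colored.cons, Colored.append] at h3 h4
      obtain ⟨⟨a1, -⟩, a2, a3⟩ := h1
      obtain ⟨⟨b1, -⟩, b2, b3⟩ := h2
      obtain ⟨c1, c2, c3⟩ := h3
      obtain ⟨d1, d2, d3⟩ := h4
      obtain ⟨y, c, m⟩ := x
      obtain ⟨y', c', m'⟩ := x'
      obtain rfl : y = y' := Sum.inl_injective (β := Fin N) (a1.symm.trans b1)
      obtain rfl : c = c' := c1.symm.trans d1
      obtain ⟨s, hs⟩ := l.exists_mem_segments_source m (Sum.inl (opp y))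
        (Sum.inl (opp y) : Fld n N)
      obtain ⟨s', hs'⟩ := l'.exists_mem_segments_source m' (Sum.inl (opp y))
        (Sum.inl (opp y) : Fld n N)
      obtain rfl : m = m' := (a2 _ hs).2.symm.trans (b2 _ hs').2
      simp only [Line.halves, List.nodup_cons, List.nodup_append', List.mem_append, not_or]
        at hn hn'
      simp only [Line.labels, List.mem_cons, List.mem_append] at hT hT'
      -- The loops are compared with the root `opp y` as end point, the remainders with the set `B`.
      have hloop : ∀ {l : Line ((Fin n × Bool) × Deco d)}, opp y ∉ l.halves →
          ∀ z ∈ l.labels, ¬ (Sum.inl z : Fld n N) = Sum.inl (opp y) := by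
        intro l hl z hz e
        exact hl (Sum.inl_injective e ▸ Line.mem_halves_of_mem_labels hz)
      obtain ⟨rfl, -⟩ := ihl (B := fun z => z = Sum.inl (opp y)) a2 b2 c2 d2 rfl rfl
        (hloop hn.1.1) (hloop hn'.1.1) hn.2.1 hn'.2.1
      obtain ⟨rfl, hkk⟩ := ihr a3 b3 c3 d3 hk hk' (fun z hz => hT z (Or.inr (Or.inr hz)))
        (fun z hz => hT' z (Or.inr (Or.inr hz))) hn.2.2.1.2 hn'.2.2.1.2
      exact ⟨rfl, hkk⟩

/-- If the lines of a list end where the lines of the list start, the set of these fields is closed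
under the lines. -/
theorem Follows.mem_iff {L : List (Fld n N × Fld n N × Mom d)} (hL : G.Follows q L)
    (hp : (L.map fun l => l.2.1).Perm (L.map Prod.fst)) (x : Fld n N) :
    x ∈ L.map Prod.fst ↔ G.wick x ∈ L.map Prod.fst := by
  constructor
  · intro hx
    obtain ⟨l, hl, rfl⟩ := List.mem_map.1 hx
    rw [(hL l hl).1, ← hp.mem_iff]
    exact List.mem_map_of_mem hl
  · intro hx
    rw [← hp.mem_iff, List.mem_map] at hx
    obtain ⟨l, hl, hlx⟩ := hx
    rw [← (hL l hl).1] at hlx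
    exact List.mem_map.2 ⟨l, hl, G.wick.injective hlx⟩

/-- The fields of a loop on the half-vertex `h` are closed under the lines. -/
theorem Follows.mem_loop_iff {p : Mom d} {h : Fld n N} {T : Line ((Fin n × Bool) × Deco d)}
    (hT : G.Follows q (T.segments p h h)) (x : Fld n N) :
    x ∈ h :: T.halves.map Sum.inl ↔ G.wick x ∈ h :: T.halves.map Sum.inl := by
  rw [← T.map_fst_segments p h h]
  refine hT.mem_iff ?_ x
  rw [T.map_fst_segments]
  exact T.map_target_segments_perm p h h

/-- The vertex of an insertion separates its loop from the rest of the graph. -/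
theorem Follows.separates {p : Mom d} {h k : Fld n N} {T : Line ((Fin n × Bool) × Deco d)}
    (hT : G.Follows q (T.segments p h k)) (hn : T.halves.Nodup) {x : Fin n × Bool}
    (hx : x ∈ T.labels) {y : Fld n N}
    (hy : ∀ z : Fin n × Bool, z.1 ≠ x.1 → y ≠ Sum.inl z) (hyx : y ≠ Sum.inl (opp x)) :
    ¬ G.link (Finset.univ.erase x.1) (Sum.inl (opp x)) y := by
  induction T generalizing p h k with
  | bare => simp [Line.labels] at hx
  | insertion w l r ihl ihr =>
    rw [Line.segments, Follows.cons, Follows.append] at hT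
    obtain ⟨-, hl, hr⟩ := hT
    simp only [Line.halves, List.nodup_cons, List.nodup_append', List.mem_append, not_or] at hn
    simp only [Line.labels, List.mem_cons, List.mem_append] at hx
    rcases hx with rfl | hx | hx
    · intro hlink
      have hiff := mem_iff_of_link (G := G)
        (S := {z | z ∈ Sum.inl (opp w.1) :: l.halves.map Sum.inl})
        hl.mem_loop_iff (fun z hz hzS => ?_) hlink
      · have hyS := hiff.1 (List.mem_cons_self)
        rcases List.mem_cons.1 hyS with rfl | hyS
        · exact hyx rfl
        · obtain ⟨z, hz, rfl⟩ := List.mem_map.1 hyS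
          by_cases hzw : z.1 = w.1.1
          · rcases eq_or_eq_opp hzw with rfl | rfl
            · exact hn.2.2.2 hz (List.mem_cons_self)
            · exact hn.1.1 hz
          · exact hy z hzw rfl
      · rcases List.mem_cons.1 hzS with e | e
        · exact absurd (congrArg Prod.fst (Sum.inl_injective e)) (Finset.ne_of_mem_erase hz)
        · obtain ⟨z', hz', e'⟩ := List.mem_map.1 e
          obtain rfl := Sum.inl_injective e'
          exact List.mem_cons_of_mem _ (List.mem_map_of_mem (Line.opp_mem_halves hz'))
    · exact ihl hl hn.2.1 hx
    · exact ihr hr hn.2.2.1.2 hx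

end FeynmanGraph

end

/-! ### Graphs made of dressed lines are tree-like and one-particle irreducible -/

section

variable {d n N : ℕ}

/-- Product of the propagators of a dressed line of momentum `p`. -/
def Line.amp (C : Mom d → ℝ) (p : Mom d) : Line (Deco d) → ℝ
  | .bare => C p
  | .insertion x l r => C p * l.amp C x.2 * r.amp C p

/-- The propagator of a bare line; external legs are amputated. -/
def segmentWeight (C : Mom d → ℝ) (l : Fld n N × Fld n N × Mom d) : ℝ :=
  if l.1.isLeft ∧ l.2.1.isLeft then C l.2.2 else 1

theorem Line.prod_segmentWeight (C : Mom d → ℝ) (p : Mom d) (h k : Fin n × Bool)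
    (T : Line ((Fin n × Bool) × Deco d)) :
    ((T.segments p (Sum.inl h : Fld n N) (Sum.inl k)).map (segmentWeight C)).prod =
      T.forget.amp C p := by
  induction T generalizing p h k with
  | bare => simp [segments, forget, amp, segmentWeight]
  | insertion x l r hl hr =>
    simp only [segments, List.map_cons, List.map_append, List.prod_cons, List.prod_append, hl, hr,
      forget, amp]
    simp [segmentWeight, mul_assoc]

namespace FeynmanGraph

variable {G : FeynmanGraph d n N} {q : Fld n N → Mom d}

theorem propagators_eq {q : Fin n × Bool → Mom d} {p : Fin N → Mom d}
    {L : List (Fld n N × Fld n N × Mom d)} (C : Mom d → ℝ) (hL : G.Follows (Sum.elim q p) L)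
    (hn : (L.map Prod.fst).Nodup) (hsrc : ∀ y, y ∈ L.map Prod.fst) :
    G.propagators C q = (L.map (segmentWeight C)).prod := by
  classical
  let g : Fld n N → ℝ := Sum.elim (fun h => if G.IsInternal h then C (q h) else 1) fun _ => 1
  have h1 : G.propagators C q = ∏ y, g y := by
    rw [Fintype.prod_sum_type]
    simp [g, propagators]
  have h2 : (Finset.univ : Finset (Fld n N)) = (L.map Prod.fst).toFinset := by
    ext y
    simpa using hsrc y
  rw [h1, h2, List.prod_toFinset _ hn, List.map_map]
  refine congrArg List.prod (List.map_congr_left fun l hl => ?_)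
  obtain ⟨h3, h4⟩ := hL l hl
  obtain ⟨y, z, p'⟩ := l
  simp only at h3 h4
  rcases y with h | k
  · simp only [Function.comp, g, segmentWeight, Sum.elim_inl, IsInternal, h3, Sum.isLeft_inl,
      true_and]
    rw [← h4, Sum.elim_inl]
  · simp [g, segmentWeight]

/-! #### Links -/

theorem link_of_wick {x y : Fld n N} (h : G.wick x = y) (E : Finset (Fin n)) : G.link E x y :=
  h ▸ G.link_wick E x

theorem apply_symm_of_wick {h k : Fld n N} {p : Mom d} (h1 : G.wick h = k) (h2 : q h = p) :
    q (G.wick.symm k) = p := by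
  rw [← h1, Equiv.symm_apply_apply, h2]

theorem Follows.link {p : Mom d} {h k : Fld n N} {T : Line ((Fin n × Bool) × Deco d)}
    (hT : G.Follows q (T.segments p h k)) (E : Finset (Fin n)) : G.link E h k := by
  induction T generalizing p h k with
  | bare => exact link_of_wick (hT _ (List.mem_singleton.2 rfl)).1 E
  | insertion x l r _ ihr =>
    rw [Line.segments, Follows.cons, Follows.append] at hT
    obtain ⟨⟨h1, -⟩, -, h3⟩ := hT
    exact Setoid.trans' _ (link_of_wick h1 E) (ihr h3)

theorem Follows.chain_link {G : FeynmanGraph d n 2} {q : Fld n 2 → Mom d} {h : Fin n × Bool}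
    {s : List (LabelledStep d n)} (hs : G.Follows q (chainSegments h s)) {E : Finset (Fin n)}
    (hE : ∀ y ∈ s, y.1.1 ∈ E) : G.link E (Sum.inl h) (Sum.inr 1) := by
  induction s generalizing h with
  | nil =>
    rw [chainSegments, Follows.cons] at hs
    exact link_of_wick hs.1.1 E
  | cons y s ih =>
    obtain ⟨x, q0, t, t'⟩ := y
    rw [chainSegments, Follows.append, Follows.append] at hs
    exact Setoid.trans' _ (hs.1.link E) (Setoid.trans' _ (G.link_opp (hE _ List.mem_cons_self))
      (ih hs.2.2 fun y hy => hE y (List.mem_cons_of_mem _ hy)))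

/-- The fields of a chain are linked to the rest of the graph only by the vertex of its first
half-vertex. -/
theorem Follows.chain_separates {G : FeynmanGraph d n 2} {q : Fld n 2 → Mom d}
    {h : Fin n × Bool} {s : List (LabelledStep d n)} (hs : G.Follows q (chainSegments h s))
    {E : Finset (Fin n)} (hE : h.1 ∉ E) {x y : Fld n 2} (hx : x ∈ chainFields h s)
    (hy : y ∉ chainFields h s) : ¬ G.link E x y := by
  intro hlink
  refine hy ((FeynmanGraph.mem_iff_of_link (G := G) (S := {z | z ∈ chainFields h s}) (fun z => ?_)
    (fun z hz hzS => ?_) hlink).1 hx)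
  · have := hs.mem_iff (by
      rw [map_fst_chainSegments]
      exact map_target_chainSegments_perm h s) z
    rwa [map_fst_chainSegments] at this
  · change Sum.inl z ∈ chainFields h s at hzS
    change Sum.inl (opp z) ∈ chainFields h s
    rw [(chainFields_perm h s).mem_iff] at hzS ⊢
    simp only [List.mem_cons, List.mem_map, List.mem_append, Sum.inl.injEq, exists_eq_right,
      reduceCtorEq, false_or] at hzS ⊢
    rcases hzS with rfl | hz1 | ⟨w, hw, rfl⟩
    · exact absurd hz hE
    · exact Or.inr (Or.inr ⟨z, hz1, rfl⟩)
    · exact Or.inr (Or.inl (by simpa using hw))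

/-- Every vertex of a chain separates its two halves. -/
theorem Follows.chain_bridge {G : FeynmanGraph d n 2} {q : Fld n 2 → Mom d} {h : Fin n × Bool}
    {s : List (LabelledStep d n)} (hs : G.Follows q (chainSegments h s))
    (hn : (chainFields h s).Nodup) {x : Fin n × Bool} (hx : x ∈ chainLabels s) :
    ¬ G.link (Finset.univ.erase x.1) (Sum.inl (opp x)) (Sum.inl x) := by
  have hne : ∀ z : Fin n × Bool, z.1 ≠ x.1 → (Sum.inl x : Fld n 2) ≠ Sum.inl z := by
    rintro z hz e
    exact hz (Sum.inl_injective e ▸ rfl)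
  have hne' : (Sum.inl x : Fld n 2) ≠ Sum.inl (opp x) := fun e =>
    opp_ne x (Sum.inl_injective e).symm
  induction s generalizing h with
  | nil => simp [chainLabels] at hx
  | cons y s ih =>
    obtain ⟨w, q0, t, t'⟩ := y
    rw [chainSegments, Follows.append, Follows.append] at hs
    simp only [chainFields, List.nodup_append'] at hn
    obtain ⟨hn1, ⟨hn2, hn3, hn4⟩, -⟩ := hn
    simp only [chainLabels, List.mem_cons, List.mem_append] at hx
    rcases hx with rfl | hx | hx | hx
    · refine hs.2.2.chain_separates (by simp) ?_ (hn4 List.mem_cons_self)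
      rw [(chainFields_perm _ s).mem_iff]
      exact List.mem_cons_self
    · exact hs.1.separates (List.Nodup.of_map _ (List.nodup_cons.1 hn1).2) hx hne hne'
    · exact hs.2.1.separates (List.Nodup.of_map _ (List.nodup_cons.1 hn2).2) hx hne hne'
    · exact ih hs.2.2 hn3 hx

/-- It is enough to check that each labelled half-vertex is separated from its other half. -/
theorem TreeLike.of_full (hc : ∀ x y, G.link Finset.univ x y) {L : List (Fin n × Bool)}
    (hL : FullLabels L)
    (h : ∀ x ∈ L, ¬ G.link (Finset.univ.erase x.1) (Sum.inl (opp x)) (Sum.inl x)) :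
    G.TreeLike := by
  refine ⟨hc, fun v hv => ?_⟩
  obtain ⟨⟨w, a⟩, hx, rfl⟩ := List.mem_map.1 (hL.mem_map_fst v)
  refine h _ hx ?_
  cases a
  · exact Setoid.symm' _ hv
  · exact hv

/-! #### Connectivity -/

theorem eqvGen_joined {cut : Set (Fin n × Bool)} {h k : Fin n × Bool}
    (hw : G.wick (Sum.inl h) = Sum.inl k) (hh : h ∉ cut) :
    Relation.EqvGen (G.Joined cut) h.1 k.1 := Relation.EqvGen.rel _ _ ⟨h.2, k.2, hh, hw⟩

/-- When one line is cut, each vertex of a dressed line remains connected to one of the two ends,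
and the two ends remain connected to each other unless the cut is on the dressed line. -/
theorem Follows.connected {p : Mom d} {h k : Fin n × Bool} {T : Line ((Fin n × Bool) × Deco d)}
    (hT : G.Follows q (T.segments p (Sum.inl h) (Sum.inl k))) (hn : (h :: T.halves).Nodup)
    (x : Fin n × Bool) :
    (∀ u ∈ T.labels, Relation.EqvGen (G.Joined {x}) u.1 h.1 ∨
      Relation.EqvGen (G.Joined {x}) u.1 k.1) ∧
    (x ∉ h :: T.halves → Relation.EqvGen (G.Joined {x}) h.1 k.1) := by
  induction T generalizing p h k with
  | bare =>
    refine ⟨by simp [Line.labels], fun hx => eqvGen_joined (hT _ (List.mem_singleton.2 rfl)).1 ?_⟩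
    rintro rfl
    exact hx List.mem_cons_self
  | insertion y l r ihl ihr =>
    rw [Line.segments, Follows.cons, Follows.append] at hT
    obtain ⟨⟨h1, -⟩, h2, h3⟩ := hT
    rw [Line.halves, ← List.cons_append, List.nodup_cons, List.nodup_append'] at hn
    obtain ⟨hn1, hn2, hn3, -⟩ := hn
    obtain ⟨il, -⟩ := ihl h2 hn2
    obtain ⟨ir, ir'⟩ := ihr h3 hn3
    have hy : h ≠ x → Relation.EqvGen (G.Joined {x}) h.1 y.1.1 := fun hx =>
      eqvGen_joined h1 hx
    have il' : ∀ u ∈ l.labels, Relation.EqvGen (G.Joined {x}) u.1 y.1.1 := fun u hu =>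
      (il u hu).elim id id
    by_cases hx : h = x
    · subst hx
      have hyk := ir' fun h' => hn1 (List.mem_append_right _ h')
      refine ⟨fun u hu => Or.inr ?_, fun h' => absurd List.mem_cons_self h'⟩
      simp only [Line.labels, List.mem_cons, List.mem_append] at hu
      rcases hu with rfl | hu | hu
      · exact hyk
      · exact (il' u hu).trans _ _ _ hyk
      · exact (ir u hu).elim (fun h' => h'.trans _ _ _ hyk) id
    · have hyh := (hy hx).symm _ _
      refine ⟨fun u hu => ?_, fun h' => (hy hx).trans _ _ _ (ir' fun h'' => h' ?_)⟩
      · simp only [Line.labels, List.mem_cons, List.mem_append] at hu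
        rcases hu with rfl | hu | hu
        · exact Or.inl hyh
        · exact Or.inl ((il' u hu).trans _ _ _ hyh)
        · exact (ir u hu).imp_left fun h' => h'.trans _ _ _ hyh
      · rw [Line.halves]
        exact List.mem_cons_of_mem _ (List.mem_cons_of_mem _ (List.mem_append_right _ h''))

/-- When one line is cut, a chain remains connected, since it contains two paths between any two
consecutive vertices. -/
theorem Follows.chain_connected {G : FeynmanGraph d n 2} {q : Fld n 2 → Mom d}
    {h : Fin n × Bool} {s : List (LabelledStep d n)} (hs : G.Follows q (chainSegments h s))
    (hn : (chainFields h s).Nodup) (x : Fin n × Bool) :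
    ∀ u ∈ chainLabels s, Relation.EqvGen (G.Joined {x}) u.1 h.1 := by
  induction s generalizing h with
  | nil => simp [chainLabels]
  | cons y s ih =>
    obtain ⟨w, q0, t, t'⟩ := y
    rw [chainSegments, Follows.append, Follows.append] at hs
    obtain ⟨h1, h2, h3⟩ := hs
    simp only [chainFields, List.nodup_append'] at hn
    obtain ⟨hn1, ⟨hn2, hn3, -⟩, hn4⟩ := hn
    have e1 : (h :: t.halves).map (Sum.inl (β := Fin 2)) = Sum.inl h :: t.halves.map Sum.inl := rfl
    have e2 : (w :: t'.halves).map (Sum.inl (β := Fin 2)) = Sum.inl w :: t'.halves.map Sum.inl :=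
      rfl
    obtain ⟨a1, a2⟩ := h1.connected (List.Nodup.of_map _ (e1 ▸ hn1)) x
    obtain ⟨b1, b2⟩ := h2.connected (List.Nodup.of_map _ (e2 ▸ hn2)) x
    have hwh : Relation.EqvGen (G.Joined {x}) w.1 h.1 := by
      by_cases hx : x ∈ h :: t.halves
      · refine b2 fun hx' => hn4 (a := Sum.inl x) ?_ (List.mem_append_left _ ?_)
        · rw [← e1]
          exact List.mem_map_of_mem hx
        · rw [← e2]
          exact List.mem_map_of_mem hx'
      · exact (a2 hx).symm _ _
    intro u hu
    simp only [chainLabels, List.mem_cons, List.mem_append] at hu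
    rcases hu with rfl | hu | hu | hu
    · exact hwh
    · exact (a1 u hu).elim id fun h' => h'.trans _ _ _ hwh
    · exact (b1 u hu).elim (fun h' => h'.trans _ _ _ hwh) id
    · exact (ih h3 hn3 u hu).trans _ _ _ hwh

theorem OnePI.of_full (hn : 0 < n)
    (hext : ∀ k : Fin N, (G.wick (Sum.inr k)).isLeft ∧ (G.wick.symm (Sum.inr k)).isLeft)
    {L : List (Fin n × Bool)} (hL : FullLabels L) (v : Fin n)
    (h : ∀ x, ∀ u ∈ L, Relation.EqvGen (G.Joined {x}) u.1 v) : G.OnePI := by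
  have hcut : ∀ x, G.ConnectedWithout {x} := by
    intro x u w
    obtain ⟨u', hu', rfl⟩ := List.mem_map.1 (hL.mem_map_fst u)
    obtain ⟨w', hw', rfl⟩ := List.mem_map.1 (hL.mem_map_fst w)
    exact (h x u' hu').trans _ _ _ ((h x w' hw').symm _ _)
  refine ⟨hn, hext, fun u w => ?_, hcut⟩
  refine Relation.EqvGen.mono (r := G.Joined {(⟨0, hn⟩, true)}) ?_ _ _ (hcut _ u w)
  rintro a b ⟨a', b', -, hab⟩
  exact ⟨a', b', Set.notMem_empty _, hab⟩

/-! #### Momentum conservation -/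

/-- Momentum conservation at the vertex `v`. -/
def TransmitsAt (G : FeynmanGraph d n N) (q : Fld n N → Mom d) (v : Fin n) : Prop :=
  ∀ (a : Bool) (c : Fin d),
    q (G.wick.symm (Sum.inl (v, a))) c = q (Sum.inl (G.strand c (v, a))) c

theorem transmitsAt_of {x : Fin n × Bool} {p p' : Mom d} (h1 : q (Sum.inl x) = p)
    (h2 : q (G.wick.symm (Sum.inl x)) = p) (h3 : q (Sum.inl (opp x)) = p')
    (h4 : q (G.wick.symm (Sum.inl (opp x))) = p') (hc : p (G.color x.1) = p' (G.color x.1)) :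
    G.TransmitsAt q x.1 := by
  intro a c
  rcases eq_or_eq_opp (x := (x.1, a)) (h := x) rfl with e | e
  · rw [e, h2]
    by_cases h : c = G.color x.1
    · rw [show G.strand c x = opp x by simp [strand, opp, h], h3, h, hc]
    · rw [show G.strand c x = x by simp [strand, h], h1]
  · rw [e, h4]
    by_cases h : c = G.color x.1
    · rw [show G.strand c (opp x) = x by simp [strand, opp, h], h1, h, hc]
    · rw [show G.strand c (opp x) = opp x by simp [strand, opp, h], h3]

theorem Follows.source {p : Mom d} {h k : Fld n N} {T : Line ((Fin n × Bool) × Deco d)}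
    (hT : G.Follows q (T.segments p h k)) : q h = p := by
  obtain ⟨y, hy⟩ := T.exists_mem_segments_source p h k
  exact (hT _ hy).2

theorem Follows.target {p : Mom d} {h k : Fld n N} {T : Line ((Fin n × Bool) × Deco d)}
    (hT : G.Follows q (T.segments p h k)) : q (G.wick.symm k) = p := by
  obtain ⟨y, hy⟩ := T.exists_mem_segments_target p h k
  exact apply_symm_of_wick (hT _ hy).1 (hT _ hy).2

theorem Follows.transmitsAt {p : Mom d} {h k : Fld n N} {T : Line ((Fin n × Bool) × Deco d)}
    (hT : G.Follows q (T.segments p h k)) (hc : G.Colored T.colors) (hv : T.forget.Valid p) :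
    ∀ x ∈ T.labels, G.TransmitsAt q x.1 := by
  induction T generalizing p h k with
  | bare => simp [Line.labels]
  | insertion y l r ihl ihr =>
    rw [Line.segments, Follows.cons, Follows.append] at hT
    obtain ⟨⟨h1, h2⟩, h3, h4⟩ := hT
    rw [Line.colors, Colored.cons, Colored.append] at hc
    obtain ⟨c1, c2, c3⟩ := hc
    obtain ⟨v1, v2, v3⟩ := hv
    intro x hx
    simp only [Line.labels, List.mem_cons, List.mem_append] at hx
    rcases hx with rfl | hx | hx
    · refine transmitsAt_of h4.source (apply_symm_of_wick h1 h2) h3.source h3.target ?_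
      rw [c1]
      exact v1.symm
    · exact ihl h3 c2 v2 x hx
    · exact ihr h4 c3 v3 x hx

theorem Follows.chain_transmitsAt {G : FeynmanGraph d n 2} {q : Fld n 2 → Mom d}
    {h : Fin n × Bool} {s : List (LabelledStep d n)} {i : Fin d}
    (hs : G.Follows q (chainSegments h s)) (hc : G.Colored (chainColors i s))
    (hv : ∀ y ∈ s, StepValid i (forgetStep y)) :
    (∃ p' : Mom d, p' i = 0 ∧ q (Sum.inl h) = p' ∧ q (G.wick.symm (Sum.inl h)) = p') ∧
      ∀ x ∈ chainLabels s, G.TransmitsAt q x.1 := by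
  induction s generalizing h with
  | nil =>
    rw [chainSegments, Follows.cons, Follows.cons] at hs
    obtain ⟨⟨-, h1⟩, ⟨h2, h3⟩, -⟩ := hs
    exact ⟨⟨0, rfl, h1, apply_symm_of_wick h2 h3⟩, by simp [chainLabels]⟩
  | cons y s ih =>
    have hvy := hv y List.mem_cons_self
    obtain ⟨w, q0, t, t'⟩ := y
    rw [chainSegments, Follows.append, Follows.append] at hs
    obtain ⟨h1, h2, h3⟩ := hs
    rw [chainColors, Colored.cons, Colored.append, Colored.append] at hc
    obtain ⟨c1, c2, c3, c4⟩ := hc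
    obtain ⟨v1, v2, v3⟩ := hvy
    obtain ⟨⟨p', e1, e2, e3⟩, hrest⟩ := ih h3 c4 fun y hy => hv y (List.mem_cons_of_mem _ hy)
    refine ⟨⟨q0, v1, h1.source, h2.target⟩, fun x hx => ?_⟩
    simp only [chainLabels, List.mem_cons, List.mem_append] at hx
    rcases hx with rfl | hx | hx | hx
    · refine transmitsAt_of h2.source h1.target e2 e3 ?_
      rw [show G.color x.1 = i from c1, e1]
      exact v1
    · exact h1.transmitsAt c2 v2 x hx
    · exact h2.transmitsAt c3 v3 x hx
    · exact hrest x hx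

theorem Follows.chain_end {G : FeynmanGraph d n 2} {q : Fld n 2 → Mom d} {h : Fin n × Bool}
    {s : List (LabelledStep d n)} (hs : G.Follows q (chainSegments h s)) :
    ∃ z : Fin n × Bool, G.wick (Sum.inl z) = Sum.inr 1 ∧ q (Sum.inl z) = 0 ∧
      G.wick (Sum.inr 1) = Sum.inl z := by
  induction s generalizing h with
  | nil =>
    rw [chainSegments, Follows.cons, Follows.cons] at hs
    exact ⟨h, hs.1.1, hs.1.2, hs.2.1.1⟩
  | cons y s ih =>
    obtain ⟨w, q0, t, t'⟩ := y
    rw [chainSegments, Follows.append, Follows.append] at hs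
    exact ih hs.2.2

theorem conserves_of_full {q : Fin n × Bool → Mom d} {p : Fin N → Mom d}
    (hext : ∀ k, Sum.elim q p (G.wick.symm (Sum.inr k)) = p k) {L : List (Fin n × Bool)}
    (hL : FullLabels L) (h : ∀ x ∈ L, G.TransmitsAt (Sum.elim q p) x.1) : G.Conserves p q := by
  refine ⟨hext, fun x c => ?_⟩
  obtain ⟨y, hy, hyv⟩ := List.mem_map.1 (hL.mem_map_fst x.1)
  have := h y hy x.2 c
  rw [hyv] at this
  exact this

end FeynmanGraph

end

/-! ### Two-point graphs -/

section

variable {d n N : ℕ}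

/-- If a list of fields consists of the external fields and of both halves of the labelled vertices,
then the labels are full if and only if the list enumerates all fields without repetition. -/
theorem fullLabels_iff_of_perm {L : List (Fin n × Bool)} {F : List (Fld n N)}
    (hF : F.Perm ((List.finRange N).map Sum.inr ++ (L ++ L.map opp).map Sum.inl)) :
    FullLabels L ↔ F.Nodup ∧ ∀ y, y ∈ F := by
  rw [fullLabels_iff, hF.nodup_iff, List.nodup_append' (l₁ := (List.finRange N).map Sum.inr)]
  simp only [hF.mem_iff, List.mem_append, List.mem_map (f := (Sum.inl : Fin n × Bool → Fld n N)),
    List.mem_map (f := (Sum.inr : Fin N → Fld n N)), List.mem_finRange, true_and]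
  constructor
  · rintro ⟨h1, h2⟩
    refine ⟨⟨(List.nodup_finRange N).map Sum.inr_injective, h1.map Sum.inl_injective, ?_⟩, ?_⟩
    · intro y hy hy'
      obtain ⟨k, -, rfl⟩ := List.mem_map.1 hy
      obtain ⟨z, -, hz⟩ := List.mem_map.1 hy'
      simp at hz
    · rintro (h | k)
      · exact Or.inr ⟨h, by simpa using h2 h, rfl⟩
      · exact Or.inl ⟨k, rfl⟩
  · rintro ⟨⟨-, h2, -⟩, h3⟩
    refine ⟨List.Nodup.of_map _ h2, fun h => ?_⟩
    rcases h3 (Sum.inl h) with ⟨k, hk⟩ | ⟨z, hz, hzh⟩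
    · simp at hk
    · simpa [← Sum.inl_injective hzh] using hz

/-- A labelled 1PI melonic two-point graph: a vertex, and a dressed line on one of its halves. -/
abbrev LabelledTwo (d n : ℕ) := ((Fin n × Bool) × Deco d) × Line ((Fin n × Bool) × Deco d)

/-- The bare lines of a two-point graph of external momentum `p`: the two external legs are hooked
to the same half-vertex, and a dressed line closes up on the other half. -/
def twoSegments (p : Mom d) (x : LabelledTwo d n) : List (Fld n 1 × Fld n 1 × Mom d) :=
  (Sum.inr 0, Sum.inl x.1.1, p) :: (Sum.inl x.1.1, Sum.inr 0, p) ::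
    x.2.segments x.1.2.2 (Sum.inl (opp x.1.1)) (Sum.inl (opp x.1.1))

/-- The vertices of a two-point graph and their colours. -/
def twoColors (x : LabelledTwo d n) : List (Fin n × Fin d) := (x.1.1.1, x.1.2.1) :: x.2.colors

/-- The labels of the vertices of a two-point graph. -/
def twoLabels (x : LabelledTwo d n) : List (Fin n × Bool) := x.1.1 :: x.2.labels

/-- Forget the labels. -/
def forgetTwo (x : LabelledTwo d n) : Deco d × Line (Deco d) := (x.1.2, x.2.forget)

/-- Momentum conservation in a two-point graph. -/
def TwoValid (p : Mom d) (u : Deco d × Line (Deco d)) : Prop :=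
  u.1.2 u.1.1 = p u.1.1 ∧ u.2.Valid u.1.2

theorem map_fst_twoSegments (p : Mom d) (x : LabelledTwo d n) :
    (twoSegments p x).map Prod.fst = Sum.inr 0 :: Sum.inl x.1.1 :: Sum.inl (opp x.1.1) ::
      x.2.halves.map Sum.inl := by
  simp [twoSegments, Line.map_fst_segments]

theorem fullLabels_two_iff (p : Mom d) (x : LabelledTwo d n) :
    FullLabels (twoLabels x) ↔
      ((twoSegments p x).map Prod.fst).Nodup ∧ ∀ y, y ∈ (twoSegments p x).map Prod.fst := by
  refine fullLabels_iff_of_perm ?_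
  rw [map_fst_twoSegments]
  refine List.Perm.cons _ ?_
  have h1 := x.2.halves_perm
  have h2 : (x.1.1 :: opp x.1.1 :: x.2.halves).Perm
      (twoLabels x ++ (twoLabels x).map opp) := by
    rw [List.perm_iff_count] at h1 ⊢
    intro a
    have h3 := h1 a
    simp only [twoLabels, List.count_cons, List.count_append, List.map_cons,
      List.cons_append] at h3 ⊢
    omega
  exact h2.map Sum.inl

theorem map_target_twoSegments_perm (p : Mom d) (x : LabelledTwo d n) :
    ((twoSegments p x).map fun l => l.2.1).Perm ((twoSegments p x).map Prod.fst) := by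
  rw [map_fst_twoSegments]
  exact (List.Perm.swap _ _ _).trans
    ((((x.2.map_target_segments_perm _ _ _)).cons _).cons _)

theorem map_fst_twoColors (x : LabelledTwo d n) :
    (twoColors x).map Prod.fst = (twoLabels x).map Prod.fst := by
  simp [twoColors, twoLabels, Line.map_fst_colors]

namespace FeynmanGraph

/-- The graph `G`, with line momenta `q` and external momentum `p`, is described by `x`. -/
def IsTwo (p : Mom d) (G : FeynmanGraph d n 1) (q : Fin n × Bool → Mom d)
    (x : LabelledTwo d n) : Prop :=
  G.Follows (Sum.elim q fun _ => p) (twoSegments p x) ∧ G.Colored (twoColors x)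

/-- Every 1PI melonic two-point graph is a vertex with a dressed line on one of its halves. -/
theorem exists_isTwo (hd : 3 ≤ d) {p : Mom d} {G : FeynmanGraph d n 1}
    {q : Fin n × Bool → Mom d} (h1 : G.OnePI) (h2 : G.Melonic)
    (h3 : G.Conserves (fun _ => p) q) :
    ∃ x : LabelledTwo d n, G.IsTwo p q x ∧ TwoValid p (forgetTwo x) ∧
      FullLabels (twoLabels x) := by
  have hG := (h1.melonic_iff_treeLike_two hd).1 h2
  have hq : G.Transmits (Sum.elim q fun _ => p) := fun h c => by
    rw [Sum.elim_inl]
    exact h3.2 h c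
  rcases hw : G.wick (Sum.inr 0) with z | k
  swap
  · have := (h1.2.1 0).1
    rw [hw] at this
    simp at this
  obtain ⟨l, hl⟩ := hG.wick_root h1 hw
  rw [Fin.fin_one_eq_zero l] at hl
  obtain ⟨S₁, S₂, hS₁, hS₂, hdis, -, -, h01, h02, hcov⟩ :=
    (G.segment_univ 0).split hG hw (by simp)
  have hS₂' := hS₂.eq_of_wick_eq hG hl
  obtain ⟨T, t1, t2, t3, t4, t5⟩ := hS₁.exists_line hG hq fun e he => by
    rw [Fin.fin_one_eq_zero e] at he
    exact absurd he h01
  have hqz : q z = p := by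
    have := h3.1 0
    rwa [← hl, Equiv.symm_apply_apply] at this
  refine ⟨((z, G.color z.1, q (TGFT.opp z)), T), ⟨?_, ?_⟩, ⟨?_, t3⟩, ?_⟩
  · refine Follows.cons.2 ⟨⟨hw, rfl⟩, Follows.cons.2 ⟨⟨hl, hqz⟩, t1⟩⟩
  · exact Colored.cons.2 ⟨rfl, t2⟩
  · exact (hq.apply_color hw).symm
  · rw [fullLabels_two_iff p, map_fst_twoSegments]
    constructor
    · refine List.nodup_cons.2 ⟨?_, List.nodup_cons.2 ⟨?_, t4⟩⟩
      · simp
      · rw [← t5]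
        exact Finset.disjoint_right.1 hdis hS₂.mem
    · intro y
      rw [List.mem_cons, List.mem_cons, ← t5]
      by_cases hy : y = Sum.inr 0
      · exact Or.inl hy
      · rcases hcov y (Finset.mem_univ _) hy with h | h
        · exact Or.inr (Or.inr h)
        · rw [hS₂', Finset.mem_singleton] at h
          exact Or.inr (Or.inl h)

theorem isTwo_realizable (hd : 3 ≤ d) (p : Mom d) {x : LabelledTwo d n}
    (hx : FullLabels (twoLabels x)) :
    ∃ (G : FeynmanGraph d n 1) (q : Fin n × Bool → Mom d), G.IsTwo p q x := by
  obtain ⟨h1, h2⟩ := (fullLabels_two_iff p x).1 hx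
  refine exists_follows_colored (by omega) h1 (fun y => ?_) ?_ ?_
  · rw [(map_target_twoSegments_perm p x).mem_iff]
    exact h2 y
  · rw [map_fst_twoColors]
    exact hx.1
  · intro k y p' hl
    rw [map_fst_twoSegments] at h1
    rcases List.mem_cons.1 hl with e | hl
    · exact congrArg (fun l => l.2.2) e
    · have := List.mem_map_of_mem (f := Prod.fst) hl
      rw [List.map_cons, Line.map_fst_segments] at this
      rw [Fin.fin_one_eq_zero k] at this
      exact absurd this (List.nodup_cons.1 h1).1

theorem IsTwo.onePI {p : Mom d} {G : FeynmanGraph d n 1} {q : Fin n × Bool → Mom d}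
    {x : LabelledTwo d n} (h : G.IsTwo p q x) (hx : FullLabels (twoLabels x)) : G.OnePI := by
  obtain ⟨hF, -⟩ := h
  have hn := ((fullLabels_two_iff p x).1 hx).1
  rw [map_fst_twoSegments] at hn
  rw [twoSegments, Follows.cons, Follows.cons] at hF
  obtain ⟨⟨h1, -⟩, ⟨h2, -⟩, h3⟩ := hF
  simp only at h1 h2
  refine OnePI.of_full x.1.1.1.pos (fun k => ?_) hx x.1.1.1 fun y u hu => ?_
  · rw [Fin.fin_one_eq_zero k, h1, ← h2, Equiv.symm_apply_apply]
    exact ⟨rfl, rfl⟩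
  · rcases List.mem_cons.1 hu with rfl | hu
    · exact Relation.EqvGen.refl _
    · exact ((h3.connected (List.Nodup.of_map (Sum.inl (β := Fin 1))
        (List.nodup_cons.1 (List.nodup_cons.1 hn).2).2) y).1 u hu).elim id id

theorem IsTwo.melonic (hd : 3 ≤ d) {p : Mom d} {G : FeynmanGraph d n 1}
    {q : Fin n × Bool → Mom d} {x : LabelledTwo d n} (h : G.IsTwo p q x)
    (hx : FullLabels (twoLabels x)) : G.Melonic := by
  have h1 := h.onePI hx
  refine (h1.melonic_iff_treeLike_two hd).2 (TreeLike.of_full h1.link hx fun y hy => ?_)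
  have hn := ((fullLabels_two_iff p x).1 hx).1
  rw [map_fst_twoSegments] at hn
  have hF := h.1
  rw [twoSegments, Follows.cons, Follows.cons] at hF
  have hn1 := (List.nodup_cons.1 hn).2
  have hn2 := List.nodup_cons.1 hn1
  rcases List.mem_cons.1 hy with rfl | hy
  · intro hlink
    refine hn2.1 ((mem_iff_of_link (G := G)
      (S := {z | z ∈ Sum.inl (TGFT.opp x.1.1) :: x.2.halves.map Sum.inl})
      hF.2.2.mem_loop_iff (fun z hz hzS => ?_) hlink).1 List.mem_cons_self)
    rcases List.mem_cons.1 hzS with e | e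
    · exact absurd (congrArg Prod.fst (Sum.inl_injective e)) (Finset.ne_of_mem_erase hz)
    · obtain ⟨z', hz', e'⟩ := List.mem_map.1 e
      obtain rfl := Sum.inl_injective e'
      exact List.mem_cons_of_mem _ (List.mem_map_of_mem (Line.opp_mem_halves hz'))
  · refine hF.2.2.separates (List.Nodup.of_map _ (List.nodup_cons.1 hn2.2).2) hy ?_ ?_
    · intro z hz e
      exact hz (Sum.inl_injective e ▸ rfl)
    · exact fun e => opp_ne y (Sum.inl_injective e).symm

theorem IsTwo.conserves {p : Mom d} {G : FeynmanGraph d n 1} {q : Fin n × Bool → Mom d}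
    {x : LabelledTwo d n} (h : G.IsTwo p q x) (hx : FullLabels (twoLabels x))
    (hv : TwoValid p (forgetTwo x)) : G.Conserves (fun _ => p) q := by
  obtain ⟨hF, hC⟩ := h
  rw [twoSegments, Follows.cons, Follows.cons] at hF
  rw [twoColors, Colored.cons] at hC
  obtain ⟨⟨h1, h1'⟩, ⟨h2, h2'⟩, h3⟩ := hF
  refine conserves_of_full (fun k => ?_) hx fun y hy => ?_
  · rw [Fin.fin_one_eq_zero k]
    exact apply_symm_of_wick h2 h2'
  · rcases List.mem_cons.1 hy with rfl | hy
    · refine transmitsAt_of h2' (apply_symm_of_wick h1 h1') h3.source h3.target ?_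
      rw [hC.1]
      exact hv.1.symm
    · exact h3.transmitsAt hC.2 hv.2 y hy

theorem IsTwo.unique {p : Mom d} {G : FeynmanGraph d n 1} {q : Fin n × Bool → Mom d}
    {x x' : LabelledTwo d n} (h : G.IsTwo p q x) (h' : G.IsTwo p q x')
    (hx : FullLabels (twoLabels x)) (hx' : FullLabels (twoLabels x')) : x = x' := by
  have hn := ((fullLabels_two_iff p x).1 hx).1
  have hn' := ((fullLabels_two_iff p x').1 hx').1
  rw [map_fst_twoSegments] at hn hn'
  obtain ⟨⟨y, c, m⟩, T⟩ := x
  obtain ⟨⟨y', c', m'⟩, T'⟩ := x'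
  obtain ⟨h1, h2⟩ := h
  obtain ⟨h1', h2'⟩ := h'
  rw [twoSegments, Follows.cons, Follows.cons] at h1 h1'
  rw [twoColors, Colored.cons] at h2 h2'
  obtain ⟨⟨a1, -⟩, -, a3⟩ := h1
  obtain ⟨⟨b1, -⟩, -, b3⟩ := h1'
  obtain rfl : y = y' := Sum.inl_injective (β := Fin 1) (a1.symm.trans b1)
  obtain rfl : c = c' := h2.1.symm.trans h2'.1
  obtain rfl : m = m' := a3.source.symm.trans b3.source
  have hh : ∀ {T : Line ((Fin n × Bool) × Deco d)}, (Sum.inr 0 :: Sum.inl y ::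
      Sum.inl (TGFT.opp y) :: T.halves.map Sum.inl : List (Fld n 1)).Nodup →
      T.halves.Nodup ∧ ∀ z ∈ T.labels, ¬ (Sum.inl z : Fld n 1) = Sum.inl (TGFT.opp y) := by
    intro T hT
    have h3 := List.nodup_cons.1 (List.nodup_cons.1 (List.nodup_cons.1 hT).2).2
    refine ⟨List.Nodup.of_map _ h3.2, fun z hz e => h3.1 ?_⟩
    rw [← e]
    exact List.mem_map_of_mem (Line.mem_halves_of_mem_labels hz)
  obtain ⟨rfl, -⟩ := a3.line_unique (B := fun z => z = Sum.inl (TGFT.opp y)) b3 h2.2 h2'.2 rfl rfl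
    (hh hn).2 (hh hn').2 (hh hn).1 (hh hn').1
  rfl

theorem IsTwo.graph_unique {p : Mom d} {G G' : FeynmanGraph d n 1}
    {q q' : Fin n × Bool → Mom d} {x : LabelledTwo d n} (h : G.IsTwo p q x)
    (h' : G'.IsTwo p q' x) (hx : FullLabels (twoLabels x)) : G = G' ∧ q = q' :=
  eq_of_follows_colored ((fullLabels_two_iff p x).1 hx).2
    (fun v => by rw [map_fst_twoColors]; exact hx.mem_map_fst v) h.1 h'.1 h.2 h'.2

theorem IsTwo.propagators_eq {p : Mom d} {G : FeynmanGraph d n 1} {q : Fin n × Bool → Mom d}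
    {x : LabelledTwo d n} (C : Mom d → ℝ) (h : G.IsTwo p q x) (hx : FullLabels (twoLabels x)) :
    G.propagators C q = (forgetTwo x).2.amp C (forgetTwo x).1.2 := by
  obtain ⟨h1, h2⟩ := (fullLabels_two_iff p x).1 hx
  rw [FeynmanGraph.propagators_eq C h.1 h1 h2, twoSegments, List.map_cons, List.map_cons,
    List.prod_cons, List.prod_cons, Line.prod_segmentWeight]
  simp [segmentWeight, forgetTwo]

end FeynmanGraph

/-! ### Four-point graphs -/

/-- A labelled 1PI melonic four-point graph: the vertex hooked to the first external leg, and a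
chain that leads to the second one. -/
abbrev LabelledFour (d n : ℕ) := (Fin n × Bool) × List (LabelledStep d n)

/-- The bare lines of a four-point graph. -/
def fourSegments (x : LabelledFour d n) : List (Fld n 2 × Fld n 2 × Mom d) :=
  (Sum.inr 0, Sum.inl x.1, 0) :: (Sum.inl x.1, Sum.inr 0, 0) :: chainSegments (opp x.1) x.2

/-- The vertices of a four-point graph and their colours. -/
def fourColors (i : Fin d) (x : LabelledFour d n) : List (Fin n × Fin d) :=
  (x.1.1, i) :: chainColors i x.2

/-- The labels of the vertices of a four-point graph. -/
def fourLabels (x : LabelledFour d n) : List (Fin n × Bool) := x.1 :: chainLabels x.2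

/-- Momentum conservation in a four-point graph. -/
def FourValid (i : Fin d) (u : List (Mom d × Line (Deco d) × Line (Deco d))) : Prop :=
  ∀ y ∈ u, StepValid i y

/-- Forget the labels. -/
def forgetFour (x : LabelledFour d n) : List (Mom d × Line (Deco d) × Line (Deco d)) :=
  x.2.map forgetStep

/-- Product of the propagators of a four-point graph. -/
def fourAmp (C : Mom d → ℝ) (u : List (Mom d × Line (Deco d) × Line (Deco d))) : ℝ :=
  (u.map fun y => y.2.1.amp C y.1 * y.2.2.amp C y.1).prod

theorem map_fst_fourSegments (x : LabelledFour d n) :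
    (fourSegments x).map Prod.fst =
      Sum.inr 0 :: Sum.inl x.1 :: chainFields (opp x.1) x.2 := by
  simp [fourSegments, map_fst_chainSegments]

theorem fullLabels_four_iff (x : LabelledFour d n) :
    FullLabels (fourLabels x) ↔
      ((fourSegments x).map Prod.fst).Nodup ∧ ∀ y, y ∈ (fourSegments x).map Prod.fst := by
  refine fullLabels_iff_of_perm ?_
  rw [map_fst_fourSegments]
  have h1 := chainFields_perm (opp x.1) x.2
  let _ : BEq (Fld n 2) := instBEqOfDecidableEq
  have e : (List.finRange 2).map (Sum.inr : Fin 2 → Fld n 2) = [Sum.inr 0, Sum.inr 1] := rfl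
  rw [e]
  rw [List.perm_iff_count] at h1 ⊢
  intro a
  have h3 := h1 a
  simp only [fourLabels, List.count_cons, List.count_append, List.map_cons, List.map_append,
    List.cons_append, List.count_nil] at h3 ⊢
  omega

theorem map_target_fourSegments_perm (x : LabelledFour d n) :
    ((fourSegments x).map fun l => l.2.1).Perm ((fourSegments x).map Prod.fst) := by
  rw [map_fst_fourSegments]
  exact (List.Perm.swap _ _ _).trans ((((map_target_chainSegments_perm _ _)).cons _).cons _)

theorem map_fst_fourColors (i : Fin d) (x : LabelledFour d n) :
    (fourColors i x).map Prod.fst = (fourLabels x).map Prod.fst := by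
  simp [fourColors, fourLabels, map_fst_chainColors]

theorem mem_chainLabels_of_mem {s : List (LabelledStep d n)} {y : LabelledStep d n}
    (h : y ∈ s) : y.1 ∈ chainLabels s := by
  induction s with
  | nil => simp at h
  | cons z s ih =>
    obtain ⟨w, q0, t, t'⟩ := z
    rcases List.mem_cons.1 h with rfl | h
    · exact List.mem_cons_self
    · exact List.mem_cons_of_mem _ (List.mem_append_right _ (List.mem_append_right _ (ih h)))

theorem mem_chainColors_of_mem {i : Fin d} {s : List (LabelledStep d n)} {y : LabelledStep d n}
    (h : y ∈ s) : (y.1.1, i) ∈ chainColors i s := by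
  induction s with
  | nil => simp at h
  | cons z s ih =>
    obtain ⟨w, q0, t, t'⟩ := z
    rcases List.mem_cons.1 h with rfl | h
    · exact List.mem_cons_self
    · exact List.mem_cons_of_mem _ (List.mem_append_right _ (List.mem_append_right _ (ih h)))

theorem prod_segmentWeight_chainSegments (C : Mom d → ℝ) (h : Fin n × Bool)
    (s : List (LabelledStep d n)) :
    ((chainSegments h s).map (segmentWeight C)).prod = fourAmp C (s.map forgetStep) := by
  induction s generalizing h with
  | nil => simp [chainSegments, segmentWeight, fourAmp]
  | cons y s ih =>
    obtain ⟨w, q0, t, t'⟩ := y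
    simp only [chainSegments, List.map_append, List.prod_append, Line.prod_segmentWeight, ih]
    simp [fourAmp, forgetStep, mul_assoc]

namespace FeynmanGraph

/-- The graph `G`, with line momenta `q` and vanishing external momenta, is described by `x`. -/
def IsFour (i : Fin d) (G : FeynmanGraph d n 2) (q : Fin n × Bool → Mom d)
    (x : LabelledFour d n) : Prop :=
  G.Follows (Sum.elim q fun _ => 0) (fourSegments x) ∧ G.Colored (fourColors i x)

/-- Every 1PI melonic four-point graph whose legs share exactly the faces of colour `i` is a chain
of vertices of colour `i`. -/
theorem exists_isFour (hd : 3 ≤ d) {i : Fin d} {G : FeynmanGraph d n 2}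
    {q : Fin n × Bool → Mom d} (h1 : G.OnePI) (h2 : G.Melonic) (hi : G.SharesFace i)
    (h3 : G.Conserves (fun _ => 0) q) :
    ∃ x : LabelledFour d n, G.IsFour i q x ∧ FourValid i (forgetFour x) ∧
      FullLabels (fourLabels x) := by
  have hG := (h1.melonic_iff_treeLike_four hd hi).1 h2
  have hq : G.Transmits (Sum.elim q fun _ => 0) := fun h c => by
    rw [Sum.elim_inl]
    exact h3.2 h c
  have hext : ∀ e, (Sum.elim q fun _ => 0 : Fld n 2 → Mom d) (G.wick.symm (Sum.inr e)) =
      (Sum.elim q fun _ => 0 : Fld n 2 → Mom d) (Sum.inr e) := h3.1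
  -- The two external legs lie on different cycles of `wick`, because there is a colour `c ≠ i`.
  have hfar : ¬ TGFT.cyc G.wick (Sum.inr 0) (Sum.inr 1) := by
    intro h
    have : Nontrivial (Fin d) := Fin.nontrivial_iff_two_le.2 (by omega)
    obtain ⟨c, hc⟩ := exists_ne i
    refine hc ((hi c).1 ?_)
    rw [hG.cyc_faceStep]
    exact G.link_cyc _ h
  have hfar' : ∀ k l : Fin 2, TGFT.cyc G.wick (Sum.inr k) (Sum.inr l) → l = k := by
    intro k l h
    fin_cases k <;> fin_cases l
    · rfl
    · exact absurd h hfar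
    · exact absurd (Setoid.symm' _ h) hfar
    · rfl
  have hleg : ∀ k : Fin 2, ∃ z, G.wick (Sum.inr k) = Sum.inl z ∧
      G.wick (Sum.inl z) = Sum.inr k := by
    intro k
    rcases hw : G.wick (Sum.inr k) with z | l
    · obtain ⟨l, hl⟩ := hG.wick_root h1 hw
      have : l = k := hfar' k l (Setoid.trans' _ (hw ▸ cyc_apply G.wick (Sum.inr k))
        (hl ▸ cyc_apply G.wick (Sum.inl z)))
      exact ⟨z, rfl, this ▸ hl⟩
    · have := (h1.2.1 k).1
      rw [hw] at this
      simp at this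
  obtain ⟨z, hw, hl⟩ := hleg 0
  obtain ⟨z', hw', hl'⟩ := hleg 1
  obtain ⟨S₁, S₂, hS₁, hS₂, hdis, -, -, h01, h02, hcov⟩ :=
    (G.segment_univ 0).split hG hw (by simp)
  have hS₂' := hS₂.eq_of_wick_eq hG hl
  have h1S : Sum.inr 1 ∈ S₁ := by
    rcases hcov (Sum.inr 1) (Finset.mem_univ _) (by simp) with h | h
    · exact h
    · rw [hS₂', Finset.mem_singleton] at h
      simp at h
  -- The common face of colour `i` crosses vertices of colour `i` only.
  have hlink : G.link {v | G.color v = i} (Sum.inr 0) (Sum.inr 1) := by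
    rw [← hG.cyc_faceStep]
    exact (hi i).2 rfl
  have hcol : G.color z.1 = i := by
    by_contra hne
    refine h01 ((hS₁.mem_iff_of_link (E := {v | G.color v = i}) ?_ hlink).2 h1S)
    simpa using hne
  have hqz : q (TGFT.opp z) i = 0 := by
    have := hq.apply_color hw
    rw [hcol] at this
    exact this.symm
  obtain ⟨s, s1, s2, s3, s4, s5⟩ := hS₁.exists_chain hG hq hext rfl hl' hw' hlink h1S h01 hqz
  have hqz' : q z = 0 := by
    have := h3.1 0
    rwa [← hl, Equiv.symm_apply_apply] at this
  refine ⟨(z, s), ⟨?_, ?_⟩, ?_, ?_⟩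
  · exact Follows.cons.2 ⟨⟨hw, rfl⟩, Follows.cons.2 ⟨⟨hl, hqz'⟩, s1⟩⟩
  · exact Colored.cons.2 ⟨hcol, s2⟩
  · intro y hy
    obtain ⟨y', hy', rfl⟩ := List.mem_map.1 hy
    exact s3 y' hy'
  · rw [fullLabels_four_iff, map_fst_fourSegments]
    constructor
    · refine List.nodup_cons.2 ⟨?_, List.nodup_cons.2 ⟨?_, s4⟩⟩
      · rw [List.mem_cons, ← s5]
        rintro (e | e)
        · simp at e
        · exact h01 e
      · rw [← s5]
        exact Finset.disjoint_right.1 hdis hS₂.mem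
    · intro y
      rw [List.mem_cons, List.mem_cons, ← s5]
      by_cases hy : y = Sum.inr 0
      · exact Or.inl hy
      · rcases hcov y (Finset.mem_univ _) hy with h | h
        · exact Or.inr (Or.inr h)
        · rw [hS₂', Finset.mem_singleton] at h
          exact Or.inr (Or.inl h)

theorem mem_chainSegments_inr {h : Fin n × Bool} {s : List (LabelledStep d n)} {k : Fin 2}
    {y : Fld n 2} {p : Mom d} (hl : (Sum.inr k, y, p) ∈ chainSegments h s) : p = 0 := by
  have hline : ∀ {T : Line ((Fin n × Bool) × Deco d)} {p' : Mom d} {h' k' : Fin n × Bool},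
      (Sum.inr k, y, p) ∉ T.segments p' (Sum.inl h') (Sum.inl k' : Fld n 2) := by
    intro T p' h' k' hT
    have := List.mem_map_of_mem (f := Prod.fst) hT
    rw [Line.map_fst_segments] at this
    simp at this
  induction s generalizing h with
  | nil =>
    simp only [chainSegments, List.mem_cons, Prod.mk.injEq, List.not_mem_nil, or_false] at hl
    rcases hl with hl | hl
    · exact hl.2.2
    · exact hl.2.2
  | cons z s ih =>
    obtain ⟨w, q0, t, t'⟩ := z
    simp only [chainSegments, List.mem_append] at hl
    rcases hl with hl | hl | hl
    · exact absurd hl hline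
    · exact absurd hl hline
    · exact ih hl

theorem isFour_realizable (hd : 3 ≤ d) (i : Fin d) {x : LabelledFour d n}
    (hx : FullLabels (fourLabels x)) :
    ∃ (G : FeynmanGraph d n 2) (q : Fin n × Bool → Mom d), G.IsFour i q x := by
  obtain ⟨h1, h2⟩ := (fullLabels_four_iff x).1 hx
  refine exists_follows_colored (by omega) h1 (fun y => ?_) ?_ ?_
  · rw [(map_target_fourSegments_perm x).mem_iff]
    exact h2 y
  · rw [map_fst_fourColors]
    exact hx.1
  · intro k y p' hl
    rcases List.mem_cons.1 hl with e | hl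
    · exact congrArg (fun l => l.2.2) e
    · rcases List.mem_cons.1 hl with e | hl
      · exact congrArg (fun l => l.2.2) e
      · exact mem_chainSegments_inr hl

variable {i : Fin d} {G : FeynmanGraph d n 2} {q : Fin n × Bool → Mom d} {x : LabelledFour d n}

theorem nodup_of_fullLabels_four (hx : FullLabels (fourLabels x)) :
    Sum.inr 0 ∉ chainFields (TGFT.opp x.1) x.2 ∧ Sum.inl x.1 ∉ chainFields (TGFT.opp x.1) x.2 ∧
      (chainFields (TGFT.opp x.1) x.2).Nodup := by
  have hn := ((fullLabels_four_iff x).1 hx).1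
  rw [map_fst_fourSegments, List.nodup_cons, List.nodup_cons] at hn
  exact ⟨fun h => hn.1 (List.mem_cons_of_mem _ h), hn.2.1, hn.2.2⟩

theorem mem_chainFields_inl (h : Fin n × Bool) (s : List (LabelledStep d n)) :
    Sum.inl h ∈ chainFields h s := by
  rw [(chainFields_perm _ _).mem_iff]
  exact List.mem_cons_self

theorem mem_chainFields_inr (h : Fin n × Bool) (s : List (LabelledStep d n)) :
    Sum.inr 1 ∈ chainFields h s := by
  rw [(chainFields_perm _ _).mem_iff]
  exact List.mem_cons_of_mem _ List.mem_cons_self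

theorem IsFour.onePI (h : G.IsFour i q x) (hx : FullLabels (fourLabels x)) : G.OnePI := by
  obtain ⟨hF, -⟩ := h
  obtain ⟨-, -, hn⟩ := nodup_of_fullLabels_four hx
  rw [fourSegments, Follows.cons, Follows.cons] at hF
  obtain ⟨⟨h1, -⟩, ⟨h2, -⟩, h3⟩ := hF
  simp only at h1 h2
  refine OnePI.of_full x.1.1.pos (fun k => ?_) hx x.1.1 fun y u hu => ?_
  · rcases Fin.eq_zero_or_eq_succ k with rfl | ⟨j, rfl⟩
    · rw [h1, ← h2, Equiv.symm_apply_apply]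
      exact ⟨rfl, rfl⟩
    · obtain ⟨z, e1, -, e2⟩ := h3.chain_end
      rw [Fin.fin_one_eq_zero j, show (Fin.succ 0 : Fin 2) = 1 from rfl, e2, ← e1,
        Equiv.symm_apply_apply]
      exact ⟨rfl, rfl⟩
  · rcases List.mem_cons.1 hu with rfl | hu
    · exact Relation.EqvGen.refl _
    · exact h3.chain_connected hn y u hu

theorem IsFour.treeLike (h : G.IsFour i q x) (hx : FullLabels (fourLabels x)) :
    G.TreeLike := by
  refine TreeLike.of_full (h.onePI hx).link hx fun y hy => ?_
  obtain ⟨-, hn1, hn2⟩ := nodup_of_fullLabels_four hx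
  have hF := h.1
  rw [fourSegments, Follows.cons, Follows.cons] at hF
  rcases List.mem_cons.1 hy with rfl | hy
  · exact hF.2.2.chain_separates (by simp) (mem_chainFields_inl _ _) hn1
  · exact hF.2.2.chain_bridge hn2 hy

theorem IsFour.sharesFace (h : G.IsFour i q x) (hx : FullLabels (fourLabels x)) :
    G.SharesFace i := by
  intro c
  rw [(h.treeLike hx).cyc_faceStep]
  obtain ⟨hn0, -, -⟩ := nodup_of_fullLabels_four hx
  obtain ⟨hF, hC⟩ := h
  rw [fourSegments, Follows.cons, Follows.cons] at hF
  obtain ⟨⟨h1, -⟩, -, h3⟩ := hF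
  constructor
  · intro hlink
    by_contra hc
    refine h3.chain_separates (E := {v | G.color v = c}) ?_ (mem_chainFields_inr _ _) hn0
      (Setoid.symm' _ hlink)
    have hx1 : G.color x.1.1 = i := hC _ List.mem_cons_self
    simpa [hx1] using Ne.symm hc
  · rintro rfl
    refine Setoid.trans' _ (link_of_wick h1 _) (Setoid.trans' _ (G.link_opp ?_)
      (h3.chain_link fun y hy => ?_))
    · simpa using hC _ List.mem_cons_self
    · simpa using hC _ (List.mem_cons_of_mem _ (mem_chainColors_of_mem hy))

theorem IsFour.melonic (hd : 3 ≤ d) (h : G.IsFour i q x) (hx : FullLabels (fourLabels x)) :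
    G.Melonic :=
  ((h.onePI hx).melonic_iff_treeLike_four hd (h.sharesFace hx)).2 (h.treeLike hx)

theorem IsFour.conserves (h : G.IsFour i q x) (hx : FullLabels (fourLabels x))
    (hv : FourValid i (forgetFour x)) : G.Conserves (fun _ => 0) q := by
  obtain ⟨hF, hC⟩ := h
  rw [fourSegments, Follows.cons, Follows.cons] at hF
  rw [fourColors, Colored.cons] at hC
  obtain ⟨⟨h1, h1'⟩, ⟨h2, h2'⟩, h3⟩ := hF
  obtain ⟨⟨p', e1, e2, e3⟩, hrest⟩ := h3.chain_transmitsAt hC.2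
    fun y hy => hv _ (List.mem_map_of_mem hy)
  refine conserves_of_full (fun k => ?_) hx fun y hy => ?_
  · rcases Fin.eq_zero_or_eq_succ k with rfl | ⟨j, rfl⟩
    · exact apply_symm_of_wick h2 h2'
    · obtain ⟨z, f1, f2, -⟩ := h3.chain_end
      rw [Fin.fin_one_eq_zero j]
      exact apply_symm_of_wick f1 f2
  · rcases List.mem_cons.1 hy with rfl | hy
    · refine transmitsAt_of h2' (apply_symm_of_wick h1 h1') e2 e3 ?_
      rw [show G.color x.1.1 = i from hC.1, e1]
      rfl
    · exact hrest y hy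

/-- The chain of a graph is unique.  On the line that starts at `h`, the next vertex of the chain is
the first one whose other half is linked to the second leg; the other halves of the vertices of
dressed lines are not. -/
theorem chain_unique {G : FeynmanGraph d n 2} {q : Fld n 2 → Mom d} {h : Fin n × Bool}
    {s s' : List (LabelledStep d n)} (h1 : G.Follows q (chainSegments h s))
    (h2 : G.Follows q (chainSegments h s')) (c1 : G.Colored (chainColors i s))
    (c2 : G.Colored (chainColors i s')) (hn : (chainFields h s).Nodup)
    (hn' : (chainFields h s').Nodup) : s = s' := by
  induction s generalizing h s' with
  | nil =>
    cases s' with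
    | nil => rfl
    | cons y s' =>
      obtain ⟨w, q0, t, t'⟩ := y
      rw [chainSegments, Follows.cons] at h1
      have e1 := h1.1.1
      cases t with
      | bare =>
        have e2 := (h2 (Sum.inl h, Sum.inl w, q0) (by simp [chainSegments, Line.segments])).1
        simp [e1] at e2
      | insertion z l r =>
        have e2 := (h2 (Sum.inl h, Sum.inl z.1, q0) (by simp [chainSegments, Line.segments])).1
        simp [e1] at e2
  | cons y s ih =>
    obtain ⟨w, q0, t, u⟩ := y
    cases s' with
    | nil =>
      rw [chainSegments, Follows.cons] at h2
      have e1 := h2.1.1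
      cases t with
      | bare =>
        have e2 := (h1 (Sum.inl h, Sum.inl w, q0) (by simp [chainSegments, Line.segments])).1
        simp [e1] at e2
      | insertion z l r =>
        have e2 := (h1 (Sum.inl h, Sum.inl z.1, q0) (by simp [chainSegments, Line.segments])).1
        simp [e1] at e2
    | cons y' s' =>
      obtain ⟨w', q0', t', u'⟩ := y'
      rw [chainSegments, Follows.append, Follows.append] at h1 h2
      obtain ⟨a1, a2, a3⟩ := h1
      obtain ⟨b1, b2, b3⟩ := h2
      rw [chainColors, Colored.cons, Colored.append, Colored.append] at c1 c2
      obtain ⟨-, d1, d2, d3⟩ := c1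
      obtain ⟨-, e1, e2, e3⟩ := c2
      simp only [chainFields, List.nodup_append', List.nodup_cons] at hn hn'
      obtain ⟨⟨m1, m2⟩, ⟨⟨m3, m4⟩, m5, m6⟩, m7⟩ := hn
      obtain ⟨⟨l1, l2⟩, ⟨⟨l3, l4⟩, l5, l6⟩, l7⟩ := hn'
      -- `B` holds at the half-vertices of the chain, and at no half-vertex of a dressed line.
      let B : Fld n 2 → Prop := fun y => ∃ x : Fin n × Bool, y = Sum.inl x ∧
        G.link (Finset.univ.erase x.1) (Sum.inl (TGFT.opp x)) (Sum.inr 1)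
      have hB : ∀ {w : Fin n × Bool} {u : Line ((Fin n × Bool) × Deco d)}
          {s : List (LabelledStep d n)}, G.Follows q (chainSegments (TGFT.opp w) s) →
          (Sum.inl w :: u.halves.map Sum.inl : List (Fld n 2)).Disjoint
            (chainFields (TGFT.opp w) s) →
          B (Sum.inl w) := by
        intro w u s hs hdis
        refine ⟨w, rfl, hs.chain_link fun y hy => Finset.mem_erase.2 ⟨fun e => ?_,
          Finset.mem_univ _⟩⟩
        refine hdis List.mem_cons_self ?_
        rw [(chainFields_perm _ s).mem_iff]
        refine List.mem_cons_of_mem _ (List.mem_cons_of_mem _ (List.mem_map_of_mem ?_))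
        have hy' := mem_chainLabels_of_mem hy
        rcases eq_or_eq_opp e with e' | e'
        · exact List.mem_append_left _ (e' ▸ hy')
        · refine List.mem_append_right _ (List.mem_map.2 ⟨_, hy', ?_⟩)
          rw [e', opp_opp]
      have hB' : ∀ {T : Line ((Fin n × Bool) × Deco d)} {p : Mom d} {y y' : Fld n 2},
          G.Follows q (T.segments p y y') →
          (T.halves.map (Sum.inl : _ → Fld n 2)).Nodup →
          ∀ x ∈ T.labels, ¬ B (Sum.inl x) := by
        rintro T p y y' hT hT' x hx ⟨z, hz, hlink⟩
        obtain rfl := Sum.inl_injective hz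
        exact hT.separates (List.Nodup.of_map _ hT') hx (by simp) (by simp) hlink
      obtain rfl : q0 = q0' := a1.source.symm.trans b1.source
      obtain ⟨rfl, hww⟩ := a1.line_unique b1 d1 e1 (hB a3 m6) (hB b3 l6) (hB' a1 m2)
        (hB' b1 l2) (List.Nodup.of_map _ m2) (List.Nodup.of_map _ l2)
      obtain rfl := Sum.inl_injective hww
      have hu : ∀ {T : Line ((Fin n × Bool) × Deco d)} {F : List (Fld n 2)},
          (Sum.inl h :: t.halves.map Sum.inl : List (Fld n 2)).Disjoint
            ((Sum.inl w :: T.halves.map Sum.inl) ++ F) →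
          ∀ x ∈ T.labels, ¬ (Sum.inl x : Fld n 2) = Sum.inl h := by
        intro T F hdis x hx e
        refine hdis List.mem_cons_self (List.mem_append_left _ (List.mem_cons_of_mem _ ?_))
        rw [← e]
        exact List.mem_map_of_mem (Line.mem_halves_of_mem_labels hx)
      obtain ⟨rfl, -⟩ := a2.line_unique (B := fun y => y = Sum.inl h) b2 d2 e2 rfl rfl (hu m7)
        (hu l7) (List.Nodup.of_map _ m4) (List.Nodup.of_map _ l4)
      rw [ih a3 b3 d3 e3 m5 l5]

theorem IsFour.unique {x' : LabelledFour d n} (h : G.IsFour i q x) (h' : G.IsFour i q x')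
    (hx : FullLabels (fourLabels x)) (hx' : FullLabels (fourLabels x')) : x = x' := by
  obtain ⟨-, -, hn⟩ := nodup_of_fullLabels_four hx
  obtain ⟨-, -, hn'⟩ := nodup_of_fullLabels_four hx'
  obtain ⟨y, s⟩ := x
  obtain ⟨y', s'⟩ := x'
  obtain ⟨h1, h2⟩ := h
  obtain ⟨h1', h2'⟩ := h'
  rw [fourSegments, Follows.cons, Follows.cons] at h1 h1'
  rw [fourColors, Colored.cons] at h2 h2'
  obtain rfl : y = y' := Sum.inl_injective (β := Fin 2) (h1.1.1.symm.trans h1'.1.1)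
  exact congrArg (Prod.mk y) (chain_unique h1.2.2 h1'.2.2 h2.2 h2'.2 hn hn')

theorem IsFour.graph_unique {G' : FeynmanGraph d n 2} {q' : Fin n × Bool → Mom d}
    (h : G.IsFour i q x) (h' : G'.IsFour i q' x) (hx : FullLabels (fourLabels x)) :
    G = G' ∧ q = q' :=
  eq_of_follows_colored ((fullLabels_four_iff x).1 hx).2
    (fun v => by rw [map_fst_fourColors]; exact hx.mem_map_fst v) h.1 h'.1 h.2 h'.2

theorem IsFour.propagators_eq (C : Mom d → ℝ) (h : G.IsFour i q x)
    (hx : FullLabels (fourLabels x)) : G.propagators C q = fourAmp C (forgetFour x) := by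
  obtain ⟨h1, h2⟩ := (fullLabels_four_iff x).1 hx
  rw [FeynmanGraph.propagators_eq C h.1 h1 h2, fourSegments, List.map_cons, List.map_cons,
    List.prod_cons, List.prod_cons, prod_segmentWeight_chainSegments]
  simp [segmentWeight, forgetFour]

end FeynmanGraph

end

/-! ### Counting labels -/

section

variable {d n N : ℕ}

theorem finite_fullLabels (n : ℕ) : Finite {L : List (Fin n × Bool) // FullLabels L} :=
  (List.finite_length_eq (Fin n × Bool) n).subset fun _ h => h.2

/-- The `n` vertices can be labelled in `n! 2ⁿ` ways: the factor `2` is the exchange of the two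
halves of a vertex. -/
theorem card_fullLabels (n : ℕ) :
    Nat.card {L : List (Fin n × Bool) // FullLabels L} = n ! * 2 ^ n := by
  let f : Equiv.Perm (Fin n) × (Fin n → Bool) → {L : List (Fin n × Bool) // FullLabels L} :=
    fun x => ⟨List.ofFn fun k => (x.1 k, x.2 k), by
      refine ⟨?_, List.length_ofFn⟩
      rw [List.map_ofFn, List.nodup_ofFn]
      exact x.1.injective⟩
  have hf : Function.Bijective f := by
    constructor
    · rintro ⟨a, b⟩ ⟨a', b'⟩ h
      have h1 := List.ofFn_injective (congrArg Subtype.val h)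
      have h2 : ∀ k, a k = a' k ∧ b k = b' k := fun k => Prod.mk.inj (congrFun h1 k)
      exact Prod.ext (Equiv.ext fun k => (h2 k).1) (funext fun k => (h2 k).2)
    · rintro ⟨L, hL⟩
      let g : Fin n → Fin n × Bool := fun k => L[(k : ℕ)]'(by rw [hL.2]; exact k.2)
      have hg : List.ofFn g = L := by
        refine List.ext_getElem (by rw [List.length_ofFn, hL.2]) fun k h1 h2 => ?_
        rw [List.getElem_ofFn]
      have hinj : Function.Injective fun k => (g k).1 := by
        rw [← List.nodup_ofFn]
        have := hL.1
        rw [← hg, List.map_ofFn] at this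
        exact this
      refine ⟨(Equiv.ofBijective _ (Finite.injective_iff_bijective.1 hinj), fun k => (g k).2), ?_⟩
      exact Subtype.ext hg
  rw [← Nat.card_congr (Equiv.ofBijective f hf), Nat.card_eq_fintype_card, Fintype.card_prod,
    Fintype.card_perm, Fintype.card_fun, Fintype.card_fin, Fintype.card_bool]

/-- The sum over labelled graphs is a sum over unlabelled structures `u`, if a graph determines a
labelled structure and conversely, and if a labelled structure is an unlabelled one together with a
list of labels. -/
theorem hasSum_unlabelled {U : Type} {X : ℕ → Type} {size : U → ℕ} {forget : ∀ {n}, X n → U}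
    {labels : ∀ {n}, X n → List (Fin n × Bool)}
    (hsize : ∀ {n} (x : X n), (labels x).length = size (forget x))
    (hinj : ∀ {n} (x x' : X n), forget x = forget x' → labels x = labels x' → x = x')
    (hsurj : ∀ {n} (u : U) (L : List (Fin n × Bool)), L.length = size u →
      ∃ x : X n, forget x = u ∧ labels x = L)
    {S : ∀ n, Set (FeynmanGraph d n N × (Fin n × Bool → Mom d))}
    {R : ∀ {n}, FeynmanGraph d n N × (Fin n × Bool → Mom d) → X n → Prop} {V : U → Prop}
    {term : LabelledGraph d N → ℝ} {val : U → ℝ} {lam : ℝ}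
    (hzero : ∀ n y, y ∉ S n → term ⟨n, y⟩ = 0)
    (hex : ∀ n, ∀ y ∈ S n, ∃ x, R y x ∧ V (forget x) ∧ FullLabels (labels x))
    (hreal : ∀ n (x : X n), FullLabels (labels x) → V (forget x) → ∃ y ∈ S n, R y x)
    (huniq : ∀ n y (x x' : X n), R y x → R y x' → FullLabels (labels x) →
      FullLabels (labels x') → x = x')
    (hgraph : ∀ n y y' (x : X n), R y x → R y' x → FullLabels (labels x) → y = y')
    (hval : ∀ n, ∀ y ∈ S n, ∀ x : X n, R y x → FullLabels (labels x) →
      term ⟨n, y⟩ = (-lam) ^ n / n ! * val (forget x))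
    (hsum : Summable term) :
    HasSum (Set.indicator {u | V u} fun u => (-2 * lam) ^ size u * val u) (∑' x, term x) := by
  classical
  let Λ : U → Type := fun u => {L : List (Fin (size u) × Bool) // FullLabels L}
  have hx : ∀ (u : U) (L : Λ u), ∃ x : X (size u), forget x = u ∧ labels x = L.1 := fun u L =>
    hsurj u L.1 L.2.2
  choose x hx1 hx2 using hx
  have hy : ∀ (u : {u // V u}) (L : Λ u.1), ∃ y ∈ S (size u.1), R y (x u.1 L) := fun u L =>
    hreal _ _ (by rw [hx2]; exact L.2) (by rw [hx1]; exact u.2)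
  choose y hyS hyR using hy
  let T : (Σ u : {u // V u}, Λ u.1) → LabelledGraph d N := fun z => ⟨size z.1.1, y z.1 z.2⟩
  have hT : Function.Injective T := by
    rintro ⟨⟨u, hu⟩, L⟩ ⟨⟨u', hu'⟩, L'⟩ h
    -- Two structures of the same graph have the same order, so they can be compared.
    have key : ∀ (n n' : ℕ) (y : FeynmanGraph d n N × (Fin n × Bool → Mom d))
        (y' : FeynmanGraph d n' N × (Fin n' × Bool → Mom d)) (a : X n) (a' : X n'),
        (⟨n, y⟩ : LabelledGraph d N) = ⟨n', y'⟩ → R y a → R y' a' → FullLabels (labels a) →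
        FullLabels (labels a') → HEq a a' ∧ forget a = forget a' := by
      rintro n n' y y' a a' h h1 h2 h3 h4
      obtain ⟨rfl, h⟩ := Sigma.mk.inj h
      obtain rfl := eq_of_heq h
      obtain rfl := huniq n y a a' h1 h2 h3 h4
      exact ⟨HEq.rfl, rfl⟩
    obtain ⟨k1, k2⟩ := key _ _ _ _ _ _ h (hyR ⟨u, hu⟩ L) (hyR ⟨u', hu'⟩ L')
      (by rw [hx2]; exact L.2) (by rw [hx2]; exact L'.2)
    rw [hx1, hx1] at k2
    obtain rfl : u = u' := k2
    have k3 := congrArg labels (eq_of_heq k1)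
    rw [hx2, hx2] at k3
    obtain rfl : L = L' := Subtype.ext k3
    rfl
  have hrange : ∀ z, z ∉ Set.range T → term z = 0 := by
    rintro ⟨n, w⟩ hz
    refine hzero n w fun hw => hz ?_
    obtain ⟨a, h1, h2, h3⟩ := hex n w hw
    obtain ⟨u, hu⟩ : ∃ u, forget a = u := ⟨_, rfl⟩
    have hn : n = size u := by rw [← hu, ← hsize, h3.2]
    subst hn
    rw [hu] at h2
    refine ⟨⟨⟨u, h2⟩, ⟨labels a, h3⟩⟩, ?_⟩
    have ha : x u ⟨labels a, h3⟩ = a := hinj _ _ (by rw [hx1, hu]) (by rw [hx2])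
    have h4 := hyR ⟨u, h2⟩ ⟨labels a, h3⟩
    rw [ha] at h4
    exact congrArg (Sigma.mk (size u)) (hgraph _ _ _ _ h4 h1 h3)
  have h1 : HasSum (term ∘ T) (∑' z, term z) := (hT.hasSum_iff hrange).2 hsum.hasSum
  have h2 : HasSum (fun u : {u // V u} => (-2 * lam) ^ size u.1 * val u.1) (∑' z, term z) := by
    refine h1.sigma fun u => ?_
    have : Finite (Λ u.1) := finite_fullLabels _
    have := Fintype.ofFinite (Λ u.1)
    have h3 : ∀ L : Λ u.1, (term ∘ T) ⟨u, L⟩ = (-lam) ^ size u.1 / (size u.1)! * val u.1 := by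
      intro L
      have h4 := hval _ _ (hyS u L) _ (hyR u L) (by rw [hx2]; exact L.2)
      rw [hx1] at h4
      exact h4
    have h5 := hasSum_fintype fun L : Λ u.1 => (term ∘ T) ⟨u, L⟩
    rw [Finset.sum_congr rfl fun L _ => h3 L, Finset.sum_const, Finset.card_univ,
      ← Nat.card_eq_fintype_card, card_fullLabels, nsmul_eq_mul] at h5
    convert h5 using 1
    have h6 : ((size u.1)! : ℝ) ≠ 0 := by exact_mod_cast Nat.factorial_ne_zero _
    have h7 : (-2 * lam) ^ size u.1 = 2 ^ size u.1 * (-lam) ^ size u.1 := by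
      rw [← mul_pow]
      congr 1
      ring
    rw [h7]
    push_cast
    field_simp
  rwa [← hasSum_subtype_iff_indicator]

namespace Line

theorem length_labels {α β : Type} (T : Line (β × α)) : T.labels.length = T.forget.size := by
  induction T with
  | bare => rfl
  | insertion x l r hl hr => simp [labels, forget, size, hl, hr]

theorem eq_of_forget_of_labels {α β : Type} {T T' : Line (β × α)} (h : T.forget = T'.forget)
    (h' : T.labels = T'.labels) : T = T' := by
  induction T generalizing T' with
  | bare =>
    cases T' with
    | bare => rfl
    | insertion x l r => simp [forget] at h
  | insertion x l r hl hr =>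
    cases T' with
    | bare => simp [forget] at h
    | insertion x' l' r' =>
      simp only [forget, insertion.injEq, labels, List.cons.injEq] at h h'
      obtain ⟨h1, h2, h3⟩ := h
      obtain ⟨h4, h5⟩ := h'
      obtain ⟨h6, h7⟩ := List.append_inj h5 (by rw [length_labels, length_labels, h2])
      rw [hl h2 h6, hr h3 h7, Prod.ext h4 h1]

theorem exists_labelled {α β : Type} (t : Line α) (L : List β) (h : L.length = t.size) :
    ∃ T : Line (β × α), T.forget = t ∧ T.labels = L := by
  induction t generalizing L with
  | bare => exact ⟨bare, rfl, (List.length_eq_zero_iff.1 h).symm⟩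
  | insertion x l r hl hr =>
    cases L with
    | nil => simp [size] at h
    | cons b L =>
      simp only [size, List.length_cons] at h
      obtain ⟨l', h1, h2⟩ := hl (L.take l.size) (by rw [List.length_take]; omega)
      obtain ⟨r', h3, h4⟩ := hr (L.drop l.size) (by rw [List.length_drop]; omega)
      exact ⟨insertion (b, x) l' r', by simp [forget, h1, h3],
        by simp [labels, h2, h4, List.take_append_drop]⟩

end Line

/-- Number of vertices of a step of a chain. -/
def stepSize (y : Mom d × Line (Deco d) × Line (Deco d)) : ℕ := y.2.1.size + y.2.2.size + 1

theorem length_chainLabels (s : List (LabelledStep d n)) :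
    (chainLabels s).length = ((s.map forgetStep).map stepSize).sum := by
  induction s with
  | nil => rfl
  | cons y s ih =>
    obtain ⟨w, q, t, t'⟩ := y
    simp only [chainLabels, List.length_cons, List.length_append, ih, Line.length_labels,
      List.map_cons, List.sum_cons, stepSize, forgetStep]
    omega

theorem chain_eq_of_forget_of_labels {s s' : List (LabelledStep d n)}
    (h : s.map forgetStep = s'.map forgetStep) (h' : chainLabels s = chainLabels s') :
    s = s' := by
  induction s generalizing s' with
  | nil =>
    cases s' with
    | nil => rfl
    | cons y s' => simp at h
  | cons y s ih =>
    cases s' with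
    | nil => simp at h
    | cons y' s' =>
      obtain ⟨w, q, t, u⟩ := y
      obtain ⟨w', q', t', u'⟩ := y'
      simp only [List.map_cons, List.cons.injEq, forgetStep, Prod.mk.injEq, chainLabels] at h h'
      obtain ⟨⟨rfl, h2, h3⟩, h4⟩ := h
      obtain ⟨rfl, h5⟩ := h'
      obtain ⟨h6, h7⟩ := List.append_inj h5 (by rw [Line.length_labels, Line.length_labels, h2])
      obtain ⟨h8, h9⟩ := List.append_inj h7 (by rw [Line.length_labels, Line.length_labels, h3])
      rw [Line.eq_of_forget_of_labels h2 h6, Line.eq_of_forget_of_labels h3 h8, ih h4 h9]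

theorem exists_labelled_chain (u : List (Mom d × Line (Deco d) × Line (Deco d)))
    (L : List (Fin n × Bool)) (h : L.length = (u.map stepSize).sum) :
    ∃ s : List (LabelledStep d n), s.map forgetStep = u ∧ chainLabels s = L := by
  induction u generalizing L with
  | nil => exact ⟨[], rfl, (List.length_eq_zero_iff.1 h).symm⟩
  | cons y u ih =>
    obtain ⟨q, t, t'⟩ := y
    cases L with
    | nil =>
      simp only [List.map_cons, List.sum_cons, stepSize, List.length_nil] at h
      omega
    | cons b L =>
      simp only [List.map_cons, List.sum_cons, stepSize, List.length_cons] at h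
      obtain ⟨T, h1, h2⟩ := t.exists_labelled (L.take t.size) (by rw [List.length_take]; omega)
      obtain ⟨T', h3, h4⟩ := t'.exists_labelled ((L.drop t.size).take t'.size)
        (by rw [List.length_take, List.length_drop]; omega)
      obtain ⟨s, h5, h6⟩ := ih ((L.drop t.size).drop t'.size)
        (by rw [List.length_drop, List.length_drop]; omega)
      exact ⟨(b, q, T, T') :: s, by simp [forgetStep, h1, h3, h5],
        by simp only [chainLabels, h2, h4, h6, List.take_append_drop]⟩

/-! ### The self-energy and the four-point function as sums over trees -/

open Classical in
/-- Weight of a dressed line of momentum `p`; every insertion contributes a factor `-2 lam`. -/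
def lineWeight (C : Mom d → ℝ) (lam : ℝ) (p : Mom d) (t : Line (Deco d)) : ℝ :=
  if t.Valid p then (-2 * lam) ^ t.size * t.amp C p else 0

/-- The melonic self-energy is the sum over the vertices with a dressed line as loop. -/
theorem hasSum_selfEnergy (hd : 3 ≤ d) {C : Mom d → ℝ} {lam : ℝ} {p : Mom d}
    (h : Summable (selfEnergyTerm C lam p)) :
    HasSum (fun u : Deco d × Line (Deco d) =>
      (if u.1.2 u.1.1 = p u.1.1 then -2 * lam else 0) * lineWeight C lam u.1.2 u.2)
      (selfEnergy C lam p) := by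
  classical
  have key := hasSum_unlabelled (d := d) (N := 1) (U := Deco d × Line (Deco d))
    (X := fun n => LabelledTwo d n) (size := fun u => u.2.size + 1) (forget := forgetTwo)
    (labels := twoLabels)
    (S := fun n => {y | y.1.OnePI ∧ y.1.Melonic ∧ y.1.Conserves (fun _ => p) y.2})
    (R := fun y x => y.1.IsTwo p y.2 x) (V := TwoValid p) (term := selfEnergyTerm C lam p)
    (val := fun u => u.2.amp C u.1.2) (lam := lam)
    (fun x => by simp [twoLabels, forgetTwo, Line.length_labels])
    (fun x x' h1 h2 => by
      simp only [forgetTwo, Prod.mk.injEq, twoLabels, List.cons.injEq] at h1 h2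
      exact Prod.ext (Prod.ext h2.1 h1.1) (Line.eq_of_forget_of_labels h1.2 h2.2))
    (fun u L hL => by
      cases L with
      | nil => simp at hL
      | cons b L =>
        obtain ⟨T, h1, h2⟩ := u.2.exists_labelled L (by simpa using hL)
        exact ⟨((b, u.1), T), by simp [forgetTwo, h1], by simp [twoLabels, h2]⟩)
    (fun n y hy => if_neg hy)
    (fun n y hy => FeynmanGraph.exists_isTwo hd hy.1 hy.2.1 hy.2.2)
    (fun n x hx hv => by
      obtain ⟨G, q, hG⟩ := FeynmanGraph.isTwo_realizable hd p hx
      exact ⟨(G, q), ⟨hG.onePI hx, hG.melonic hd hx, hG.conserves hx hv⟩, hG⟩)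
    (fun n y x x' h1 h2 h3 h4 => h1.unique h2 h3 h4)
    (fun n y y' x h1 h2 h3 => Prod.ext (h1.graph_unique h2 h3).1 (h1.graph_unique h2 h3).2)
    (fun n y hy x h1 h2 => by
      refine (if_pos hy).trans ?_
      rw [h1.propagators_eq C h2]) h
  refine key.congr_fun ?_
  intro u
  by_cases h1 : u.1.2 u.1.1 = p u.1.1
  · by_cases h2 : u.2.Valid u.1.2
    · rw [Set.indicator_of_mem (show u ∈ {u | TwoValid p u} from ⟨h1, h2⟩), if_pos h1, lineWeight,
        if_pos h2, pow_succ]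
      ring
    · rw [Set.indicator_of_notMem (show u ∉ {u | TwoValid p u} from fun h3 => h2 h3.2), lineWeight,
        if_neg h2, mul_zero]
  · rw [Set.indicator_of_notMem (show u ∉ {u | TwoValid p u} from fun h3 => h1 h3.1), if_neg h1,
      zero_mul]

open Classical in
/-- Weight of a step of a chain of colour `i`. -/
def stepWeight (C : Mom d → ℝ) (lam : ℝ) (i : Fin d)
    (y : Mom d × Line (Deco d) × Line (Deco d)) : ℝ :=
  if y.1 i = 0 then -2 * lam * (lineWeight C lam y.1 y.2.1 * lineWeight C lam y.1 y.2.2) else 0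

theorem prod_stepWeight (C : Mom d → ℝ) (lam : ℝ) (i : Fin d)
    (u : List (Mom d × Line (Deco d) × Line (Deco d))) :
    (u.map (stepWeight C lam i)).prod =
      Set.indicator {u | FourValid i u}
        (fun u => (-2 * lam) ^ (u.map stepSize).sum * fourAmp C u) u := by
  classical
  have hstep : ∀ y : Mom d × Line (Deco d) × Line (Deco d), stepWeight C lam i y =
      if StepValid i y then (-2 * lam) ^ stepSize y * (y.2.1.amp C y.1 * y.2.2.amp C y.1)
        else 0 := by
    intro y
    unfold stepWeight StepValid lineWeight stepSize
    by_cases h1 : y.1 i = 0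
    · by_cases h2 : y.2.1.Valid y.1
      · by_cases h3 : y.2.2.Valid y.1
        · simp only [h1, h2, h3, if_true, and_self]
          ring
        · simp [h3]
      · simp [h2]
    · simp [h1]
  by_cases hu : FourValid i u
  · rw [Set.indicator_of_mem (show u ∈ {u | FourValid i u} from hu)]
    induction u with
    | nil => simp [fourAmp]
    | cons y u ih =>
      have h1 : FourValid i u := fun z hz => hu z (List.mem_cons_of_mem _ hz)
      rw [List.map_cons, List.prod_cons, ih h1, hstep, if_pos (hu y List.mem_cons_self)]
      simp only [fourAmp, List.map_cons, List.sum_cons, List.prod_cons, pow_add]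
      ring
  · rw [Set.indicator_of_notMem (show u ∉ {u | FourValid i u} from hu)]
    unfold FourValid at hu
    push Not at hu
    obtain ⟨y, hy, hyv⟩ := hu
    refine List.prod_eq_zero (List.mem_map.2 ⟨y, hy, ?_⟩)
    rw [hstep, if_neg hyv]

/-- The melonic four-point function is twice the sum over chains. -/
theorem hasSum_vertex (hd : 3 ≤ d) {C : Mom d → ℝ} {lam : ℝ} {i : Fin d}
    (h : Summable (vertexTerm C lam i)) :
    HasSum (fun u : Bool × List (Mom d × Line (Deco d) × Line (Deco d)) =>
      -2 * lam * (u.2.map (stepWeight C lam i)).prod) (∑' x, vertexTerm C lam i x) := by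
  classical
  -- The boolean tells which of the two pairings of the external fields has to be twisted away.
  let tw : ∀ {n : ℕ}, Bool → FeynmanGraph d n 2 → FeynmanGraph d n 2 := fun b G =>
    if b then G.twist else G
  have htw : ∀ {n : ℕ} (b : Bool) (G : FeynmanGraph d n 2), tw b (tw b G) = G := by
    intro n b G
    cases b
    · rfl
    · exact G.twist_twist
  have h1PI : ∀ {n : ℕ} (b : Bool) {G : FeynmanGraph d n 2}, G.OnePI → (tw b G).OnePI := by
    intro n b G hG
    cases b
    · exact hG
    · exact FeynmanGraph.twist_onePI hG
  have hmel : ∀ {n : ℕ} (b : Bool) {G : FeynmanGraph d n 2}, G.Melonic → (tw b G).Melonic := by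
    intro n b G hG
    cases b
    · exact hG
    · exact FeynmanGraph.twist_melonic hG
  have hcons : ∀ {n : ℕ} (b : Bool) {G : FeynmanGraph d n 2} {q : Fin n × Bool → Mom d},
      G.Conserves (fun _ => 0) q → (tw b G).Conserves (fun _ => 0) q := by
    intro n b G q hG
    cases b
    · exact hG
    · exact FeynmanGraph.twist_conserves hG
  have hprop : ∀ {n : ℕ} (b : Bool) (G : FeynmanGraph d n 2) (q : Fin n × Bool → Mom d),
      (tw b G).propagators C q = G.propagators C q := by
    intro n b G q
    cases b
    · rfl
    · exact G.twist_propagators C q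
  have key := hasSum_unlabelled (d := d) (N := 2)
    (U := Bool × List (Mom d × Line (Deco d) × Line (Deco d)))
    (X := fun n => Bool × LabelledFour d n) (size := fun u => (u.2.map stepSize).sum + 1)
    (forget := fun x => (x.1, forgetFour x.2)) (labels := fun x => fourLabels x.2)
    (S := fun n => {y | y.1.OnePI ∧ y.1.Melonic ∧ y.1.BoundaryMelon i ∧
      y.1.Conserves (fun _ => 0) y.2})
    (R := fun y x => (tw x.1 y.1).IsFour i y.2 x.2) (V := fun u => FourValid i u.2)
    (term := vertexTerm C lam i) (val := fun u => fourAmp C u.2) (lam := lam)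
    (fun x => by simp [fourLabels, forgetFour, length_chainLabels])
    (fun x x' h1 h2 => by
      simp only [forgetFour, Prod.mk.injEq, fourLabels, List.cons.injEq] at h1 h2
      exact Prod.ext h1.1 (Prod.ext h2.1 (chain_eq_of_forget_of_labels h1.2 h2.2)))
    (fun u L hL => by
      cases L with
      | nil => simp at hL
      | cons b L =>
        obtain ⟨s, h1, h2⟩ := exists_labelled_chain u.2 L (by simpa using hL)
        exact ⟨(u.1, (b, s)), by simp [forgetFour, h1], by simp [fourLabels, h2]⟩)
    (fun n y hy => if_neg hy)
    (fun n y hy => by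
      obtain ⟨h1, h2, h3, h4⟩ := hy
      obtain ⟨b, hb⟩ : ∃ b, (tw b y.1).SharesFace i := by
        rcases FeynmanGraph.boundaryMelon_iff.1 h3 with h5 | h5
        · exact ⟨false, h5⟩
        · exact ⟨true, h5⟩
      obtain ⟨x, hx⟩ := FeynmanGraph.exists_isFour hd (h1PI b h1) (hmel b h2) hb (hcons b h4)
      exact ⟨(b, x), hx⟩)
    (fun n x hx hv => by
      obtain ⟨G, q, hG⟩ := FeynmanGraph.isFour_realizable hd i hx
      refine ⟨(tw x.1 G, q), ⟨h1PI _ (hG.onePI hx), hmel _ (hG.melonic hd hx), ?_,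
        hcons _ (hG.conserves hx hv)⟩, ?_⟩
      · rw [FeynmanGraph.boundaryMelon_iff]
        have h5 := hG.sharesFace hx
        rcases x with ⟨b, x⟩
        cases b
        · exact Or.inl h5
        · right
          change G.twist.twist.SharesFace i
          rwa [FeynmanGraph.twist_twist]
      · change (tw x.1 (tw x.1 G)).IsFour i q x.2
        rwa [htw])
    (fun n y x x' h1 h2 h3 h4 => by
      obtain ⟨b, x⟩ := x
      obtain ⟨b', x'⟩ := x'
      have h5 := h1.sharesFace h3
      have h6 := h2.sharesFace h4
      obtain rfl : b = b' := by
        cases b <;> cases b'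
        · rfl
        · exact absurd h6 (FeynmanGraph.SharesFace.not_twist hd h5)
        · exact absurd h5 (FeynmanGraph.SharesFace.not_twist hd h6)
        · rfl
      exact Prod.ext rfl (h1.unique h2 h3 h4))
    (fun n y y' x h1 h2 h3 => by
      obtain ⟨h4, h5⟩ := h1.graph_unique h2 h3
      refine Prod.ext ?_ h5
      rw [← htw x.1 y.1, h4, htw])
    (fun n y hy x h1 h2 => by
      refine (if_pos hy).trans ?_
      rw [← hprop x.1, h1.propagators_eq C h2]) h
  refine key.congr_fun ?_
  intro u
  rw [prod_stepWeight]
  by_cases h1 : FourValid i u.2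
  · rw [Set.indicator_of_mem (show u ∈ {u : Bool × _ | FourValid i u.2} from h1),
      Set.indicator_of_mem (show u.2 ∈ {u | FourValid i u} from h1), pow_succ]
    ring
  · rw [Set.indicator_of_notMem (show u ∉ {u : Bool × _ | FourValid i u.2} from h1),
      Set.indicator_of_notMem (show u.2 ∉ {u | FourValid i u} from h1), mul_zero]

end

/-! ### The Dyson equation and the geometric series -/

section

variable {d : ℕ}

theorem lineWeight_bare (C : Mom d → ℝ) (lam : ℝ) (p : Mom d) :
    lineWeight C lam p .bare = C p := by
  simp [lineWeight, Line.Valid, Line.size, Line.amp]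

open Classical in
theorem lineWeight_insertion (C : Mom d → ℝ) (lam : ℝ) (p : Mom d) (x : Deco d)
    (l r : Line (Deco d)) :
    lineWeight C lam p (.insertion x l r) =
      C p * (((if x.2 x.1 = p x.1 then -2 * lam else 0) * lineWeight C lam x.2 l) *
        lineWeight C lam p r) := by
  unfold lineWeight
  by_cases h1 : x.2 x.1 = p x.1 <;> by_cases h2 : l.Valid x.2 <;> by_cases h3 : r.Valid p <;>
    simp [Line.Valid, Line.size, Line.amp, h1, h2, h3]
  ring

/-- A dressed line is bare, or starts with an insertion. -/
def Line.equivSum (α : Type) : Unit ⊕ ((α × Line α) × Line α) ≃ Line α where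
  toFun
    | .inl _ => .bare
    | .inr z => .insertion z.1.1 z.1.2 z.2
  invFun
    | .bare => .inl ()
    | .insertion x l r => .inr ((x, l), r)
  left_inv := by rintro (_ | _) <;> rfl
  right_inv := by rintro (_ | _) <;> rfl

theorem summable_lineWeight (hd : 3 ≤ d) {C : Mom d → ℝ} {lam : ℝ} {p : Mom d}
    (h : Summable (selfEnergyTerm C lam p)) : Summable (lineWeight C lam p) := by
  classical
  rcases eq_or_ne lam 0 with rfl | hlam
  · refine summable_of_ne_finset_zero (s := {Line.bare}) fun t ht => ?_
    cases t with
    | bare => simp at ht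
    | insertion x l r => simp [lineWeight_insertion]
  · -- The self-energy contains the tadpoles whose loop is a dressed line of momentum `p` itself.
    have h1 := (hasSum_selfEnergy hd h).summable.comp_injective
      (Prod.mk_right_injective ((⟨0, by omega⟩, p) : Deco d))
    refine (summable_mul_left_iff (a := -2 * lam) (by simpa using hlam)).1 (h1.congr fun t => ?_)
    simp

/-- The sum over dressed lines solves the Dyson equation `G = C + C Σ G`. -/
theorem tsum_lineWeight_eq (hd : 3 ≤ d) {C : Mom d → ℝ} {lam : ℝ} {p : Mom d}
    (h : Summable (selfEnergyTerm C lam p)) :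
    ∑' t, lineWeight C lam p t =
      C p + C p * (selfEnergy C lam p * ∑' t, lineWeight C lam p t) := by
  classical
  have h1 := (summable_lineWeight hd h).hasSum
  have h2 := hasSum_selfEnergy hd h
  have h3 := (h2.mul h1
    (summable_mul_of_summable_norm h2.summable.norm h1.summable.norm)).mul_left (C p)
  have h4 : HasSum (fun _ : Unit => C p) (C p) := hasSum_unique _
  refine ((Line.equivSum (Deco d)).hasSum_iff.1 (HasSum.sum ?_ ?_)).tsum_eq
  · exact h4.congr_fun fun _ => lineWeight_bare C lam p
  · exact h3.congr_fun fun z => lineWeight_insertion C lam p z.1.1 z.1.2 z.2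

theorem one_sub_mul_selfEnergy_ne_zero (hd : 3 ≤ d) {C : Mom d → ℝ} {lam : ℝ} {p : Mom d}
    (h : Summable (selfEnergyTerm C lam p)) : 1 - C p * selfEnergy C lam p ≠ 0 := by
  intro h0
  have h1 := tsum_lineWeight_eq hd h
  set g := ∑' t, lineWeight C lam p t
  have h2 : C p = 0 := by linear_combination g * h0 - h1
  simp [h2] at h0

theorem tsum_lineWeight (hd : 3 ≤ d) {C : Mom d → ℝ} {lam : ℝ} {p : Mom d}
    (h : Summable (selfEnergyTerm C lam p)) :
    ∑' t, lineWeight C lam p t = effPropagator C lam p := by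
  rw [effPropagator, eq_div_iff (one_sub_mul_selfEnergy_ne_zero hd h)]
  linear_combination tsum_lineWeight_eq hd h

/-- A list is empty, or has a first element. -/
def listEquivSum (α : Type) : Unit ⊕ (α × List α) ≃ List α where
  toFun
    | .inl _ => []
    | .inr z => z.1 :: z.2
  invFun
    | [] => .inl ()
    | y :: u => .inr (y, u)
  left_inv := by rintro (_ | _) <;> rfl
  right_inv := by rintro (_ | _) <;> rfl

/-- The sum over lists of the products of the weights is a geometric series. -/
theorem tsum_list_prod_eq {α : Type} {w : α → ℝ} {a : ℝ} (hw : HasSum w a)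
    (h : Summable fun u : List α => (u.map w).prod) :
    ∑' u : List α, (u.map w).prod = 1 + a * ∑' u : List α, (u.map w).prod := by
  have h1 := hw.mul h.hasSum (summable_mul_of_summable_norm (f := w)
    (g := fun u : List α => (u.map w).prod) hw.summable.norm h.norm)
  have h2 : HasSum (fun _ : Unit => (1 : ℝ)) 1 := hasSum_unique _
  refine ((listEquivSum α).hasSum_iff.1 (HasSum.sum ?_ ?_)).tsum_eq
  · exact h2.congr_fun fun _ => rfl
  · exact h1.congr_fun fun z => List.prod_cons

theorem selfEnergy_zero (C : Mom d → ℝ) (p : Mom d) : selfEnergy C 0 p = 0 := by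
  classical
  have h : ∀ x, selfEnergyTerm C 0 p x = 0 := by
    intro x
    unfold selfEnergyTerm
    split_ifs with h
    · rw [neg_zero, zero_pow h.1.1.ne', zero_div, zero_mul]
    · rfl
  rw [selfEnergy, tsum_congr h, tsum_zero]

theorem effPropagator_zero (C : Mom d → ℝ) (p : Mom d) : effPropagator C 0 p = C p := by
  rw [effPropagator, selfEnergy_zero, mul_zero, sub_zero, div_one]

section Perturbative

variable {C : Mom d → ℝ} {lam : ℝ} {i : Fin d}

theorem summable_prod_stepWeight (hd : 3 ≤ d) (hlam : lam ≠ 0)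
    (h4 : Summable (vertexTerm C lam i)) :
    Summable fun u : List (Mom d × Line (Deco d) × Line (Deco d)) =>
      (u.map (stepWeight C lam i)).prod :=
  (summable_mul_left_iff (a := -2 * lam) (by simpa using hlam)).1
    ((hasSum_vertex hd h4).summable.prod_factor false)

theorem hasSum_stepWeight_fiber (hd : 3 ≤ d) (h2 : ∀ p, Summable (selfEnergyTerm C lam p))
    (q : Mom d) :
    HasSum (fun z : Line (Deco d) × Line (Deco d) => stepWeight C lam i (q, z))
      ({q : Mom d | q i = 0}.indicator (fun q => -2 * lam * effPropagator C lam q ^ 2) q) := by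
  classical
  by_cases hq : q i = 0
  · have h := (summable_lineWeight hd (h2 q)).hasSum
    rw [tsum_lineWeight hd (h2 q)] at h
    rw [Set.indicator_of_mem (show q ∈ {q : Mom d | q i = 0} from hq), sq]
    refine ((h.mul h (summable_mul_of_summable_norm h.summable.norm h.summable.norm)).mul_left
      (-2 * lam)).congr_fun fun z => ?_
    exact if_pos hq
  · rw [Set.indicator_of_notMem (show q ∉ {q : Mom d | q i = 0} from hq)]
    exact hasSum_zero.congr_fun fun z => if_neg hq

/-- The sum over the steps of a chain is the effective loop. -/
theorem hasSum_stepWeight (hd : 3 ≤ d) (hC : Summable C)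
    (h2 : ∀ p, Summable (selfEnergyTerm C lam p)) (h4 : Summable (vertexTerm C lam i)) :
    (Summable fun p : {p : Mom d // p i = 0} => effPropagator C lam p.1 ^ 2) ∧
      HasSum (stepWeight C lam i) (-2 * lam * effLoop C lam i) := by
  rcases eq_or_ne lam 0 with rfl | hlam
  · constructor
    · simp only [effPropagator_zero, sq]
      exact (summable_mul_of_summable_norm hC.norm hC.norm).comp_injective
        (i := fun p : {p : Mom d // p i = 0} => (p.1, p.1))
        fun p p' h => Subtype.ext (Prod.mk.inj h).1
    · rw [mul_zero, zero_mul]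
      refine hasSum_zero.congr_fun fun y => ?_
      simp [stepWeight]
  · -- Chains with one step give the summability over steps.
    have h := ((summable_prod_stepWeight hd hlam h4).comp_injective
      List.singleton_injective).congr fun y => List.prod_singleton
    have h5 := h.hasSum.prod_fiberwise (hasSum_stepWeight_fiber hd h2)
    rw [← hasSum_subtype_iff_indicator] at h5
    have h6 : Summable fun p : {p : Mom d // p i = 0} => effPropagator C lam p.1 ^ 2 :=
      (summable_mul_left_iff (a := -2 * lam) (by simpa using hlam)).1 h5.summable
    refine ⟨h6, ?_⟩
    have h7 := h5.unique (h6.hasSum.mul_left (-2 * lam))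
    rw [effLoop, ← h7]
    exact h.hasSum

/-- The four-point function is a geometric series in the effective loop. -/
theorem effCoupling_eq (hd : 3 ≤ d) (hC : Summable C)
    (h2 : ∀ p, Summable (selfEnergyTerm C lam p)) (h4 : Summable (vertexTerm C lam i)) :
    1 + 2 * lam * effLoop C lam i ≠ 0 ∧
      effCoupling C lam i = lam / (1 + 2 * lam * effLoop C lam i) := by
  have h5 := hasSum_vertex hd h4
  rcases eq_or_ne lam 0 with rfl | hlam
  · refine ⟨by simp, ?_⟩
    have h6 := h5.unique (hasSum_zero.congr_fun fun u => by simp)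
    rw [effCoupling, gammaFour, h6]
    simp
  · have h6 := summable_prod_stepWeight hd hlam h4
    have h7 := tsum_list_prod_eq (hasSum_stepWeight hd hC h2 h4).2 h6
    have h8 := (h5.prod_fiberwise fun _ => h6.hasSum.mul_left (-2 * lam)).unique (hasSum_fintype _)
    rw [Fintype.sum_bool] at h8
    set X := ∑' u : List (Mom d × Line (Deco d) × Line (Deco d)), (u.map (stepWeight C lam i)).prod
    have h9 : X * (1 + 2 * lam * effLoop C lam i) = 1 := by linear_combination h7
    have h10 := right_ne_zero_of_mul (h9.trans_ne one_ne_zero)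
    refine ⟨h10, ?_⟩
    rw [effCoupling, gammaFour, h8, eq_div_iff h10]
    linear_combination lam * h9

end Perturbative

end

end TGFT

end

theorem mainTheorem1 (d : ℕ) (hd : 3 ≤ d) (i : Fin d)
    (χ : TGFT.Mom d → ℝ) (Z m2 : ℝ) (r : ℝ → TGFT.Mom d → ℝ)
    (lamR Zlam : ℝ) (U : Set ℝ) (hU : IsOpen U)
    (hIR : TGFT.Perturbative χ Z m2 (fun _ => 0) (Zlam * lamR) i)
    (hpert : ∀ s ∈ U, TGFT.Perturbative χ Z m2 (r s) (Zlam * lamR) i)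
    (hren : TGFT.gammaFour (TGFT.covariance χ Z m2 (fun _ => 0)) (Zlam * lamR) i = 4 * lamR)
    (lam41 A : ℝ → ℝ) (AIR : ℝ)
    (hlam41 : ∀ s, lam41 s = TGFT.effCoupling (TGFT.covariance χ Z m2 (r s)) (Zlam * lamR) i)
    (hA : ∀ s, A s = TGFT.effLoop (TGFT.covariance χ Z m2 (r s)) (Zlam * lamR) i)
    (hAIR : AIR = TGFT.effLoop (TGFT.covariance χ Z m2 (fun _ => 0)) (Zlam * lamR) i) :
    (Summable fun p : {p : TGFT.Mom d // p i = 0} =>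
      TGFT.effPropagator (TGFT.covariance χ Z m2 (fun _ => 0)) (Zlam * lamR) p.1 ^ 2) ∧
    (∀ p, 1 - TGFT.covariance χ Z m2 (fun _ => 0) p *
      TGFT.selfEnergy (TGFT.covariance χ Z m2 (fun _ => 0)) (Zlam * lamR) p ≠ 0) ∧
    ∀ s ∈ U,
      (Summable fun p : {p : TGFT.Mom d // p i = 0} =>
        TGFT.effPropagator (TGFT.covariance χ Z m2 (r s)) (Zlam * lamR) p.1 ^ 2) ∧
      (∀ p, 1 - TGFT.covariance χ Z m2 (r s) p *
        TGFT.selfEnergy (TGFT.covariance χ Z m2 (r s)) (Zlam * lamR) p ≠ 0) ∧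
      1 + 2 * lamR * (A s - AIR) ≠ 0 ∧
      lam41 s = lamR / (1 + 2 * lamR * (A s - AIR)) ∧
      ∀ A' : ℝ, HasDerivAt A A' s → HasDerivAt lam41 (-2 * lam41 s ^ 2 * A') s := by
  set lam := Zlam * lamR
  obtain ⟨hIR1, -⟩ := TGFT.hasSum_stepWeight hd hIR.uv hIR.selfEnergy hIR.vertex
  obtain ⟨hIR3, hIR4⟩ := TGFT.effCoupling_eq hd hIR.uv hIR.selfEnergy hIR.vertex
  rw [← hAIR] at hIR3 hIR4
  have hlamR : lamR = lam / (1 + 2 * lam * AIR) := by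
    rw [← hIR4, TGFT.effCoupling, hren]
    ring
  refine ⟨hIR1, fun p => TGFT.one_sub_mul_selfEnergy_ne_zero hd (hIR.selfEnergy p), ?_⟩
  have key : ∀ s ∈ U, 1 + 2 * lam * A s ≠ 0 ∧ lam41 s = lam / (1 + 2 * lam * A s) := by
    intro s hs
    have := hpert s hs
    rw [hlam41, hA]
    exact TGFT.effCoupling_eq hd this.uv this.selfEnergy this.vertex
  intro s hs
  have hs' := hpert s hs
  obtain ⟨h1, h2⟩ := key s hs
  have h3 : 1 + 2 * lamR * (A s - AIR) = (1 + 2 * lam * A s) / (1 + 2 * lam * AIR) := by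
    rw [hlamR]
    field_simp
    ring
  refine ⟨(TGFT.hasSum_stepWeight hd hs'.uv hs'.selfEnergy hs'.vertex).1,
    fun p => TGFT.one_sub_mul_selfEnergy_ne_zero hd (hs'.selfEnergy p), ?_, ?_, ?_⟩
  · rw [h3]
    exact div_ne_zero h1 hIR3
  · rw [h3, h2, hlamR, div_div_div_cancel_right₀ hIR3]
  · intro A' hA'
    have h4 : HasDerivAt (fun t => lam / (1 + 2 * lam * A t)) (-2 * lam41 s ^ 2 * A') s := by
      have h5 : HasDerivAt (fun t => lam * (1 + 2 * lam * A t)⁻¹) _ s :=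
        (((hA'.const_mul (2 * lam)).const_add 1).fun_inv h1).const_mul lam
      refine h5.congr_deriv ?_
      rw [h2]
      generalize 1 + 2 * lam * A s = D
      ring
    refine h4.congr_of_eventuallyEq ?_
    filter_upwards [hU.mem_nhds hs] with t ht
    exact (key t ht).2
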